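/- Let $\Sigma_g$ denote the closed connected orientable surface of genus $g$. Let $M$ be a compact connected $3$-manifold whose boundary is $\Sigma_g\sqcup T_1\sqcup\dots\sqcup T_k$, where $g,k\ge 0$ and every $T_i$ is homeomorphic to the torus $\Sigma_1$. An ideal triangulation $\mathcal T$ of $M$ with $n$ tetrahedra is a realization of the interior of $M$, up to homeomorphism, as a gluing of $n$ copies of the standard tetrahedron with its four vertices removed, induced by a simplicial pairing of the faces of the tetrahedra. A vertex of a tetrahedron lies on the component of $\partial M$ to which the points of the tetrahedron converge in $M$ as they approach that vertex, and an edge of $\mathcal T$ connects the components on which its two endpoints lie. The incidence number of an edge of $\mathcal T$ is the number of tetrahedra incident to it, counted with multiplicity. Then every ideal triangulation $\mathcal T$ of $M$ has at least $g+k$ tetrahedra. If moreover $g\ge 2$ and $\mathcal T$ has exactly $g+k$ tetrahedra, then: - $g\ge k$; - for each $i=1,\dots,k$ there are exactly two tetrahedra of $\mathcal T$ with three vertices on $\Sigma_g$ and one vertex on $T_i$; the remaining $g-k$ tetrahedra have all four vertices on $\Sigma_g$; - $\mathcal T$ has exactly $k+1$ edges $e_0,\dots,e_k$, where $e_0$ has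 both endpoints on $\Sigma_g$ and incidence number $6g$, and, for each $i=1,\dots,k$, the edge $e_i$ connects $\Sigma_g$ to $T_i$ and has incidence number $6$. -/

import Mathlib

open scoped Topology

/-! ### Gluing simplices along a simplicial face-pairing -/

/-- A simplicial pairing of all the faces of `n` copies of the standard `d`-simplex. Face `f` of a
simplex is the one opposite to its vertex `f`. Face `f` of simplex `i` is glued to face
`perm i f f` of simplex `target i f`, each vertex `v ≠ f` of the former being sent to the vertex
`perm i f v` of the latter (the value `perm i f f` only records which face is reached).
The pairing is an involution on the faces, without fixed faces. -/
structure FacePairing (d n : ℕ) where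
  target : Fin n → Fin (d + 1) → Fin n
  perm : Fin n → Fin (d + 1) → Equiv.Perm (Fin (d + 1))
  target_target : ∀ i f, target (target i f) (perm i f f) = i
  perm_perm : ∀ i f, perm (target i f) (perm i f f) = (perm i f)⁻¹
  no_fixed_face : ∀ i f, (target i f, perm i f f) ≠ (i, f)

/-- The identifications induced by a face-pairing on `n` copies of a subset `S` of the standard
simplex (in barycentric coordinates): a point of face `f` of simplex `i` is identified with its
image under the simplicial map of that face. -/
def FacePairing.Rel {d n : ℕ} (P : FacePairing d n) (S : Set (Fin (d + 1) → ℝ))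
    (p q : Fin n × S) : Prop :=
  ∃ f, p.2.1 f = 0 ∧ q.1 = P.target p.1 f ∧ ∀ v, q.2.1 (P.perm p.1 f v) = p.2.1 v

/-- The space obtained from `n` copies of `S` by the identifications of a face-pairing, with the
quotient topology (`Quot` passes to the equivalence relation generated by `Rel`). -/
abbrev FacePairing.Glued {d n : ℕ} (P : FacePairing d n) (S : Set (Fin (d + 1) → ℝ)) : Type :=
  Quot (P.Rel S)

/-- The standard simplex with its vertices removed. -/
def puncturedSimplex (d : ℕ) : Set (Fin (d + 1) → ℝ) :=
  stdSimplex ℝ (Fin (d + 1)) \ Set.range fun v => Pi.single v 1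

/-! ### The closed orientable surface of genus `g` -/

/-- The `(4g+2)`-gon with vertices `p_0, …, p_{4g+1}` in cyclic order is cut from its centre `c`
into the triangles `j = (c, p_j, p_{j+1})`, with vertices numbered `0, 1, 2`. The face-pairing puts
the polygon together again (faces `1` and `2`) and identifies opposite sides of it by translation
(face `0`): the side from `p_j` to `p_{j+1}` is glued to the side from `p_{j+2g+2}` to
`p_{j+2g+1}`. -/
def oppositeSidesPairing (g : ℕ) : FacePairing 2 (4 * g + 2) where
  target j f := ![j + ⟨2 * g + 1, by omega⟩, j + 1, j - 1] f
  perm _ _ := Equiv.swap 1 2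
  target_target j f := by
    fin_cases f
    · have h : (⟨2 * g + 1, by omega⟩ : Fin (4 * g + 2)) + ⟨2 * g + 1, by omega⟩ = 0 := by
        apply Fin.ext
        rw [Fin.val_add]
        change (2 * g + 1 + (2 * g + 1)) % (4 * g + 2) = 0
        rw [show 2 * g + 1 + (2 * g + 1) = 4 * g + 2 by ring, Nat.mod_self]
      simp [Equiv.swap_apply_def, add_assoc, h]
    · simp
    · simp
  perm_perm _ _ := (Equiv.swap_inv 1 2).symm
  no_fixed_face j f := by
    fin_cases f
    · intro h
      have h1 := congrArg Prod.fst h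
      simp only [Fin.zero_eta, Matrix.cons_val_zero, add_eq_left] at h1
      have h2 := congrArg Fin.val h1
      change 2 * g + 1 = 0 at h2
      omega
    · simp
    · simp

/-- `Σ_g`: the regular `(4g+2)`-gon with opposite sides identified by translations, i.e. the closed
connected orientable surface of genus `g` (a sphere for `g = 0`, the hexagonal torus for
`g = 1`). -/
abbrev ClosedSurface (g : ℕ) : Type :=
  (oppositeSidesPairing g).Glued (stdSimplex ℝ (Fin 3))

/-! ### Three-manifolds with boundary and their ideal triangulations -/

/-- `M` is a topological 3-manifold with boundary `B`: around every point there is a chart onto an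
open subset of the closed half-space `{x | 0 ≤ x 0}` of `ℝ³` in which `B` corresponds to the
bounding plane. (Interior points have charts that miss the plane.) -/
def IsThreeManifoldWithBoundary (M : Type*) [TopologicalSpace M] (B : Set M) : Prop :=
  ∀ x : M, ∃ e : OpenPartialHomeomorph M (EuclideanHalfSpace 3),
    x ∈ e.source ∧ ∀ y ∈ e.source, y ∈ B ↔ (e y).1 0 = 0

/-- An ideal triangulation with `n` tetrahedra of a manifold `M` with boundary `B`: a realization
of the interior of `M` as a gluing of `n` copies of the tetrahedron with its vertices removed,
induced by a simplicial face-pairing of the tetrahedra. -/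
structure IdealTriangulation (n : ℕ) (M : Type*) [TopologicalSpace M] (B : Set M)
    extends FacePairing 3 n where
  homeo : toFacePairing.Glued (puncturedSimplex 3) ≃ₜ ↥(Bᶜ)

/-- Vertex `v` of tetrahedron `i` lies on the part `C` of the boundary: in `M`, the points of the
tetrahedron converge to `C` as they approach the (removed) vertex `v`. -/
def IdealTriangulation.VertexOn {n : ℕ} {M : Type*} [TopologicalSpace M] {B : Set M}
    (T : IdealTriangulation n M B) (i : Fin n) (v : Fin 4) (C : Set M) : Prop :=
  Filter.Tendsto (fun x : puncturedSimplex 3 => (T.homeo (Quot.mk _ (i, x)) : M))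
    (Filter.comap Subtype.val (𝓝 (Pi.single v 1))) (𝓝ˢ C)

/-- The edges of the `n` tetrahedra before gluing: a tetrahedron and two of its vertices. -/
abbrev TetrahedronEdge (n : ℕ) : Type := Fin n × {e : Finset (Fin 4) // e.card = 2}

/-- Two edges are identified by the pairing of a face that contains them (that is, of a face `f`
whose opposite vertex is not on the edge). -/
def FacePairing.EdgeRel {n : ℕ} (P : FacePairing 3 n) (p q : TetrahedronEdge n) : Prop :=
  ∃ f ∉ p.2.1, q.1 = P.target p.1 f ∧ q.2.1 = p.2.1.map (P.perm p.1 f).toEmbedding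

/-- The edges of the triangulation: the edges of the tetrahedra after gluing. -/
def FacePairing.Edge {n : ℕ} (P : FacePairing 3 n) : Type := Quot P.EdgeRel

/-- The incidence number of an edge: the number of tetrahedra incident to it, with multiplicity. -/
noncomputable def FacePairing.incidence {n : ℕ} (P : FacePairing 3 n) (e : P.Edge) : ℕ :=
  Nat.card {p : TetrahedronEdge n // (Quot.mk P.EdgeRel p : P.Edge) = e}

/-- The edge `e` joins the parts `C` and `D` of the boundary. -/
def IdealTriangulation.Joins {n : ℕ} {M : Type*} [TopologicalSpace M] {B : Set M}
    (T : IdealTriangulation n M B) (e : T.Edge) (C D : Set M) : Prop :=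
  ∃ (i : Fin n) (a b : Fin 4) (hab : a ≠ b),
    e = Quot.mk _ (i, ⟨{a, b}, Finset.card_pair hab⟩) ∧ T.VertexOn i a C ∧ T.VertexOn i b D

/-- The boundary component `Σ_g` of `M`, for an identification `h` of the boundary with the
disjoint union of `Σ_g` and `k` tori. -/
def genusComponent {g k : ℕ} {M : Type*} [TopologicalSpace M] {B : Set M}
    (h : B ≃ₜ ClosedSurface g ⊕ (Fin k × ClosedSurface 1)) : Set M :=
  Set.range fun s : ClosedSurface g => (h.symm (Sum.inl s) : M)

/-- The `i`-th toric boundary component `T_i` of `M`. -/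
def torusComponent {g k : ℕ} {M : Type*} [TopologicalSpace M] {B : Set M}
    (h : B ≃ₜ ClosedSurface g ⊕ (Fin k × ClosedSurface 1)) (i : Fin k) : Set M :=
  Set.range fun s : ClosedSurface 1 => (h.symm (Sum.inr (i, s)) : M)

/-!
The edges of the triangulation are counted with Euler characteristics, and their number is bounded
from below by a cohomological argument.

**Links and boundary components.** An ideal vertex has a neighbourhood that is a cone over its link,
a surface glued from triangles. The ideal vertices correspond to the boundary components
(`IdealTriangulation.exists_equiv_idealVertex`), and a link has the same first cohomology over
`ZMod 2` as the boundary component (`IdealTriangulation.finrank_transitions_linkGluing`). The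
cohomology used here is that of local cocycles (`IsLocalCocycle`) modulo those with a primitive
(`IsPrimitive`), which is defined for all subsets of the manifold, restricts to subsets, and is taut:
the cocycles and primitives on a compact set extend to its neighbourhoods. Neighbourhoods of the
boundary component and of the ideal vertex are interlaced; cocycles and primitives extend across the
boundary because the interior part of a small neighbourhood of a boundary point is a half-ball
(`IsThreeManifoldWithBoundary.exists_isLocalCocycle_extension`). For a gluing of triangles the
cohomology is computed by the combinatorial transition cocycles of double covers
(`TriangleGluing.IsModel`, `TriangleGluing.finrank_transitions`), which gives the Euler
characteristic: `2 V + 4 γ = F + 4` for the link of an ideal vertex at a component of genus `γ`, with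
`V` vertices and `F` triangles (`IdealTriangulation.two_mul_card_vertex_linkGluing`).

**Counting edges.** The sum of `F` over all links is `4 n`. The sum of `V` is the number of oriented
edges, which is twice the number of edges, unless an edge is glued to itself with reversed
orientation; then its midpoint would have the cone over a projective plane as a neighbourhood, while
a punctured ball of a 3-manifold has no nontrivial double cover
(`IdealTriangulation.not_eqvGen_swap`). Hence there are `n + 1 - g` edges.

**Few edges.** On the 2-skeleton with its ideal vertices restored, the coboundaries of functions on
the `k + 1` ideal vertices are a `k`-dimensional space of functions on the edges. The boundary of
a face, a sum of three edges, is a cycle that is not zero, so that this space is proper and there are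
at least `k + 1` edges (`FacePairing.card_idealVertex_le_card_edge`). This is `g + k ≤ n`. In the case
of equality the coboundaries are a hyperplane, so that all faces have the same boundary; this must be
a single edge, a loop at an ideal vertex `v₀`, and every other edge joins `v₀` to an ideal vertex of
its own (`FacePairing.exists_equiv_edge`). Thus the link of every ideal vertex other than `v₀` has
a single vertex, and the Euler relation says that it consists of `4 γ - 2` triangles, that is, of two
triangles for a torus. If `2 ≤ g`, then `v₀` has to be at the component of genus `g`, for otherwise
too many tetrahedra would be needed, and the remaining numbers follow.
-/

/-! ### Local cocycles with values in `ZMod 2` -/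

section LocalCocycles

variable {X Y : Type*} [TopologicalSpace X] [TopologicalSpace Y]

/-- A degree one local cocycle on `U`: for each `p ∈ U` the germ at `p` of `c p` is a function
with values in `ZMod 2`, and the germs at nearby points differ by a constant. It is a section of
the quotient of the sheaf of all functions `U → ZMod 2` by the constant sheaf. -/
def IsLocalCocycle (c : X → X → ZMod 2) (U : Set X) : Prop :=
  ∀ p ∈ U, ∀ᶠ q in 𝓝[U] p, ∀ᶠ x in 𝓝[U] q, c p x = c p q + c q x

/-- A primitive of a local cocycle: a (discontinuous) function with coboundary `c` near the
diagonal. Local cocycles modulo those having a primitive are `H¹(U; ZMod 2)`. -/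
def IsPrimitive (c : X → X → ZMod 2) (f : X → ZMod 2) (U : Set X) : Prop :=
  ∀ p ∈ U, ∀ᶠ q in 𝓝[U] p, c p q = f p + f q

theorem IsLocalCocycle.comp {c : X → X → ZMod 2} {U : Set X} (hc : IsLocalCocycle c U)
    {φ : Y → X} {V : Set Y} (hφ : ContinuousOn φ V) (hm : Set.MapsTo φ V U) :
    IsLocalCocycle (fun a b => c (φ a) (φ b)) V := by
  have key : ∀ p ∈ V, Filter.Tendsto φ (𝓝[V] p) (𝓝[U] (φ p)) := fun p hp =>
    (hφ p hp).tendsto_nhdsWithin hm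
  intro p hp
  filter_upwards [(key p hp).eventually (hc (φ p) (hm hp)), self_mem_nhdsWithin] with q hq hqV
  exact (key q hqV).eventually hq

theorem IsPrimitive.comp {c : X → X → ZMod 2} {f : X → ZMod 2} {U : Set X}
    (hf : IsPrimitive c f U) {φ : Y → X} {V : Set Y} (hφ : ContinuousOn φ V)
    (hm : Set.MapsTo φ V U) :
    IsPrimitive (fun a b => c (φ a) (φ b)) (fun a => f (φ a)) V := fun p hp =>
  ((hφ p hp).tendsto_nhdsWithin hm).eventually (hf (φ p) (hm hp))

theorem IsLocalCocycle.mono {c : X → X → ZMod 2} {U V : Set X} (hc : IsLocalCocycle c U)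
    (h : V ⊆ U) : IsLocalCocycle c V :=
  hc.comp (φ := id) continuousOn_id h

theorem IsPrimitive.mono {c : X → X → ZMod 2} {f : X → ZMod 2} {U V : Set X}
    (hc : IsPrimitive c f U) (h : V ⊆ U) : IsPrimitive c f V :=
  hc.comp (φ := id) continuousOn_id h

theorem IsLocalCocycle.add {c c' : X → X → ZMod 2} {U : Set X} (hc : IsLocalCocycle c U)
    (hc' : IsLocalCocycle c' U) : IsLocalCocycle (fun a b => c a b + c' a b) U := by
  intro p hp
  filter_upwards [hc p hp, hc' p hp] with q h h'
  filter_upwards [h, h'] with x hx hx'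
  rw [hx, hx']; ring

theorem IsLocalCocycle.self {c : X → X → ZMod 2} {U : Set X} (hc : IsLocalCocycle c U)
    {p : X} (hp : p ∈ U) : c p p = 0 := by
  have := ((hc p hp).self_of_nhdsWithin hp).self_of_nhdsWithin hp
  grind

/-- The germ `c p` of a local cocycle is a primitive near `p`. -/
theorem IsLocalCocycle.exists_isOpen {c : X → X → ZMod 2} {U : Set X} (hc : IsLocalCocycle c U)
    {p : X} (hp : p ∈ U) : ∃ O, IsOpen O ∧ p ∈ O ∧ IsPrimitive c (c p) (U ∩ O) := by
  obtain ⟨O, hO, hpO, h⟩ := mem_nhdsWithin.1 (hc p hp)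
  refine ⟨O, hO, hpO, fun q hq => ?_⟩
  have h1 : ∀ᶠ x in 𝓝[U] q, c p x = c p q + c q x := h ⟨hq.2, hq.1⟩
  filter_upwards [nhdsWithin_mono q Set.inter_subset_left h1] with x hx
  grind

theorem IsPrimitive.add_eq_add {c : X → X → ZMod 2} {f f' : X → ZMod 2} {U : Set X}
    (hf : IsPrimitive c f U) (hf' : IsPrimitive c f' U) (hU : IsPreconnected U) {x y : X}
    (hx : x ∈ U) (hy : y ∈ U) : f x + f' x = f y + f' y := by
  refine hU.induction₂' (fun x y => f x + f' x = f y + f' y) (fun p hp => ?_)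
    (fun x y z _ _ _ h h' => h.trans h') hx hy
  filter_upwards [hf p hp, hf' p hp] with q h h'
  grind

theorem IsPrimitive.congr {c : X → X → ZMod 2} {f f' : X → ZMod 2} {U : Set X}
    (hf : IsPrimitive c f U) (h : ∀ x ∈ U, f x = f' x) : IsPrimitive c f' U := by
  intro p hp
  filter_upwards [hf p hp, self_mem_nhdsWithin] with q hq hqU
  rw [hq, h p hp, h q hqU]

theorem IsPrimitive.add_const {c : X → X → ZMod 2} {f : X → ZMod 2} {U : Set X}
    (hf : IsPrimitive c f U) (a : ZMod 2) : IsPrimitive c (fun x => f x + a) U := by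
  intro p hp
  filter_upwards [hf p hp] with q hq
  grind

/-- Primitives on two relatively closed sets that agree on the overlap glue. -/
theorem IsPrimitive.union {c : X → X → ZMod 2} {f : X → ZMod 2} {A B : Set X}
    (hA : IsPrimitive c f A) (hB : IsPrimitive c f B) (h1 : B ∩ closure A ⊆ A)
    (h2 : A ∩ closure B ⊆ B) : IsPrimitive c f (A ∪ B) := by
  have key : ∀ (S T : Set X), IsPrimitive c f S → T ∩ closure S ⊆ S → ∀ p ∈ S ∪ T,
      ∀ᶠ q in 𝓝[S] p, c p q = f p + f q := by
    intro S T hS h p hp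
    by_cases hpS : p ∈ S
    · exact hS p hpS
    · have : p ∉ closure S := fun hc => hpS (h ⟨hp.resolve_left hpS, hc⟩)
      rw [mem_closure_iff_nhdsWithin_neBot, Filter.not_neBot] at this
      simp [this]
  intro p hp
  rw [nhdsWithin_union, Filter.eventually_sup]
  exact ⟨key A B hA h1 p hp, key B A hB h2 p hp.symm⟩

/-- Primitives on the members of an open cover glue if pairwise intersections are preconnected
and triple intersections are nonempty: the obstruction is a Čech 1-cocycle on the nerve of the
cover, whose 2-skeleton is that of a simplex. -/
theorem exists_isPrimitive_of_cover {ι : Type*} [Nonempty ι] {c : X → X → ZMod 2} {W : ι → Set X}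
    {U : Set X} (hU : U = ⋃ i, W i) (hW : ∀ i, IsOpen (W i))
    (hf : ∀ i, ∃ f, IsPrimitive c f (W i)) (h2 : ∀ i j, IsPreconnected (W i ∩ W j))
    (h3 : ∀ i j k, (W i ∩ W j ∩ W k).Nonempty) : ∃ f, IsPrimitive c f U := by
  choose f hf using hf
  obtain ⟨i₀⟩ := ‹Nonempty ι›
  have key : ∀ i j x y, x ∈ W i ∩ W j → y ∈ W i ∩ W j → f i x + f j x = f i y + f j y :=
    fun i j x y hx hy => ((hf i).mono Set.inter_subset_left).add_eq_add
      ((hf j).mono Set.inter_subset_right) (h2 i j) hx hy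
  have hz : ∀ i, ∃ z, z ∈ W i ∩ W i₀ := fun i => by
    obtain ⟨z, hz⟩ := h3 i i₀ i₀
    exact ⟨z, hz.1⟩
  choose z hz using hz
  set g : ι → X → ZMod 2 := fun i x => f i x + (f i (z i) + f i₀ (z i)) with hg
  have hgg : ∀ i j x, x ∈ W i → x ∈ W j → g i x = g j x := by
    intro i j x hi hj
    obtain ⟨w, ⟨hwi, hwj⟩, hw0⟩ := h3 i j i₀
    have e1 := key i j x w ⟨hi, hj⟩ ⟨hwi, hwj⟩
    have e2 := key i i₀ w (z i) ⟨hwi, hw0⟩ (hz i)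
    have e3 := key j i₀ w (z j) ⟨hwj, hw0⟩ (hz j)
    simp only [hg]
    grind
  classical
  refine ⟨fun x => if h : ∃ i, x ∈ W i then g h.choose x else 0, ?_⟩
  have hF : ∀ i, ∀ x ∈ W i, (if h : ∃ i, x ∈ W i then g h.choose x else 0) = g i x := by
    intro i x hx
    have h : ∃ i, x ∈ W i := ⟨i, hx⟩
    rw [dif_pos h]
    exact hgg _ _ x h.choose_spec hx
  intro p hp
  obtain ⟨i, hi⟩ := Set.mem_iUnion.1 (hU ▸ hp)
  have hWp : W i ∈ 𝓝 p := (hW i).mem_nhds hi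
  have := (hf i).add_const (f i (z i) + f i₀ (z i)) p hi
  rw [nhdsWithin_eq_nhds.2 hWp] at this
  filter_upwards [nhdsWithin_le_nhds this, nhdsWithin_le_nhds hWp] with q hq hqW
  rw [hF i p hi, hF i q hqW, hq]

/-- A cocycle on `K × [0, 1]` has a primitive near each segment `{x} × [0, 1]`. -/
theorem IsLocalCocycle.exists_isPrimitive_tube {c : X × ℝ → X × ℝ → ZMod 2} {K : Set X}
    (hc : IsLocalCocycle c (K ×ˢ Set.Icc 0 1)) {x : X} (hx : x ∈ K) :
    ∃ O, IsOpen O ∧ x ∈ O ∧ ∃ f, IsPrimitive c f ((K ∩ O) ×ˢ Set.Icc 0 1) := by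
  have hloc : ∀ s : Set.Icc (0 : ℝ) 1, ∃ O : Set X, IsOpen O ∧ x ∈ O ∧ ∃ J : Set ℝ, IsOpen J ∧
      (s : ℝ) ∈ J ∧ ∃ f, IsPrimitive c f ((K ∩ O) ×ˢ (Set.Icc 0 1 ∩ J)) := by
    intro s
    obtain ⟨O, hO, hpO, h⟩ := hc.exists_isOpen (p := (x, (s : ℝ))) ⟨hx, s.2⟩
    obtain ⟨O1, J, hO1, hJ, h1, h2, hsub⟩ := isOpen_prod_iff.1 hO x s hpO
    refine ⟨O1, hO1, h1, J, hJ, h2, _, h.mono ?_⟩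
    rintro ⟨y, t⟩ ⟨⟨hy, hy'⟩, ht, ht'⟩
    exact ⟨⟨hy, ht⟩, hsub ⟨hy', ht'⟩⟩
  choose O hO hxO J hJ hsJ f hf using hloc
  obtain ⟨t, ht0, htm, ⟨m, hm⟩, hcov⟩ := exists_monotone_Icc_subset_open_cover_Icc zero_le_one
    (c := fun s : Set.Icc (0 : ℝ) 1 => Subtype.val ⁻¹' J s)
    (fun s => (hJ s).preimage continuous_subtype_val)
    (fun s _ => Set.mem_iUnion.2 ⟨s, hsJ s⟩)
  have step : ∀ n, ∃ O, IsOpen O ∧ x ∈ O ∧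
      ∃ f, IsPrimitive c f ((K ∩ O) ×ˢ Set.Icc 0 (t n : ℝ)) := by
    intro n
    induction n with
    | zero =>
      refine ⟨O ⟨0, by simp⟩, hO _, hxO _, _, (hf ⟨0, by simp⟩).mono ?_⟩
      rintro ⟨y, s⟩ ⟨hy, hs1, hs2⟩
      have hs : s = 0 := le_antisymm (by simpa [ht0] using hs2) hs1
      subst hs
      exact ⟨hy, by simp, hsJ ⟨0, by simp⟩⟩
    | succ n ih =>
      obtain ⟨O1, hO1, hx1, Φ, hΦ⟩ := ih
      obtain ⟨s, hs⟩ := hcov n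
      have hle : (t n : ℝ) ≤ t (n + 1) := htm (Nat.le_succ n)
      have hφ : IsPrimitive c (f s) ((K ∩ (O1 ∩ O s)) ×ˢ Set.Icc (t n : ℝ) (t (n + 1))) := by
        refine (hf s).mono ?_
        rintro ⟨y, r⟩ ⟨hy, hr⟩
        have hr01 : r ∈ Set.Icc (0 : ℝ) 1 := ⟨(t n).2.1.trans hr.1, hr.2.trans (t (n + 1)).2.2⟩
        have hmem : (⟨r, hr01⟩ : Set.Icc (0 : ℝ) 1) ∈ Set.Icc (t n) (t (n + 1)) := hr
        exact ⟨⟨hy.1, hy.2.2⟩, hr01, hs hmem⟩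
      have hΦ' : IsPrimitive c Φ ((K ∩ (O1 ∩ O s)) ×ˢ Set.Icc 0 (t n : ℝ)) := by
        refine hΦ.mono ?_
        rintro ⟨y, r⟩ ⟨hy, hr⟩
        exact ⟨⟨hy.1, hy.2.1⟩, hr⟩
      -- on the next slab the primitive is corrected by its (locally constant) difference with
      -- the previous one along the common wall
      have hφ' : IsPrimitive c (fun p => f s p + (f s (p.1, t n) + Φ (p.1, t n)))
          ((K ∩ (O1 ∩ O s)) ×ˢ Set.Icc (t n : ℝ) (t (n + 1))) := by
        rintro ⟨y, r⟩ ⟨hy, hr⟩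
        have hlc : ∀ᶠ q in 𝓝[K ∩ (O1 ∩ O s)] y,
            f s (q, t n) + Φ (q, t n) = f s (y, t n) + Φ (y, t n) := by
          have hcont : ContinuousOn (fun q : X => (q, (t n : ℝ))) (K ∩ (O1 ∩ O s)) := by fun_prop
          have e1 := (hφ.comp hcont fun q hq => ⟨hq, le_rfl, hle⟩) y hy
          have e2 := (hΦ'.comp hcont fun q hq => ⟨hq, (t n).2.1, le_rfl⟩) y hy
          filter_upwards [e1, e2] with q h1 h2
          grind
        have hfst : Filter.Tendsto Prod.fst
            (𝓝[(K ∩ (O1 ∩ O s)) ×ˢ Set.Icc (t n : ℝ) (t (n + 1))] (y, r))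
            (𝓝[K ∩ (O1 ∩ O s)] y) :=
          continuous_fst.continuousWithinAt.tendsto_nhdsWithin fun q hq => hq.1
        filter_upwards [hφ (y, r) ⟨hy, hr⟩, hfst.eventually hlc] with q h1 h2
        grind
      classical
      refine ⟨O1 ∩ O s, hO1.inter (hO s), ⟨hx1, hxO s⟩,
        fun p => if p.2 ≤ t n then Φ p else f s p + (f s (p.1, t n) + Φ (p.1, t n)), ?_⟩
      have hsplit : (K ∩ (O1 ∩ O s)) ×ˢ Set.Icc 0 (t (n + 1) : ℝ)
          = (K ∩ (O1 ∩ O s)) ×ˢ Set.Icc 0 (t n : ℝ)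
            ∪ (K ∩ (O1 ∩ O s)) ×ˢ Set.Icc (t n : ℝ) (t (n + 1)) := by
        rw [← Set.prod_union, Set.Icc_union_Icc_eq_Icc (t n).2.1 hle]
      rw [hsplit]
      refine IsPrimitive.union (hΦ'.congr ?_) (hφ'.congr ?_) ?_ ?_
      · rintro ⟨y, r⟩ ⟨hy, hr⟩
        rw [if_pos hr.2]
      · rintro ⟨y, r⟩ ⟨hy, hr⟩
        dsimp only
        split_ifs with h
        · have : r = t n := le_antisymm h hr.1
          subst this
          grind
        · rfl
      · rintro ⟨y, r⟩ ⟨⟨hy, hr⟩, hcl⟩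
        rw [closure_prod_eq] at hcl
        exact ⟨hy, by simpa using hcl.2⟩
      · rintro ⟨y, r⟩ ⟨⟨hy, hr⟩, hcl⟩
        rw [closure_prod_eq] at hcl
        exact ⟨hy, by simpa using hcl.2⟩
  have := step m
  rwa [hm m le_rfl] at this

/-- Homotopy invariance, in the form needed: a contraction of `K` to a point inside `K` provides
a primitive of every local cocycle on `K`. -/
theorem IsLocalCocycle.exists_isPrimitive_of_starConvex {E : Type*} [AddCommGroup E] [Module ℝ E]
    [TopologicalSpace E] [IsTopologicalAddGroup E] [ContinuousSMul ℝ E] {c : E → E → ZMod 2}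
    {K : Set E} (hc : IsLocalCocycle c K) {x₀ : E} (hK : StarConvex ℝ x₀ K) :
    ∃ f, IsPrimitive c f K := by
  set H : E × ℝ → E := fun p => x₀ + p.2 • (p.1 - x₀) with hH
  have hHc : Continuous H := by fun_prop
  have hHK : Set.MapsTo H (K ×ˢ Set.Icc 0 1) K := by
    rintro ⟨x, t⟩ ⟨hx, ht⟩
    have := hK hx (sub_nonneg.2 ht.2) ht.1 (by ring)
    convert this using 1
    simp only [hH]
    module
  have hc' := hc.comp hHc.continuousOn hHK
  have ht := fun x (hx : x ∈ K) => hc'.exists_isPrimitive_tube hx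
  choose! O hO hxO Φ hΦ using ht
  have hH1 : ∀ x, H (x, 1) = x := by intro x; simp [hH]
  have hH0 : ∀ x, H (x, 0) = x₀ := by intro x; simp [hH]
  refine ⟨fun x => Φ x (x, 1) + Φ x (x, 0), fun p hp => ?_⟩
  have hx0 : x₀ ∈ K := by simpa [hH0] using hHK (x := (p, 0)) ⟨hp, by simp⟩
  have h1 := ((hΦ p hp).comp (φ := fun x : E => (x, (1 : ℝ))) (V := K ∩ O p) (by fun_prop)
    (fun x hx => ⟨hx, by simp⟩)) p ⟨hp, hxO p hp⟩
  have h0 := ((hΦ p hp).comp (φ := fun x : E => (x, (0 : ℝ))) (V := K ∩ O p) (by fun_prop)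
    (fun x hx => ⟨hx, by simp⟩)) p ⟨hp, hxO p hp⟩
  rw [nhdsWithin_inter_of_mem' (nhdsWithin_le_nhds ((hO p hp).mem_nhds (hxO p hp)))] at h1 h0
  filter_upwards [h1, h0, self_mem_nhdsWithin,
    nhdsWithin_le_nhds ((hO p hp).mem_nhds (hxO p hp))] with q e1 e0 hqK hqO
  -- the increment along `{q} × [0, 1]` does not depend on the primitive used
  have key : Φ p (q, 1) + Φ q (q, 1) = Φ p (q, 0) + Φ q (q, 0) := by
    have hcont : ContinuousOn (fun t : ℝ => (q, t)) (Set.Icc 0 1) := by fun_prop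
    exact ((hΦ p hp).comp hcont fun t ht => ⟨⟨hqK, hqO⟩, ht⟩).add_eq_add
      ((hΦ q hqK).comp hcont fun t ht => ⟨⟨hqK, hxO q hqK⟩, ht⟩) isPreconnected_Icc
      (by simp) (by simp)
  simp only [hH1, hH0, hc.self hx0] at e1 e0
  grind

theorem IsLocalCocycle.exists_isPrimitive_of_convex {E : Type*} [AddCommGroup E] [Module ℝ E]
    [TopologicalSpace E] [IsTopologicalAddGroup E] [ContinuousSMul ℝ E] {c : E → E → ZMod 2}
    {K : Set E} (hc : IsLocalCocycle c K) (hK : Convex ℝ K) : ∃ f, IsPrimitive c f K := by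
  rcases K.eq_empty_or_nonempty with rfl | ⟨x, hx⟩
  · exact ⟨0, fun p hp => hp.elim⟩
  · exact hc.exists_isPrimitive_of_starConvex (hK.starConvex hx)

end LocalCocycles

/-! ### Double covers, and extension of cocycles to neighbourhoods -/

section TwistedSections

/-- The sign `(-1)^e`. -/
def zmodSign (e : ZMod 2) : ℝ := if e = 0 then 1 else -1

theorem zmodSign_add (a b : ZMod 2) : zmodSign (a + b) = zmodSign a * zmodSign b := by
  have : ∀ e : ZMod 2, e = 0 ∨ e = 1 := by decide
  have h2 : (1 : ZMod 2) + 1 = 0 := by decide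
  rcases this a with rfl | rfl <;> rcases this b with rfl | rfl <;> simp [zmodSign, h2]

theorem zmodSign_mul_self (a : ZMod 2) : zmodSign a * zmodSign a = 1 := by
  unfold zmodSign; split_ifs <;> norm_num

theorem zmodSign_ne_zero (a : ZMod 2) : zmodSign a ≠ 0 := by
  unfold zmodSign; split_ifs <;> norm_num

theorem zmodSign_injective : Function.Injective zmodSign := by
  have : ∀ e : ZMod 2, e = 0 ∨ e = 1 := by decide
  intro a b h
  rcases this a with rfl | rfl <;> rcases this b with rfl | rfl <;>
    first | rfl | norm_num [zmodSign] at h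

theorem zmodSign_mul_neg_iff {a : ZMod 2} {r : ℝ} (hr : 0 < r) :
    (if zmodSign a * r < 0 then (1 : ZMod 2) else 0) = a := by
  have : ∀ e : ZMod 2, e = 0 ∨ e = 1 := by decide
  rcases this a with rfl | rfl <;> simp [zmodSign, hr, hr.le]

/-- A strict cocycle on `U`: the cocycle identity holds for all triples of points in a
neighbourhood of any point of `U`. -/
def IsStrictCocycle {X : Type*} [TopologicalSpace X] (c : X → X → ZMod 2) (U : Set X) : Prop :=
  ∀ p ∈ U, ∃ W ∈ 𝓝[U] p, ∀ x ∈ W, ∀ y ∈ W, ∀ z ∈ W, c x z = c x y + c y z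

theorem IsStrictCocycle.isLocalCocycle {X : Type*} [TopologicalSpace X] {c : X → X → ZMod 2}
    {U : Set X} (h : IsStrictCocycle c U) : IsLocalCocycle c U := by
  intro p hp
  obtain ⟨W, hW, hWc⟩ := h p hp
  have hpW := mem_of_mem_nhdsWithin hp hW
  filter_upwards [eventually_eventually_nhdsWithin.2 hW, hW] with q hq hqW
  filter_upwards [hq] with x hx
  exact hWc p hpW q hqW x hx

/-- Let `π` be a hereditarily quotient map (this is `hnhds`) from `V` onto `U`, and `F` a nowhere
vanishing function on `V` that descends to `U` up to sign, i.e. a nowhere vanishing section of a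
sum of copies of a real line bundle on `U` with structure group `{±1}`. The double cover of `U`
given by the signs is described by a strict cocycle `c` on `U`, and the sign by which `F` differs
from a (discontinuous) function on `U` is a primitive of the pullback of `c` to `V`. -/
theorem exists_isStrictCocycle_of_section {X Y E : Type*} [TopologicalSpace X]
    [TopologicalSpace Y] [NormedAddCommGroup E] [InnerProductSpace ℝ E] {π : Y → X} {V : Set Y}
    {F : Y → E} (hF : ContinuousOn F V) (hF0 : ∀ y ∈ V, F y ≠ 0)
    (hpm : ∀ y ∈ V, ∀ y' ∈ V, π y = π y' → ∃ e, F y' = zmodSign e • F y)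
    (hnhds : ∀ x ∈ π '' V, ∀ s : Set X, (∀ y ∈ V, π y = x → ∀ᶠ y' in 𝓝[V] y, π y' ∈ s) →
      s ∈ 𝓝[π '' V] x) :
    ∃ (c : X → X → ZMod 2) (ε : Y → ZMod 2), IsStrictCocycle c (π '' V) ∧
      IsPrimitive (fun y y' => c (π y) (π y')) ε V ∧
      ∀ y ∈ V, ∀ y' ∈ V, π y = π y' → F y' = zmodSign (ε y + ε y') • F y := by
  classical
  set s : X → E := fun x => if h : ∃ y ∈ V, π y = x then F h.choose else 0 with hs
  have hsF : ∀ y ∈ V, ∃ e, F y = zmodSign e • s (π y) := by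
    intro y hy
    have h : ∃ y' ∈ V, π y' = π y := ⟨y, hy, rfl⟩
    simp only [hs, dif_pos h]
    exact hpm _ h.choose_spec.1 _ hy h.choose_spec.2
  choose! ε hε using hsF
  have hsε : ∀ y ∈ V, s (π y) = zmodSign (ε y) • F y := by
    intro y hy
    rw [hε y hy, smul_smul, zmodSign_mul_self, one_smul]
  have hs0 : ∀ y ∈ V, s (π y) ≠ 0 := by
    intro y hy
    rw [hsε y hy]
    exact smul_ne_zero (zmodSign_ne_zero _) (hF0 y hy)
  have hpos : ∀ v : E, v ≠ 0 → ∃ N ∈ 𝓝 v, ∀ a ∈ N, ∀ b ∈ N, 0 < inner ℝ a b := by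
    intro v hv
    have hc : Continuous fun p : E × E => inner ℝ p.1 p.2 := by fun_prop
    have : {p : E × E | 0 < inner ℝ p.1 p.2} ∈ 𝓝 (v, v) :=
      (isOpen_lt continuous_const hc).mem_nhds (real_inner_self_pos.2 hv)
    rw [nhds_prod_eq, Filter.mem_prod_same_iff] at this
    obtain ⟨N, hN, hsub⟩ := this
    exact ⟨N, hN, fun a ha b hb => hsub (Set.mk_mem_prod ha hb)⟩
  have hinner : ∀ (a b : ZMod 2) (v w : E),
      inner ℝ (zmodSign a • v) (zmodSign b • w) = zmodSign (a + b) * inner ℝ v w := by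
    intro a b v w
    rw [inner_smul_left, inner_smul_right, zmodSign_add]
    simp
    ring
  refine ⟨fun x x' => if inner ℝ (s x) (s x') < 0 then 1 else 0, ε, ?_, ?_, ?_⟩
  · rintro _ ⟨y, hy, rfl⟩
    obtain ⟨N, hN, hNpos⟩ := hpos (s (π y)) (hs0 y hy)
    refine ⟨{x | ∃ e, zmodSign e • s x ∈ N}, hnhds _ ⟨y, hy, rfl⟩ _ ?_, ?_⟩
    · intro y' hy' hyy
      have ht : Filter.Tendsto (fun z => zmodSign (ε y') • F z) (𝓝[V] y') (𝓝 (s (π y))) := by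
        rw [← hyy, hsε y' hy']
        exact (hF y' hy').const_smul _
      filter_upwards [ht hN, self_mem_nhdsWithin] with z hz hzV
      refine ⟨ε y' + ε z, ?_⟩
      rw [zmodSign_add, mul_smul, ← hε z hzV]
      exact hz
    · have key : ∀ x x' e e', zmodSign e • s x ∈ N → zmodSign e' • s x' ∈ N →
          (if inner ℝ (s x) (s x') < 0 then (1 : ZMod 2) else 0) = e + e' := by
        intro x x' e e' h h'
        have hp := hNpos _ h _ h'
        have : inner ℝ (s x) (s x') = zmodSign (e + e') *
            inner ℝ (zmodSign e • s x) (zmodSign e' • s x') := by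
          rw [hinner, ← mul_assoc, zmodSign_mul_self, one_mul]
        rw [this, zmodSign_mul_neg_iff hp]
      rintro x ⟨e, hx⟩ y ⟨e', hy⟩ z ⟨e'', hz⟩
      dsimp only
      rw [key _ _ _ _ hx hy, key _ _ _ _ hx hz, key _ _ _ _ hy hz]
      grind
  · intro y hy
    obtain ⟨N, hN, hNpos⟩ := hpos (F y) (hF0 y hy)
    filter_upwards [hF y hy hN, self_mem_nhdsWithin] with z hz hzV
    rw [hsε y hy, hsε z hzV, hinner,
      zmodSign_mul_neg_iff (hNpos _ (mem_of_mem_nhds hN) _ hz)]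
  · intro y hy y' hy' h
    rw [hε y' hy', ← h, hsε y hy, smul_smul, add_comm, zmodSign_add]

end TwistedSections

section Tautness

/-- A strict cocycle on a compact subset of a metrizable space extends to a neighbourhood, by
composition with a nearest point map (which is continuous at the points of the compact set). -/
theorem IsStrictCocycle.exists_extension {M : Type*} [TopologicalSpace M]
    [TopologicalSpace.MetrizableSpace M] {c : M → M → ZMod 2} {C : Set M} (hC : IsCompact C)
    (hc : IsStrictCocycle c C) : ∃ (U : Set M) (c' : M → M → ZMod 2), IsOpen U ∧ C ⊆ U ∧
      IsLocalCocycle c' U ∧ ∀ x ∈ C, ∀ y ∈ C, c' x y = c x y := by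
  let _ := TopologicalSpace.metrizableSpaceMetric M
  rcases C.eq_empty_or_nonempty with rfl | hne
  · exact ⟨∅, c, isOpen_empty, le_rfl, fun p hp => hp.elim, fun x hx => hx.elim⟩
  choose r hrC hr using fun x => hC.exists_infDist_eq_dist hne x
  have hrid : ∀ x ∈ C, r x = x := by
    intro x hx
    have := hr x
    rw [Metric.infDist_zero_of_mem hx] at this
    exact (dist_eq_zero.1 this.symm).symm
  have hcont : ∀ x ∈ C, ∀ W ∈ 𝓝[C] x, ∀ᶠ y in 𝓝 x, r y ∈ W := by
    intro x hx W hW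
    obtain ⟨δ, hδ, hsub⟩ := Metric.mem_nhdsWithin_iff.1 hW
    filter_upwards [Metric.ball_mem_nhds x (half_pos hδ)] with y hy
    refine hsub ⟨?_, hrC y⟩
    have h1 : dist y (r y) ≤ dist y x := (hr y) ▸ Metric.infDist_le_dist_of_mem hx
    have h2 : dist (r y) x ≤ dist y (r y) + dist y x := dist_triangle_left _ _ _
    rw [Metric.mem_ball] at hy ⊢
    linarith
  choose! W hW hWc using hc
  have hO : ∀ p ∈ C, ∃ O, IsOpen O ∧ p ∈ O ∧ ∀ y ∈ O, r y ∈ W p := by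
    intro p hp
    obtain ⟨O, h1, h2, h3⟩ := eventually_nhds_iff.1 (hcont p hp (W p) (hW p hp))
    exact ⟨O, h2, h3, h1⟩
  choose! O hO hpO hOW using hO
  refine ⟨⋃ p ∈ C, O p, fun x y => c (r x) (r y), isOpen_biUnion fun p hp => hO p hp,
    fun p hp => Set.mem_biUnion hp (hpO p hp), IsStrictCocycle.isLocalCocycle ?_, ?_⟩
  · intro x hx
    obtain ⟨p, hp, hxp⟩ := Set.mem_iUnion₂.1 hx
    exact ⟨O p, mem_nhdsWithin_of_mem_nhds ((hO p hp).mem_nhds hxp), fun x hx y hy z hz =>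
      hWc p hp _ (hOW p hp x hx) _ (hOW p hp y hy) _ (hOW p hp z hz)⟩
  · intro x hx y hy
    simp only [hrid x hx, hrid y hy]

/-- A primitive on a compact subset extends to a primitive on a neighbourhood. -/
theorem IsPrimitive.exists_extension {M : Type*} [TopologicalSpace M] [RegularSpace M]
    {c : M → M → ZMod 2} {C U : Set M} (hC : IsCompact C) (hU : IsOpen U) (hCU : C ⊆ U)
    (hc : IsLocalCocycle c U) {f : M → ZMod 2} (hf : IsPrimitive c f C) :
    ∃ (U' : Set M) (f' : M → ZMod 2), IsOpen U' ∧ C ⊆ U' ∧ U' ⊆ U ∧ IsPrimitive c f' U' := by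
  classical
  -- the local extensions are the functions `σ q = c q + f q`
  set σ : M → M → ZMod 2 := fun q x => c q x + f q with hσ
  have hW : ∀ q ∈ C, ∃ W, IsOpen W ∧ q ∈ W ∧ W ⊆ U ∧ IsPrimitive c (c q) W ∧
      ∀ q' ∈ W ∩ C, c q q' = f q + f q' := by
    intro q hq
    obtain ⟨O, hO, hqO, hprim⟩ := hc.exists_isOpen (hCU hq)
    obtain ⟨O', hO', hqO', h⟩ := mem_nhdsWithin.1 (hf q hq)
    exact ⟨U ∩ O ∩ O', (hU.inter hO).inter hO', ⟨⟨hCU hq, hqO⟩, hqO'⟩,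
      fun x hx => hx.1.1, hprim.mono Set.inter_subset_left, fun q' hq' => h ⟨hq'.1.2, hq'.2⟩⟩
  choose! W hWo hqW hWU hWp hWf using hW
  have hloc : ∀ q ∈ C, ∀ q' ∈ W q ∩ C, ∀ᶠ x in 𝓝 q', σ q x = σ q' x := by
    intro q hq q' hq'
    have := hWp q hq q' hq'.1
    rw [(hWo q hq).nhdsWithin_eq hq'.1] at this
    filter_upwards [this] with x hx
    have := hWf q hq q' hq'
    simp only [hσ]
    grind
  have hN : ∀ q ∈ C, ∃ N ∈ 𝓝 q, IsClosed N ∧ N ⊆ W q := fun q hq =>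
    exists_mem_nhds_isClosed_subset ((hWo q hq).mem_nhds (hqW q hq))
  choose! N hNq hNc hNW using hN
  obtain ⟨t, htC, hcov⟩ := hC.elim_nhds_subcover (fun q => interior (N q))
    (fun q hq => isOpen_interior.mem_nhds (mem_interior_iff_mem_nhds.2 (hNq q hq)))
  set f' : M → ZMod 2 := fun x => if h : ∃ q ∈ t, x ∈ interior (N q) then σ h.choose x else 0
    with hf'
  have key : ∀ q ∈ C, ∀ᶠ x in 𝓝 q, f' x = σ q x := by
    intro q hq
    have h1 : ∀ᶠ x in 𝓝 q, ∃ i ∈ t, x ∈ interior (N i) := by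
      obtain ⟨i, hi, hqi⟩ := Set.mem_iUnion₂.1 (hcov hq)
      filter_upwards [isOpen_interior.mem_nhds hqi] with x hx using ⟨i, hi, hx⟩
    have h2 : ∀ᶠ x in 𝓝 q, ∀ i ∈ t, x ∈ interior (N i) → σ i x = σ q x := by
      rw [Filter.eventually_all_finset]
      intro i hi
      by_cases hqi : q ∈ N i
      · filter_upwards [hloc i (htC i hi) q ⟨hNW i (htC i hi) hqi, hq⟩] with x hx _ using hx
      · filter_upwards [(hNc i (htC i hi)).isOpen_compl.mem_nhds hqi] with x hx hx'
        exact (hx (interior_subset hx')).elim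
    filter_upwards [h1, h2] with x hx1 hx2
    simp only [hf', dif_pos hx1]
    exact hx2 _ hx1.choose_spec.1 hx1.choose_spec.2
  have hO : ∀ q ∈ C, ∃ O, IsOpen O ∧ q ∈ O ∧ ∀ y ∈ O, f' y = σ q y := by
    intro p hp
    obtain ⟨O, h1, h2, h3⟩ := eventually_nhds_iff.1 (key p hp)
    exact ⟨O, h2, h3, h1⟩
  choose! O hO hqO hOf using hO
  refine ⟨⋃ q ∈ C, O q ∩ W q, f', isOpen_biUnion fun q hq => (hO q hq).inter (hWo q hq),
    fun q hq => Set.mem_biUnion hq ⟨hqO q hq, hqW q hq⟩,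
    Set.iUnion₂_subset fun q hq x hx => hWU q hq hx.2, fun p hp => ?_⟩
  obtain ⟨q, hq, hpO, hpW⟩ := Set.mem_iUnion₂.1 hp
  refine nhdsWithin_le_nhds ?_
  have := hWp q hq p hpW
  rw [(hWo q hq).nhdsWithin_eq hpW] at this
  filter_upwards [this, (hO q hq).mem_nhds hpO] with x hx hxO
  rw [hOf q hq p hpO, hOf q hq x hxO]
  simp only [hσ]
  grind

end Tautness

/-! ### Triangulated surfaces as gluings of triangles -/

/-- A gluing of triangles indexed by `I` along a simplicial pairing of their sides, with the
conventions of `FacePairing`: side `F` is opposite to vertex `F`, and it is glued to the side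
`perm t F F` of the triangle `target t F`. -/
structure TriangleGluing (I : Type*) where
  target : I → Fin 3 → I
  perm : I → Fin 3 → Equiv.Perm (Fin 3)
  target_target : ∀ t F, target (target t F) (perm t F F) = t
  perm_perm : ∀ t F, perm (target t F) (perm t F F) = (perm t F)⁻¹
  no_fixed_side : ∀ t F, (target t F, perm t F F) ≠ (t, F)

namespace TriangleGluing

open Module

variable {I : Type*} (P : TriangleGluing I)

/-- The involution on the sides. -/
def sideMap (x : I × Fin 3) : I × Fin 3 := (P.target x.1 x.2, P.perm x.1 x.2 x.2)

theorem sideMap_sideMap (x : I × Fin 3) : P.sideMap (P.sideMap x) = x := by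
  obtain ⟨t, F⟩ := x
  simp [sideMap, P.target_target, P.perm_perm]

theorem sideMap_ne (x : I × Fin 3) : P.sideMap x ≠ x := P.no_fixed_side x.1 x.2

/-- The corner `u` of triangle `t`, on a side `F`, is glued to a corner of the adjacent triangle. -/
def CornerRel (x y : I × Fin 3) : Prop :=
  ∃ F ≠ x.2, y.1 = P.target x.1 F ∧ y.2 = P.perm x.1 F x.2

/-- The vertices of the glued surface. -/
def Vertex : Type _ := Quot P.CornerRel

/-- The triangles cannot be divided into two families without common sides. -/
def IsConnected : Prop :=
  ∀ Q : I → Prop, (∀ t F, Q t → Q (P.target t F)) → ∀ t t', Q t → Q t'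

/-- Functions on the corners whose jump across each side is the same at both its ends. -/
def jumpSpace : Submodule (ZMod 2) (I × Fin 3 → ZMod 2) where
  carrier := {g | ∀ t F u w, u ≠ F → w ≠ F → g (t, u) + g (P.target t F, P.perm t F u) =
    g (t, w) + g (P.target t F, P.perm t F w)}
  add_mem' {g g'} hg hg' t F u w hu hw := by
    have h1 := hg t F u w hu hw
    have h2 := hg' t F u w hu hw
    simp only [Pi.add_apply]
    grind
  zero_mem' := by simp
  smul_mem' a g hg t F u w hu hw := by
    simp only [Pi.smul_apply, smul_eq_mul, ← mul_add, hg t F u w hu hw]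

/-- The jump across the sides of a function on the corners. -/
def jump : (I × Fin 3 → ZMod 2) →ₗ[ZMod 2] (I × Fin 3 → ZMod 2) where
  toFun g x := g (x.1, x.2 + 1) + g (P.target x.1 x.2, P.perm x.1 x.2 (x.2 + 1))
  map_add' g g' := by ext x; simp only [Pi.add_apply]; ring
  map_smul' a g := by ext x; simp [mul_add]

/-- The transition cocycles: functions on the sides that are jumps. They are the gluing data of
double covers of the surface that are trivialized over each triangle; the existence of the
function on the corners says that the holonomy around each vertex is trivial. -/
def transitions : Submodule (ZMod 2) (I × Fin 3 → ZMod 2) := P.jumpSpace.map P.jump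

/-- The jumps of functions that are constant on each triangle. -/
def triangleJump : (I → ZMod 2) →ₗ[ZMod 2] (I × Fin 3 → ZMod 2) where
  toFun h x := h x.1 + h (P.target x.1 x.2)
  map_add' g g' := by ext x; simp only [Pi.add_apply]; ring
  map_smul' a g := by ext x; simp [mul_add]

/-- The transition cocycles of trivial double covers. -/
def trivialTransitions : Submodule (ZMod 2) (I × Fin 3 → ZMod 2) := LinearMap.range P.triangleJump

theorem mem_transitions {a : I × Fin 3 → ZMod 2} : a ∈ P.transitions ↔ ∃ g : I × Fin 3 → ZMod 2,
    ∀ t F u, u ≠ F → g (t, u) + g (P.target t F, P.perm t F u) = a (t, F) := by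
  have hne : ∀ F : Fin 3, F + 1 ≠ F := by decide
  constructor
  · rintro ⟨g, hg, rfl⟩
    exact ⟨g, fun t F u hu => hg t F u (F + 1) hu (hne F)⟩
  · rintro ⟨g, hg⟩
    refine ⟨g, fun t F u w hu hw => by rw [hg t F u hu, hg t F w hw], ?_⟩
    ext ⟨t, F⟩
    exact hg t F (F + 1) (hne F)

theorem mem_trivialTransitions {a : I × Fin 3 → ZMod 2} : a ∈ P.trivialTransitions ↔
    ∃ h : I → ZMod 2, ∀ t F, h t + h (P.target t F) = a (t, F) := by
  simp only [trivialTransitions, LinearMap.mem_range, funext_iff, Prod.forall]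
  rfl

theorem trivialTransitions_le : P.trivialTransitions ≤ P.transitions := by
  intro a ha
  obtain ⟨h, hh⟩ := P.mem_trivialTransitions.1 ha
  exact P.mem_transitions.2 ⟨fun x => h x.1, fun t F u _ => hh t F⟩

/-- Functions invariant under a fixed point free involution form a space of half dimension. -/
theorem two_mul_finrank_invariants {X : Type*} [Fintype X] (τ : X → X) (h1 : ∀ x, τ (τ x) = x)
    (h2 : ∀ x, τ x ≠ x) (S : Submodule (ZMod 2) (X → ZMod 2))
    (hS : ∀ b, b ∈ S ↔ ∀ x, b (τ x) = b x) : 2 * finrank (ZMod 2) S = Fintype.card X := by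
  classical
  let T : (X → ZMod 2) →ₗ[ZMod 2] (X → ZMod 2) :=
    { toFun := fun g x => g x + g (τ x)
      map_add' := fun g g' => by ext x; simp only [Pi.add_apply]; ring
      map_smul' := fun a g => by ext x; simp [mul_add] }
  have hker : LinearMap.ker T = S := by
    ext g
    rw [LinearMap.mem_ker, hS, funext_iff]
    refine forall_congr' fun x => ?_
    change g x + g (τ x) = 0 ↔ _
    constructor <;> intro h <;> grind
  have hrange : LinearMap.range T = S := by
    ext b
    rw [hS]
    constructor
    · rintro ⟨g, rfl⟩ x
      change g (τ x) + g (τ (τ x)) = g x + g (τ x)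
      rw [h1, add_comm]
    · intro hb
      have e := Fintype.equivFin X
      refine ⟨fun x => if e x < e (τ x) then b x else 0, ?_⟩
      ext x
      change (if e x < e (τ x) then b x else 0) +
        (if e (τ x) < e (τ (τ x)) then b (τ x) else 0) = b x
      rw [h1, hb]
      have : e x ≠ e (τ x) := fun h => h2 x (e.injective h).symm
      rcases lt_or_gt_of_ne this with h | h
      · rw [if_pos h, if_neg h.not_gt, add_zero]
      · rw [if_neg h.not_gt, if_pos h, zero_add]
  have := LinearMap.finrank_range_add_finrank_ker T
  rw [hker, hrange, Module.finrank_fintype_fun_eq_card] at this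
  omega

/-- The functions constant along a relation are the functions on its quotient. -/
theorem finrank_eq_card_quot {X : Type*} [Fintype X] (r : X → X → Prop)
    (S : Submodule (ZMod 2) (X → ZMod 2)) (hS : ∀ g, g ∈ S ↔ ∀ x y, r x y → g x = g y) :
    finrank (ZMod 2) S = Nat.card (Quot r) := by
  classical
  have : Finite (Quot r) := Finite.of_surjective (Quot.mk r) Quot.mk_surjective
  have := Fintype.ofFinite (Quot r)
  let e : (Quot r → ZMod 2) →ₗ[ZMod 2] (X → ZMod 2) :=
    LinearMap.funLeft (ZMod 2) (ZMod 2) (Quot.mk r)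
  have he : Function.Injective e :=
    LinearMap.funLeft_injective_of_surjective _ _ _ Quot.mk_surjective
  have hr : LinearMap.range e = S := by
    ext g
    rw [hS]
    constructor
    · rintro ⟨g, rfl⟩ x y h
      change g (Quot.mk r x) = g (Quot.mk r y)
      rw [Quot.sound h]
    · intro h
      exact ⟨Quot.lift g h, rfl⟩
  rw [← hr, LinearMap.finrank_range_of_inj he, Module.finrank_fintype_fun_eq_card,
    Nat.card_eq_fintype_card]

/-- Functions on the sides that agree on glued sides. -/
def sideFunctions : Submodule (ZMod 2) (I × Fin 3 → ZMod 2) where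
  carrier := {b | ∀ x, b (P.sideMap x) = b x}
  add_mem' h h' x := by simp [h x, h' x]
  zero_mem' := by simp
  smul_mem' a g hg x := by simp [hg x]

/-- The sum over the three sides of each triangle. -/
def sideSum : (I × Fin 3 → ZMod 2) →ₗ[ZMod 2] (I → ZMod 2) where
  toFun b t := ∑ F, b (t, F)
  map_add' b b' := by ext t; simp [Finset.sum_add_distrib]
  map_smul' a b := by ext t; simp [Finset.mul_sum]

theorem sideSum_single [DecidableEq I] (x : I × Fin 3) :
    sideSum (Pi.single x 1) = Pi.single x.1 1 := by
  obtain ⟨t, F⟩ := x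
  ext s
  change ∑ G, (Pi.single (t, F) 1 : I × Fin 3 → ZMod 2) (s, G) = _
  by_cases hs : s = t
  · subst hs
    simp [Pi.single_apply]
  · simp [hs]

/-- The differences along the sides of the functions in `jumpSpace` are the simplicial 1-cocycles:
the functions on the glued sides whose sum over the sides of each triangle is zero. -/
theorem map_sideDifference (b : I × Fin 3 → ZMod 2) :
    (∃ g ∈ P.jumpSpace, ∀ t F, g (t, F + 1) + g (t, F + 2) = b (t, F)) ↔
      b ∈ P.sideFunctions ∧ sideSum b = 0 := by
  have hcase : ∀ (σ : Equiv.Perm (Fin 3)) (F : Fin 3),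
      (σ F + 1 = σ (F + 1) ∧ σ F + 2 = σ (F + 2)) ∨
        (σ F + 1 = σ (F + 2) ∧ σ F + 2 = σ (F + 1)) := by decide
  have h12 : ∀ F u : Fin 3, u ≠ F → u = F + 1 ∨ u = F + 2 := by decide
  have hne : ∀ F : Fin 3, F + 1 ≠ F ∧ F + 2 ≠ F := by decide
  constructor
  · rintro ⟨g, hg, hb⟩
    refine ⟨?_, ?_⟩
    · rintro ⟨t, F⟩
      have := hg t F (F + 1) (F + 2) (hne F).1 (hne F).2
      simp only [sideMap]
      rw [← hb, ← hb]
      rcases hcase (P.perm t F) F with ⟨e1, e2⟩ | ⟨e1, e2⟩ <;> rw [e1, e2] <;> grind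
    · ext t
      change ∑ F, b (t, F) = 0
      have h5 : (2 : Fin 3) + 1 = 0 ∧ (1 : Fin 3) + 2 = 0 ∧ (2 : Fin 3) + 2 = 1 ∧
        (1 : Fin 3) + 1 = 2 := by decide
      simp only [Fin.sum_univ_three, ← hb, h5, zero_add]
      grind
  · rintro ⟨hb, hs⟩
    let g : I × Fin 3 → ZMod 2 := fun x => ![0, b (x.1, 2), b (x.1, 1)] x.2
    have hg : ∀ t F, g (t, F + 1) + g (t, F + 2) = b (t, F) := by
      intro t F
      have : ∑ F, b (t, F) = 0 := congrFun hs t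
      rw [Fin.sum_univ_three] at this
      fin_cases F
      · change b (t, 2) + b (t, 1) = b (t, 0)
        grind
      · change b (t, 1) + 0 = b (t, 1)
        simp
      · change 0 + b (t, 2) = b (t, 2)
        simp
    refine ⟨g, fun t F => ?_, hg⟩
    have key : g (t, F + 1) + g (P.target t F, P.perm t F (F + 1)) =
        g (t, F + 2) + g (P.target t F, P.perm t F (F + 2)) := by
      have e1 := hg t F
      have e2 := hg (P.target t F) (P.perm t F F)
      have e3 : b (P.target t F, P.perm t F F) = b (t, F) := hb (t, F)
      rcases hcase (P.perm t F) F with ⟨h1, h2⟩ | ⟨h1, h2⟩ <;> rw [h1, h2] at e2 <;> grind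
    intro u w hu hw
    rcases h12 F u hu with rfl | rfl <;> rcases h12 F w hw with rfl | rfl <;>
      first | rfl | exact key | exact key.symm

section Finite

variable [Fintype I]

theorem mem_range_sideSum (hP : P.IsConnected) (φ : I → ZMod 2) :
    φ ∈ P.sideFunctions.map sideSum ↔ ∑ t, φ t = 0 := by
  classical
  constructor
  · rintro ⟨b, hb, rfl⟩
    change ∑ t, ∑ F, b (t, F) = 0
    rw [← Fintype.sum_prod_type]
    refine Finset.sum_involution (fun x _ => P.sideMap x) (fun x _ => ?_)
      (fun x _ _ => P.sideMap_ne x) (fun x _ => Finset.mem_univ _)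
      (fun x _ => P.sideMap_sideMap x)
    rw [hb x]
    grind
  · intro hφ
    rcases isEmpty_or_nonempty I with hI | ⟨⟨t₀⟩⟩
    · convert Submodule.zero_mem _
    set R := P.sideFunctions.map sideSum
    have key : ∀ t, (Pi.single t₀ 1 + Pi.single t 1 : I → ZMod 2) ∈ R := by
      refine fun t => hP (fun t => (Pi.single t₀ 1 + Pi.single t 1 : I → ZMod 2) ∈ R) ?_ t₀ t ?_
      · intro t F ht
        have h2 : (Pi.single t 1 + Pi.single (P.target t F) 1 : I → ZMod 2) ∈ R := by
          refine ⟨Pi.single (t, F) 1 + Pi.single (P.sideMap (t, F)) 1, fun x => ?_, ?_⟩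
          · have hinj : ∀ y, P.sideMap x = P.sideMap y ↔ x = y :=
              fun y => ⟨fun h => by rw [← P.sideMap_sideMap x, h, P.sideMap_sideMap],
                fun h => h ▸ rfl⟩
            have hinj2 : ∀ y, P.sideMap x = y ↔ x = P.sideMap y :=
              fun y => by rw [← hinj, P.sideMap_sideMap]
            simp only [Pi.add_apply, Pi.single_apply, hinj, hinj2]
            ring
          · rw [map_add]
            rw [sideSum_single, sideSum_single]
            rfl
        have := R.add_mem ht h2
        convert this using 1
        have h0 : (Pi.single t 1 + Pi.single t 1 : I → ZMod 2) = 0 := by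
          ext s
          exact CharTwo.add_self_eq_zero _
        rw [add_assoc, ← add_assoc (Pi.single t 1), h0, zero_add]
      · have h0 : (Pi.single t₀ 1 + Pi.single t₀ 1 : I → ZMod 2) = 0 := by
          ext s
          exact CharTwo.add_self_eq_zero _
        rw [h0]
        exact R.zero_mem
    have hdecomp : φ = ∑ t, φ t • (Pi.single t₀ 1 + Pi.single t 1 : I → ZMod 2) := by
      simp only [smul_add, Finset.sum_add_distrib, ← Finset.sum_smul, hφ, zero_smul, zero_add]
      ext s
      simp [Finset.sum_apply, Pi.single_apply]
    rw [hdecomp]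
    exact R.sum_mem fun t _ => R.smul_mem _ (key t)

/-- The Euler characteristic computation: `H¹` of a connected surface with `V` vertices and `F`
triangles has dimension `2 - χ`, where `χ = V - F / 2`. -/
theorem finrank_transitions [Nonempty I] (hP : P.IsConnected) :
    2 * finrank (ZMod 2) P.transitions + 2 * Nat.card P.Vertex = 3 * Fintype.card I + 2 ∧
      finrank (ZMod 2) P.trivialTransitions + 1 = Fintype.card I := by
  classical
  have hne : ∀ F : Fin 3, F + 1 ≠ F := by decide
  -- side functions
  have hS : 2 * finrank (ZMod 2) P.sideFunctions = 3 * Fintype.card I := by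
    rw [two_mul_finrank_invariants P.sideMap P.sideMap_sideMap P.sideMap_ne P.sideFunctions
      (fun b => Iff.rfl), Fintype.card_prod, Fintype.card_fin, mul_comm]
  -- the image of the coboundary has codimension one
  have hsum : finrank (ZMod 2) (P.sideFunctions.map (sideSum (I := I))) + 1 = Fintype.card I := by
    let σ : (I → ZMod 2) →ₗ[ZMod 2] ZMod 2 := ∑ t, LinearMap.proj t
    have hσ : ∀ φ, σ φ = ∑ t, φ t := fun φ => by simp [σ]
    have hker : LinearMap.ker σ = P.sideFunctions.map sideSum := by
      ext φ
      rw [P.mem_range_sideSum hP, LinearMap.mem_ker, hσ]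
    have hsurj : LinearMap.range σ = ⊤ := by
      rw [LinearMap.range_eq_top]
      intro a
      exact ⟨Pi.single (Classical.arbitrary I) a, by simp [hσ]⟩
    have := LinearMap.finrank_range_add_finrank_ker σ
    rw [hker, hsurj, finrank_top, Module.finrank_self, Module.finrank_fintype_fun_eq_card] at this
    omega
  -- cocycles
  let d : P.sideFunctions →ₗ[ZMod 2] (I → ZMod 2) := sideSum.comp P.sideFunctions.subtype
  have hd : finrank (ZMod 2) (LinearMap.range d) + finrank (ZMod 2) (LinearMap.ker d) =
      finrank (ZMod 2) P.sideFunctions := LinearMap.finrank_range_add_finrank_ker d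
  have hdr : LinearMap.range d = P.sideFunctions.map sideSum := by
    rw [LinearMap.range_comp, Submodule.range_subtype]
  -- the jump space is an extension of the cocycles by the functions on the triangles
  let ψ : P.jumpSpace →ₗ[ZMod 2] (I × Fin 3 → ZMod 2) :=
    { toFun := fun g x => g.1 (x.1, x.2 + 1) + g.1 (x.1, x.2 + 2)
      map_add' := fun g g' => by ext x; simp only [Submodule.coe_add, Pi.add_apply]; ring
      map_smul' := fun a g => by ext x; simp [mul_add] }
  have hψ := LinearMap.finrank_range_add_finrank_ker ψ
  have hψr : LinearMap.range ψ = (LinearMap.ker d).map P.sideFunctions.subtype := by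
    ext b
    constructor
    · rintro ⟨g, rfl⟩
      have := (P.map_sideDifference (ψ g)).1 ⟨g.1, g.2, fun t F => rfl⟩
      exact ⟨⟨ψ g, this.1⟩, this.2, rfl⟩
    · rintro ⟨b, hb, rfl⟩
      obtain ⟨g, hg, hgb⟩ := (P.map_sideDifference b.1).2 ⟨b.2, hb⟩
      exact ⟨⟨g, hg⟩, funext fun x => hgb x.1 x.2⟩
  have hψr' : finrank (ZMod 2) (LinearMap.range ψ) = finrank (ZMod 2) (LinearMap.ker d) := by
    rw [hψr]
    exact Submodule.finrank_map_subtype_eq _ _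
  have hψk : finrank (ZMod 2) (LinearMap.ker ψ) = Fintype.card I := by
    let κ : (I → ZMod 2) →ₗ[ZMod 2] P.jumpSpace :=
      { toFun := fun h => ⟨fun x => h x.1, fun t F u w _ _ => rfl⟩
        map_add' := fun _ _ => rfl
        map_smul' := fun _ _ => rfl }
    have hκ : Function.Injective κ := fun h h' e => by
      ext t
      exact congrFun (congrArg Subtype.val e) (t, 0)
    have : LinearMap.range κ = LinearMap.ker ψ := by
      ext g
      rw [LinearMap.mem_ker]
      constructor
      · rintro ⟨h, rfl⟩
        ext x
        change h x.1 + h x.1 = 0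
        grind
      · intro h
        refine ⟨fun t => g.1 (t, 0), ?_⟩
        ext ⟨t, F⟩
        change g.1 (t, 0) = g.1 (t, F)
        have h1 : g.1 (t, 0) + g.1 (t, 1) = 0 := congrFun h (t, 2)
        have h2 : g.1 (t, 2) + g.1 (t, 0) = 0 := congrFun h (t, 1)
        fin_cases F
        · rfl
        · change g.1 (t, 0) = g.1 (t, 1)
          grind
        · change g.1 (t, 0) = g.1 (t, 2)
          grind
    rw [← this, LinearMap.finrank_range_of_inj hκ, Module.finrank_fintype_fun_eq_card]
  -- transitions
  let θ : P.jumpSpace →ₗ[ZMod 2] (I × Fin 3 → ZMod 2) := P.jump.comp P.jumpSpace.subtype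
  have hθ := LinearMap.finrank_range_add_finrank_ker θ
  have hθr : LinearMap.range θ = P.transitions := by
    rw [LinearMap.range_comp, Submodule.range_subtype]
    rfl
  have hθk : finrank (ZMod 2) (LinearMap.ker θ) = Nat.card P.Vertex := by
    have h1 : finrank (ZMod 2) ((LinearMap.ker θ).map P.jumpSpace.subtype) =
        finrank (ZMod 2) (LinearMap.ker θ) :=
      Submodule.finrank_map_subtype_eq _ _
    rw [← h1]
    refine finrank_eq_card_quot P.CornerRel _ fun g => ?_
    constructor
    · rintro ⟨g, hg, rfl⟩ ⟨t, u⟩ ⟨_, _⟩ ⟨F, hF, rfl, rfl⟩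
      have e1 := g.2 t F u (F + 1) hF.symm (hne F)
      have e2 : g.1 (t, F + 1) + g.1 (P.target t F, P.perm t F (F + 1)) = 0 := congrFun hg (t, F)
      change g.1 (t, u) = g.1 (P.target t F, P.perm t F u)
      grind
    · intro hg
      have hg' : ∀ t F u, u ≠ F → g (t, u) = g (P.target t F, P.perm t F u) :=
        fun t F u hu => hg _ _ ⟨F, hu.symm, rfl, rfl⟩
      refine ⟨⟨g, fun t F u w hu hw => ?_⟩, ?_, rfl⟩
      · rw [← hg' t F u hu, ← hg' t F w hw]
        grind
      · refine LinearMap.mem_ker.2 (funext fun x => ?_)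
        change g (x.1, x.2 + 1) + g (P.target x.1 x.2, P.perm x.1 x.2 (x.2 + 1)) = 0
        rw [← hg' _ _ _ (hne x.2)]
        grind
  -- trivial transitions
  have hη := LinearMap.finrank_range_add_finrank_ker P.triangleJump
  have hηk : finrank (ZMod 2) (LinearMap.ker P.triangleJump) = 1 := by
    let κ : ZMod 2 →ₗ[ZMod 2] (I → ZMod 2) :=
      { toFun := fun a _ => a
        map_add' := fun _ _ => rfl
        map_smul' := fun _ _ => rfl }
    have hκ : Function.Injective κ := fun a b e => congrFun e (Classical.arbitrary I)
    have : LinearMap.range κ = LinearMap.ker P.triangleJump := by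
      ext h
      rw [LinearMap.mem_ker]
      constructor
      · rintro ⟨a, rfl⟩
        ext x
        change a + a = 0
        grind
      · intro hh
        refine ⟨h (Classical.arbitrary I), funext fun t => ?_⟩
        refine (hP (fun t => h t = h (Classical.arbitrary I)) (fun t F ht => ?_) _ t rfl).symm
        have : h t + h (P.target t F) = 0 := congrFun hh (t, F)
        grind
    rw [← this, LinearMap.finrank_range_of_inj hκ, Module.finrank_self]
  rw [Module.finrank_fintype_fun_eq_card, hηk] at hη
  rw [hdr] at hd
  rw [hψr', hψk] at hψ
  rw [hθr, hθk] at hθ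
  refine ⟨by omega, hη⟩

end Finite

end TriangleGluing

/-! ### First cohomology of a space glued from triangles -/

/-- The union of the dilated triangles `{y ≥ 0 | ∑ y = s}`, `s ∈ J`. For `J = {1}` this is the
standard triangle, and for `J = (0, ε)` it is a neighbourhood of a vertex of a tetrahedron, with
the vertex removed, in the barycentric coordinates of the other three vertices. -/
def triangleCone (J : Set ℝ) : Set (Fin 3 → ℝ) := {y | (∀ u, 0 ≤ y u) ∧ ∑ u, y u ∈ J}

theorem convex_triangleCone {J : Set ℝ} (hJ : Convex ℝ J) : Convex ℝ (triangleCone J) := by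
  intro y hy y' hy' a b ha hb hab
  refine ⟨fun u => ?_, ?_⟩
  · have := hy.1 u
    have := hy'.1 u
    simp only [Pi.add_apply, Pi.smul_apply, smul_eq_mul]
    positivity
  · have := hJ hy.2 hy'.2 ha hb hab
    simpa [Finset.sum_add_distrib, Finset.mul_sum] using this

theorem comp_perm_mem_triangleCone {J : Set ℝ} {y : Fin 3 → ℝ} (σ : Equiv.Perm (Fin 3)) :
    (fun v => y (σ v)) ∈ triangleCone J ↔ y ∈ triangleCone J := by
  simp only [triangleCone, Set.mem_ofPred_eq, Equiv.sum_comp σ y]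
  exact and_congr_left fun _ => ⟨fun h u => by simpa using h (σ.symm u), fun h u => h _⟩

theorem single_mem_triangleCone {J : Set ℝ} {s : ℝ} (hs : s ∈ J) (hs0 : 0 ≤ s) (u : Fin 3) :
    (Pi.single u s : Fin 3 → ℝ) ∈ triangleCone J := by
  refine ⟨fun v => ?_, by simpa using hs⟩
  rw [Pi.single_apply]
  split_ifs <;> simp [hs0]

namespace TriangleGluing

variable {I X : Type*} [TopologicalSpace X]
  (P : TriangleGluing I)

/-- A point of side `F` of triangle `t` is glued to a point of the adjacent triangle. -/
def PointRel (p q : I × (Fin 3 → ℝ)) : Prop :=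
  ∃ F, p.2 F = 0 ∧ q = (P.target p.1 F, fun v => p.2 ((P.perm p.1 F).symm v))

/-- `π` exhibits its image as the quotient of copies of `triangleCone J` by the identifications of
`P`. The neighbourhood condition says that `π` is hereditarily quotient onto its image, which is
stronger than being a quotient map. -/
structure IsModel (J : Set ℝ) (π : I × (Fin 3 → ℝ) → X) : Prop where
  continuousOn : ∀ t, ContinuousOn (fun y => π (t, y)) (triangleCone J)
  glue : ∀ p, p.2 ∈ triangleCone J → ∀ q, P.PointRel p q → π p = π q
  eqvGen : ∀ p q, p.2 ∈ triangleCone J → q.2 ∈ triangleCone J → π p = π q →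
    Relation.EqvGen P.PointRel p q
  mem_nhds : ∀ x ∈ π '' (Set.univ ×ˢ triangleCone J), ∀ s : Set X,
    (∀ t, ∀ y ∈ triangleCone J, π (t, y) = x →
      ∀ᶠ y' in 𝓝[triangleCone J] y, π (t, y') ∈ s) →
    s ∈ 𝓝[π '' (Set.univ ×ˢ triangleCone J)] x

/-- `a` is a transition cocycle of the local cocycle `c`: the pullback of `c` to each piece has a
primitive, and `a` measures the jump of these primitives across the sides. -/
def HasTransitions (J : Set ℝ) (π : I × (Fin 3 → ℝ) → X) (c : X → X → ZMod 2)
    (a : I × Fin 3 → ZMod 2) : Prop :=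
  ∃ f : I → (Fin 3 → ℝ) → ZMod 2,
    (∀ t, IsPrimitive (fun y y' => c (π (t, y)) (π (t, y'))) (f t) (triangleCone J)) ∧
    ∀ t F, ∀ y ∈ triangleCone J, y F = 0 →
      f t y + f (P.target t F) (fun v => y ((P.perm t F).symm v)) = a (t, F)

variable {P} {J : Set ℝ} {π : I × (Fin 3 → ℝ) → X}

theorem PointRel.mem_iff {p q : I × (Fin 3 → ℝ)} (h : P.PointRel p q) :
    p.2 ∈ triangleCone J ↔ q.2 ∈ triangleCone J := by
  obtain ⟨F, -, rfl⟩ := h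
  exact (comp_perm_mem_triangleCone _).symm

omit [TopologicalSpace X] in
theorem HasTransitions.add {c c' : X → X → ZMod 2} {a a' : I × Fin 3 → ZMod 2}
    (h : P.HasTransitions J π c a) (h' : P.HasTransitions J π c' a') :
    P.HasTransitions J π (fun x y => c x y + c' x y) (a + a') := by
  obtain ⟨f, h1, h2⟩ := h
  obtain ⟨f', h1', h2'⟩ := h'
  refine ⟨fun t y => f t y + f' t y, fun t p hp => ?_, fun t F y hy hF => ?_⟩
  · filter_upwards [h1 t p hp, h1' t p hp] with q e e'
    grind
  · have := h2 t F y hy hF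
    have := h2' t F y hy hF
    simp only [Pi.add_apply]
    grind

omit [TopologicalSpace X] in
theorem HasTransitions.mono {J' : Set ℝ} {c : X → X → ZMod 2} {a : I × Fin 3 → ZMod 2}
    (h : P.HasTransitions J π c a) (hJ : J' ⊆ J) : P.HasTransitions J' π c a := by
  have hsub : triangleCone J' ⊆ triangleCone J := fun y hy => ⟨hy.1, hJ hy.2⟩
  obtain ⟨f, h1, h2⟩ := h
  exact ⟨f, fun t => (h1 t).mono hsub, fun t F y hy => h2 t F y (hsub hy)⟩

omit [TopologicalSpace X] in
theorem HasTransitions.congr {c c' : X → X → ZMod 2} {a : I × Fin 3 → ZMod 2}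
    (h : P.HasTransitions J π c a)
    (hc : ∀ x ∈ π '' (Set.univ ×ˢ triangleCone J), ∀ y ∈ π '' (Set.univ ×ˢ triangleCone J),
      c x y = c' x y) : P.HasTransitions J π c' a := by
  obtain ⟨f, h1, h2⟩ := h
  refine ⟨f, fun t p hp => ?_, h2⟩
  filter_upwards [h1 t p hp, self_mem_nhdsWithin] with q hq hqK
  rw [← hq]
  exact (hc _ ⟨(t, p), ⟨trivial, hp⟩, rfl⟩ _ ⟨(t, q), ⟨trivial, hqK⟩, rfl⟩).symm

namespace IsModel

omit [TopologicalSpace X] in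
theorem mapsTo (t : I) : Set.MapsTo (fun y => π (t, y)) (triangleCone J)
    (π '' (Set.univ ×ˢ triangleCone J)) := fun _ hy => ⟨_, ⟨trivial, hy⟩, rfl⟩

/-- A function on the pieces that respects the gluing is constant on the fibres of `π`. -/
theorem eq_of_eq (hπ : P.IsModel J π) {α : Type*} {φ : I × (Fin 3 → ℝ) → α}
    (hφ : ∀ p, p.2 ∈ triangleCone J → ∀ q, P.PointRel p q → φ p = φ q) {p q : I × (Fin 3 → ℝ)}
    (hp : p.2 ∈ triangleCone J) (hq : q.2 ∈ triangleCone J) (h : π p = π q) : φ p = φ q := by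
  have key : ∀ p q, Relation.EqvGen P.PointRel p q →
      (p.2 ∈ triangleCone J ↔ q.2 ∈ triangleCone J) ∧ (p.2 ∈ triangleCone J → φ p = φ q) := by
    intro p q h
    induction h with
    | rel p q h => exact ⟨h.mem_iff, fun hp => hφ p hp q h⟩
    | refl p => exact ⟨Iff.rfl, fun _ => rfl⟩
    | symm p q _ ih => exact ⟨ih.1.symm, fun hq => (ih.2 (ih.1.2 hq)).symm⟩
    | trans p q r _ _ ih ih' =>
      exact ⟨ih.1.trans ih'.1, fun hp => (ih.2 hp).trans (ih'.2 (ih.1.1 hp))⟩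
  exact (key p q (hπ.eqvGen p q hp hq h)).2 hp

theorem isPreconnected_range (hπ : P.IsModel J π) (hJ : Convex ℝ J) (hJ0 : ∀ s ∈ J, 0 < s)
    (hJn : J.Nonempty) (hP : P.IsConnected) :
    IsPreconnected (π '' (Set.univ ×ˢ triangleCone J)) := by
  obtain ⟨s, hs⟩ := hJn
  have : π '' (Set.univ ×ˢ triangleCone J) = ⋃ t, (fun y => π (t, y)) '' triangleCone J := by
    ext x
    simp only [Set.mem_image, Set.mem_prod, Prod.exists, Set.mem_iUnion]
    constructor
    · rintro ⟨t, y, ⟨-, hy⟩, rfl⟩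
      exact ⟨t, y, hy, rfl⟩
    · rintro ⟨t, y, hy, rfl⟩
      exact ⟨t, y, ⟨trivial, hy⟩, rfl⟩
  rw [this]
  refine IsPreconnected.iUnion_of_reflTransGen
    (fun t => (convex_triangleCone hJ).isPreconnected.image _ (hπ.continuousOn t)) fun t t' => ?_
  refine hP (fun t' => Relation.ReflTransGen _ t t') (fun t' F h => h.tail ?_) t t' .refl
  have hmem := single_mem_triangleCone hs (hJ0 s hs).le (F + 1)
  have hne : (Pi.single (F + 1) s : Fin 3 → ℝ) F = 0 :=
    Pi.single_eq_of_ne (show F ≠ F + 1 by clear hmem h; revert F; decide) _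
  refine ⟨π (t', Pi.single (F + 1) s), ⟨_, hmem, rfl⟩, _,
    (comp_perm_mem_triangleCone (P.perm t' F).symm).2 hmem, ?_⟩
  exact (hπ.glue (t', Pi.single (F + 1) s) hmem _ ⟨F, hne, rfl⟩).symm

/-- The pieces being convex, a local cocycle has a primitive on each of them; its jump across a side
is constant as the sides are connected, and these constants are a transition cocycle. -/
theorem exists_hasTransitions (hπ : P.IsModel J π) (hJ : Convex ℝ J) (hJ0 : ∀ s ∈ J, 0 < s)
    (hJn : J.Nonempty) {c : X → X → ZMod 2}
    (hc : IsLocalCocycle c (π '' (Set.univ ×ˢ triangleCone J))) :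
    ∃ a ∈ P.transitions, P.HasTransitions J π c a := by
  obtain ⟨s, hs⟩ := hJn
  have hs0 := (hJ0 s hs).le
  have hK := convex_triangleCone hJ
  have hf := fun t => (hc.comp (hπ.continuousOn t) (mapsTo t)).exists_isPrimitive_of_convex hK
  choose f hf using hf
  have hne : ∀ F : Fin 3, F ≠ F + 1 := by decide
  have key : ∀ t F, ∀ y ∈ triangleCone J, ∀ y' ∈ triangleCone J, y F = 0 → y' F = 0 →
      f t y + f (P.target t F) (fun v => y ((P.perm t F).symm v)) =
        f t y' + f (P.target t F) (fun v => y' ((P.perm t F).symm v)) := by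
    intro t F y hy y' hy' hF hF'
    have hconv : Convex ℝ (triangleCone J ∩ {y | y F = 0}) := by
      refine hK.inter fun y hy y' hy' a b _ _ _ => ?_
      simp only [Set.mem_ofPred_eq] at hy hy'
      simp [hy, hy']
    have h1 := (hf t).mono (Set.inter_subset_left : triangleCone J ∩ {y | y F = 0} ⊆ _)
    have h2 := (hf (P.target t F)).comp (V := triangleCone J ∩ {y | y F = 0})
      (φ := fun y v => y ((P.perm t F).symm v)) (by fun_prop)
      (fun y hy => (comp_perm_mem_triangleCone _).2 hy.1)
    refine h1.add_eq_add (f' := fun y => f (P.target t F) (fun v => y ((P.perm t F).symm v)))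
      (fun p hp => ?_) hconv.isPreconnected ⟨hy, hF⟩ ⟨hy', hF'⟩
    filter_upwards [h2 p hp, self_mem_nhdsWithin] with q hq hqK
    rw [← hq, hπ.glue (t, p) hp.1 _ ⟨F, hp.2, rfl⟩, hπ.glue (t, q) hqK.1 _ ⟨F, hqK.2, rfl⟩]
  refine ⟨fun x => f x.1 (Pi.single (x.2 + 1) s) + f (P.target x.1 x.2)
    (fun v => (Pi.single (x.2 + 1) s : Fin 3 → ℝ) ((P.perm x.1 x.2).symm v)),
    P.mem_transitions.2 ⟨fun x => f x.1 (Pi.single x.2 s), fun t F u hu => ?_⟩, f, hf,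
    fun t F y hy hF => key t F _ hy _ (single_mem_triangleCone hs hs0 _) hF
      (by simp [hne])⟩
  rw [← key t F _ (single_mem_triangleCone hs hs0 u) _ (single_mem_triangleCone hs hs0 _)
    (by simp [hu.symm]) (by simp [hne])]
  have hsingle : (Pi.single (P.perm t F u) s : Fin 3 → ℝ) =
      fun v => (Pi.single u s : Fin 3 → ℝ) ((P.perm t F).symm v) := by
    ext v
    simp only [Pi.single_apply, Equiv.symm_apply_eq]
  dsimp only
  rw [hsingle]

/-- If the transition cocycle is trivial, then the primitives on the pieces can be changed by
constants so as to agree on the sides. -/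
theorem exists_isPrimitive (hπ : P.IsModel J π) {c : X → X → ZMod 2} {a : I × Fin 3 → ZMod 2}
    (ha : a ∈ P.trivialTransitions) (hc : P.HasTransitions J π c a) :
    ∃ f, IsPrimitive c f (π '' (Set.univ ×ˢ triangleCone J)) := by
  classical
  obtain ⟨h, hh⟩ := P.mem_trivialTransitions.1 ha
  obtain ⟨f, hf, hfa⟩ := hc
  have key : ∀ p q : I × (Fin 3 → ℝ), p.2 ∈ triangleCone J → q.2 ∈ triangleCone J → π p = π q →
      f p.1 p.2 + h p.1 = f q.1 q.2 + h q.1 := by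
    intro p q
    refine hπ.eq_of_eq (φ := fun p => f p.1 p.2 + h p.1) ?_
    rintro ⟨t, y⟩ hy _ ⟨F, hF, rfl⟩
    have e1 := hfa t F y hy hF
    have e2 := hh t F
    dsimp only
    grind
  set φ : X → ZMod 2 := fun x => if hx : ∃ p : I × (Fin 3 → ℝ), p.2 ∈ triangleCone J ∧ π p = x then
    f hx.choose.1 hx.choose.2 + h hx.choose.1 else 0 with hφ
  have hφπ : ∀ t, ∀ y ∈ triangleCone J, φ (π (t, y)) = f t y + h t := by
    intro t y hy
    have hx : ∃ p : I × (Fin 3 → ℝ), p.2 ∈ triangleCone J ∧ π p = π (t, y) := ⟨(t, y), hy, rfl⟩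
    simp only [hφ, dif_pos hx]
    exact key _ (t, y) hx.choose_spec.1 hy hx.choose_spec.2
  refine ⟨φ, fun x hx => hπ.mem_nhds x hx {q | c x q = φ x + φ q} fun t y hy hyx => ?_⟩
  filter_upwards [hf t y hy, self_mem_nhdsWithin] with y' h1 h2
  rw [← hyx]
  simp only [hφπ t y hy, hφπ t y' h2, h1]
  grind

/-- The restrictions of a primitive to the pieces have no jumps, and other primitives on the pieces
differ from them by constants. -/
theorem mem_trivialTransitions (hπ : P.IsModel J π) (hJ : Convex ℝ J) (hJ0 : ∀ s ∈ J, 0 < s)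
    (hJn : J.Nonempty) {c : X → X → ZMod 2} {φ : X → ZMod 2}
    (hφ : IsPrimitive c φ (π '' (Set.univ ×ˢ triangleCone J))) {a : I × Fin 3 → ZMod 2}
    (hc : P.HasTransitions J π c a) : a ∈ P.trivialTransitions := by
  obtain ⟨s, hs⟩ := hJn
  have hmem := single_mem_triangleCone hs (hJ0 s hs).le
  have hne : ∀ F : Fin 3, F ≠ F + 1 := by decide
  obtain ⟨f, hf, hfa⟩ := hc
  have key : ∀ t, ∀ y ∈ triangleCone J, f t y + φ (π (t, y)) =
      f t (Pi.single 0 s) + φ (π (t, Pi.single 0 s)) := fun t y hy =>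
    (hf t).add_eq_add (hφ.comp (hπ.continuousOn t) (mapsTo t))
      (convex_triangleCone hJ).isPreconnected hy (hmem 0)
  refine P.mem_trivialTransitions.2
    ⟨fun t => f t (Pi.single 0 s) + φ (π (t, Pi.single 0 s)), fun t F => ?_⟩
  have hF : (Pi.single (F + 1) s : Fin 3 → ℝ) F = 0 := by simp [hne]
  have e1 := key t _ (hmem (F + 1))
  have e2 := key (P.target t F) _ ((comp_perm_mem_triangleCone (P.perm t F).symm).2 (hmem (F + 1)))
  have e3 := hfa t F _ (hmem (F + 1)) hF
  have e4 := hπ.glue (t, Pi.single (F + 1) s) (hmem (F + 1)) _ ⟨F, hF, rfl⟩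
  dsimp only at e4
  rw [← e4] at e2
  dsimp only
  rw [← e1, ← e2]
  grind

/-- Every transition cocycle comes from a local cocycle: the line bundle with these transition
signs has enough sections to define a nowhere vanishing section of a sum of copies of it. There is
a copy for each stratum of the glued surface, with a section supported near that stratum. -/
theorem exists_isStrictCocycle [Fintype I] (hπ : P.IsModel J π) (hJ0 : ∀ s ∈ J, 0 < s)
    {a : I × Fin 3 → ZMod 2} (ha : a ∈ P.transitions) :
    ∃ c, IsStrictCocycle c (π '' (Set.univ ×ˢ triangleCone J)) ∧ P.HasTransitions J π c a := by
  classical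
  let _ : TopologicalSpace I := ⊥
  have : DiscreteTopology I := ⟨rfl⟩
  obtain ⟨g, hg⟩ := P.mem_transitions.1 ha
  have : Finite P.Vertex := Finite.of_surjective (Quot.mk P.CornerRel) Quot.mk_surjective
  have := Fintype.ofFinite P.Vertex
  have hne : ∀ F : Fin 3, F + 1 ≠ F ∧ F + 2 ≠ F ∧ F + 1 ≠ F + 2 := by decide
  have hall : ∀ F v : Fin 3, v = F ∨ v = F + 1 ∨ v = F + 2 := by decide
  have hsym : ∀ x, a (P.sideMap x) = a x := by
    rintro ⟨t, F⟩
    have h1 := hg t F (F + 1) (hne F).1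
    have h2 := hg (P.target t F) (P.perm t F F) (P.perm t F (F + 1))
      (fun h => (hne F).1 ((P.perm t F).injective h))
    simp only [P.target_target, P.perm_perm, Equiv.Perm.inv_def, Equiv.symm_apply_apply] at h2
    rw [sideMap, ← h2, ← h1, add_comm]
  -- signs on the sides with the prescribed jumps
  let e := Fintype.equivFin (I × Fin 3)
  let h : I × Fin 3 → ZMod 2 := fun x => if e x < e (P.sideMap x) then 0 else a x
  have hh : ∀ x, h (P.sideMap x) = h x + a x := by
    intro x
    have hx : e x ≠ e (P.sideMap x) := fun h => P.sideMap_ne x (e.injective h).symm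
    simp only [h, P.sideMap_sideMap, hsym]
    rcases lt_or_gt_of_ne hx with h | h
    · rw [if_pos h, if_neg h.not_gt, zero_add]
    · rw [if_pos h, if_neg h.not_gt]
      grind
  -- the section has a component for each vertex, which is a barycentric coordinate up to sign near
  -- that vertex, components for each side, and one for each triangle, positive in its interior;
  -- the signs `g` at the corners and `h` at the sides make it jump by the sign of `a` across sides
  let ι := P.Vertex ⊕ ((I × Fin 3) ⊕ I)
  let b : ι → EuclideanSpace ℝ ι := fun i => EuclideanSpace.single i 1
  let S : I × (Fin 3 → ℝ) → EuclideanSpace ℝ ι := fun p =>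
    ∑ u, (zmodSign (g (p.1, u)) * p.2 u) • b (.inl (Quot.mk _ (p.1, u))) +
    ∑ F, (zmodSign (h (p.1, F)) * (p.2 (F + 1) * p.2 (F + 2))) •
      (b (.inr (.inl (p.1, F))) + b (.inr (.inl (P.sideMap (p.1, F))))) +
    (p.2 0 * p.2 1 * p.2 2) • b (.inr (.inr p.1))
  have hScont : Continuous S := continuous_prod_of_discrete_left.2 fun t => by
    simp only [S]
    fun_prop
  have hprod0 : ∀ (y : Fin 3 → ℝ) (F G : Fin 3), y F = 0 → G ≠ F → y (G + 1) * y (G + 2) = 0 := by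
    intro y F G hF hG
    rcases hall G F with rfl | rfl | rfl
    · exact (hG rfl).elim
    · rw [hF, zero_mul]
    · rw [hF, mul_zero]
  have hprod : ∀ (y : Fin 3 → ℝ) (F : Fin 3), y 0 * y 1 * y 2 = y F * y (F + 1) * y (F + 2) := by
    intro y F
    fin_cases F
    · rfl
    · change y 0 * y 1 * y 2 = y 1 * y 2 * y 0
      ring
    · change y 0 * y 1 * y 2 = y 2 * y 0 * y 1
      ring
  have hcase : ∀ (σ : Equiv.Perm (Fin 3)) (F : Fin 3),
      (σ F + 1 = σ (F + 1) ∧ σ F + 2 = σ (F + 2)) ∨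
        (σ F + 1 = σ (F + 2) ∧ σ F + 2 = σ (F + 1)) := by decide
  have hSrel : ∀ t F (y : Fin 3 → ℝ), y F = 0 →
      S (P.target t F, fun v => y ((P.perm t F).symm v)) = zmodSign (a (t, F)) • S (t, y) := by
    intro t F y hF
    set σ := P.perm t F
    have e1 : ∑ u, (zmodSign (g (P.target t F, u)) * y (σ.symm u)) •
        b (.inl (Quot.mk _ (P.target t F, u))) =
        zmodSign (a (t, F)) • ∑ u, (zmodSign (g (t, u)) * y u) • b (.inl (Quot.mk _ (t, u))) := by
      rw [← Equiv.sum_comp σ, Finset.smul_sum]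
      refine Finset.sum_congr rfl fun u _ => ?_
      rw [Equiv.symm_apply_apply]
      by_cases hu : u = F
      · rw [hu, hF]
        simp
      · have hq : (Quot.mk P.CornerRel (P.target t F, σ u)) = Quot.mk P.CornerRel (t, u) :=
          (Quot.sound ⟨F, Ne.symm hu, rfl, rfl⟩).symm
        have hgu : g (P.target t F, σ u) = a (t, F) + g (t, u) := by
          have := hg t F u hu
          grind
        rw [hq, hgu, zmodSign_add, smul_smul, mul_assoc]
    have e2 : ∑ G, (zmodSign (h (P.target t F, G)) * (y (σ.symm (G + 1)) * y (σ.symm (G + 2)))) •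
        (b (.inr (.inl (P.target t F, G))) + b (.inr (.inl (P.sideMap (P.target t F, G))))) =
        zmodSign (a (t, F)) • ∑ G, (zmodSign (h (t, G)) * (y (G + 1) * y (G + 2))) •
        (b (.inr (.inl (t, G))) + b (.inr (.inl (P.sideMap (t, G))))) := by
      rw [← Equiv.sum_comp σ, Finset.smul_sum]
      refine Finset.sum_congr rfl fun G _ => ?_
      have hyy : y (σ.symm (σ G + 1)) * y (σ.symm (σ G + 2)) = y (G + 1) * y (G + 2) := by
        rcases hcase σ G with ⟨h1, h2⟩ | ⟨h1, h2⟩ <;> rw [h1, h2] <;>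
          simp only [Equiv.symm_apply_apply]
        rw [mul_comm]
      rw [hyy]
      by_cases hG : G = F
      · subst hG
        have hsm : (P.target t G, σ G) = P.sideMap (t, G) := rfl
        rw [hsm, P.sideMap_sideMap, hh, zmodSign_add, smul_smul, add_comm (b _)]
        congr 1
        ring
      · rw [hprod0 y F G hF hG]
        simp
    have e3 : (y (σ.symm 0) * y (σ.symm 1) * y (σ.symm 2)) • b (.inr (.inr (P.target t F))) =
        zmodSign (a (t, F)) • (y 0 * y 1 * y 2) • b (.inr (.inr t)) := by
      rw [hprod (fun v => y (σ.symm v)) (σ F), hprod y F]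
      simp [hF]
    simp only [S]
    rw [e1, e2, e3, ← smul_add, ← smul_add]
  have hS0 : ∀ p ∈ (Set.univ : Set I) ×ˢ triangleCone J, S p ≠ 0 := by
    rintro ⟨t, y⟩ ⟨-, hy⟩ hS
    change y ∈ triangleCone J at hy
    have hcoord : ∀ i, S (t, y) i = 0 := fun i => by rw [hS]; rfl
    have h3 := hcoord (.inr (.inr t))
    have h2 := fun F => hcoord (.inr (.inl (t, F)))
    have h1 := fun u => hcoord (.inl (Quot.mk _ (t, u)))
    simp only [S, b, ι, PiLp.add_apply, WithLp.ofLp_sum, Finset.sum_apply, PiLp.smul_apply,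
      PiLp.single_apply, reduceCtorEq, if_false, mul_zero, Finset.sum_const_zero, zero_add, add_zero,
      Sum.inr.injEq, Sum.inl.injEq, if_true, smul_eq_mul, mul_one] at h1 h2 h3
    obtain ⟨F, hF⟩ : ∃ F, y F = 0 := by
      rcases mul_eq_zero.1 h3 with h | h
      · rcases mul_eq_zero.1 h with h | h
        exacts [⟨0, h⟩, ⟨1, h⟩]
      · exact ⟨2, h⟩
    have hE : y (F + 1) * y (F + 2) = 0 := by
      have := h2 F
      rw [Finset.sum_eq_single F] at this
      · simpa [zmodSign_ne_zero, (P.sideMap_ne (t, F)).symm] using this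
      · intro G _ hG
        rw [hprod0 y F G hF hG]
        simp
      · simp
    -- the point is a vertex of the triangle
    obtain ⟨u, hu⟩ : ∃ u, ∀ v ≠ u, y v = 0 := by
      rcases mul_eq_zero.1 hE with h | h
      · refine ⟨F + 2, fun v hv => ?_⟩
        rcases hall F v with rfl | rfl | rfl
        exacts [hF, h, (hv rfl).elim]
      · refine ⟨F + 1, fun v hv => ?_⟩
        rcases hall F v with rfl | rfl | rfl
        exacts [hF, (hv rfl).elim, h]
    have hyu : y u = 0 := by
      have := h1 u
      rw [Finset.sum_eq_single u] at this
      · simpa [zmodSign_ne_zero] using this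
      · intro v _ hv
        rw [hu v hv]
        simp
      · simp
    have hpos := hJ0 _ hy.2
    rw [Finset.sum_eq_zero] at hpos
    · exact hpos.ne rfl
    · intro v _
      by_cases hv : v = u
      · rw [hv, hyu]
      · exact hu v hv
  have hpm : ∀ p q, Relation.EqvGen P.PointRel p q → ∃ e, S q = zmodSign e • S p := by
    intro p q h
    induction h with
    | rel p q h =>
      obtain ⟨F, hF, rfl⟩ := h
      exact ⟨_, hSrel p.1 F p.2 hF⟩
    | refl p => exact ⟨0, by simp [zmodSign]⟩
    | symm p q _ ih =>
      obtain ⟨e, he⟩ := ih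
      exact ⟨e, by rw [he, smul_smul, zmodSign_mul_self, one_smul]⟩
    | trans p q r _ _ ih ih' =>
      obtain ⟨e, he⟩ := ih
      obtain ⟨e', he'⟩ := ih'
      exact ⟨e' + e, by rw [he', he, smul_smul, zmodSign_add]⟩
  have hnW : ∀ t y, 𝓝[(Set.univ : Set I) ×ˢ triangleCone J] (t, y) =
      Filter.map (fun y' => (t, y')) (𝓝[triangleCone J] y) := by
    intro t y
    rw [nhdsWithin_prod_eq, nhdsWithin_univ, nhds_discrete, Filter.pure_prod]
  obtain ⟨c, ε, hc, hε, hεS⟩ := exists_isStrictCocycle_of_section (π := π)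
    (V := Set.univ ×ˢ triangleCone J) hScont.continuousOn hS0
    (fun p hp q hq h => hpm p q (hπ.eqvGen p q hp.2 hq.2 h)) (fun x hx s hs => by
      refine hπ.mem_nhds x hx s fun t y hy hyx => ?_
      have := hs (t, y) ⟨trivial, hy⟩ hyx
      rw [hnW] at this
      exact this)
  refine ⟨c, hc, fun t y => ε (t, y), fun t y hy => ?_, fun t F y hy hF => ?_⟩
  · have := hε (t, y) ⟨trivial, hy⟩
    rw [hnW] at this
    exact this
  · have hy' := (comp_perm_mem_triangleCone (J := J) (P.perm t F).symm).2 hy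
    have h1 := hεS (t, y) ⟨trivial, hy⟩ (P.target t F, _) ⟨trivial, hy'⟩
      (hπ.glue (t, y) hy _ ⟨F, hF, rfl⟩)
    rw [hSrel t F y hF] at h1
    exact (zmodSign_injective (smul_left_injective ℝ (hS0 (t, y) ⟨trivial, hy⟩) h1)).symm

end IsModel

end TriangleGluing

/-! ### Local cocycles on a three-manifold with boundary -/

section ThreeManifold

/-- Transport of the existence of primitives along a continuous map with a continuous section. -/
theorem exists_isPrimitive_of_retract {X Y : Type*} [TopologicalSpace X] [TopologicalSpace Y]
    {U : Set X} {V : Set Y} {φ : Y → X} {ψ : X → Y} (hφ : ContinuousOn φ V)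
    (hψ : ContinuousOn ψ U) (hφm : Set.MapsTo φ V U) (hψm : Set.MapsTo ψ U V)
    (hφψ : ∀ x ∈ U, φ (ψ x) = x)
    (h : ∀ c, IsLocalCocycle c V → ∃ f, IsPrimitive c f V) (c : X → X → ZMod 2)
    (hc : IsLocalCocycle c U) : ∃ f, IsPrimitive c f U := by
  obtain ⟨f, hf⟩ := h _ (hc.comp hφ hφm)
  refine ⟨fun x => f (ψ x), fun p hp => ?_⟩
  filter_upwards [(hf.comp hψ hψm) p hp, self_mem_nhdsWithin] with q hq hqU
  rw [← hq, hφψ p hp, hφψ q hqU]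

/-- The first cohomology of a punctured ball in space vanishes: the punctured ball is covered by
four half-balls as in `exists_isPrimitive_of_cover`. -/
theorem exists_isPrimitive_punctured_ball (x₀ : EuclideanSpace ℝ (Fin 3)) {r : ℝ} (hr : 0 < r)
    (c : EuclideanSpace ℝ (Fin 3) → EuclideanSpace ℝ (Fin 3) → ZMod 2)
    (hc : IsLocalCocycle c (Metric.ball x₀ r \ {x₀})) :
    ∃ f, IsPrimitive c f (Metric.ball x₀ r \ {x₀}) := by
  -- four linear forms with sum zero, any three of which are independent
  let l : Fin 4 → EuclideanSpace ℝ (Fin 3) →ₗ[ℝ] ℝ :=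
    ![(EuclideanSpace.proj 0).toLinearMap, (EuclideanSpace.proj 1).toLinearMap,
      (EuclideanSpace.proj 2).toLinearMap, -((EuclideanSpace.proj 0).toLinearMap +
        (EuclideanSpace.proj 1).toLinearMap + (EuclideanSpace.proj 2).toLinearMap)]
  have hlc : ∀ i, Continuous (l i) := fun i => (l i).continuous_of_finiteDimensional
  -- `v m` is positive for all the linear forms but `l m`
  let v : Fin 4 → EuclideanSpace ℝ (Fin 3) := fun m =>
    WithLp.toLp 2 fun i => if (i : ℕ) = m then -3 else 1
  have hlv : ∀ i m, i ≠ m → 0 < l i (v m) := by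
    intro i m him
    fin_cases i <;> fin_cases m <;> first
      | exact (him rfl).elim
      | (norm_num [l, v]; done)
      | (norm_num [l, v]; rw [if_neg (by decide)]; norm_num)
  have hW : ∀ i, Convex ℝ (Metric.ball x₀ r ∩ {z | 0 < l i (z - x₀)}) := by
    intro i
    refine (convex_ball x₀ r).inter ?_
    have : {z | 0 < l i (z - x₀)} = {z | l i x₀ < l i z} := by
      ext z
      simp [map_sub]
    rw [this]
    exact convex_halfSpace_gt (l i).isLinear _
  have hsub : ∀ i, Metric.ball x₀ r ∩ {z | 0 < l i (z - x₀)} ⊆ Metric.ball x₀ r \ {x₀} := by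
    rintro i z ⟨hz, hz'⟩
    refine ⟨hz, fun h => ?_⟩
    rw [Set.mem_singleton_iff.1 h] at hz'
    simp at hz'
  refine exists_isPrimitive_of_cover (W := fun i => Metric.ball x₀ r ∩ {z | 0 < l i (z - x₀)})
    (Set.Subset.antisymm ?_ (Set.iUnion_subset hsub)) (fun i => Metric.isOpen_ball.inter
      (isOpen_lt continuous_const ((hlc i).comp (continuous_id.sub continuous_const))))
    (fun i => (hc.mono (hsub i)).exists_isPrimitive_of_convex (hW i))
    (fun i j => ((hW i).inter (hW j)).isPreconnected) ?_
  · rintro z ⟨hz, hz0⟩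
    by_contra hcon
    simp only [Set.mem_iUnion, Set.mem_inter_iff, hz, true_and, not_exists] at hcon
    have hcon' : ∀ i, l i (z - x₀) ≤ 0 := fun i => not_lt.1 (hcon i)
    have h0 : (z - x₀) 0 ≤ 0 := hcon' 0
    have h1 : (z - x₀) 1 ≤ 0 := hcon' 1
    have h2 : (z - x₀) 2 ≤ 0 := hcon' 2
    have h3 : -((z - x₀) 0 + (z - x₀) 1 + (z - x₀) 2) ≤ 0 := hcon' 3
    refine hz0 (sub_eq_zero.1 ?_)
    ext i
    change (z - x₀) i = 0
    fin_cases i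
    · change (z - x₀) 0 = 0
      linarith
    · change (z - x₀) 1 = 0
      linarith
    · change (z - x₀) 2 = 0
      linarith
  · intro i j k
    obtain ⟨m, hi, hj, hk⟩ : ∃ m, i ≠ m ∧ j ≠ m ∧ k ≠ m := by
      revert i j k
      decide
    obtain ⟨δ, hδ, hδr⟩ : ∃ δ : ℝ, 0 < δ ∧ δ * ‖v m‖ < r := by
      refine ⟨r / (‖v m‖ + 1), by positivity, ?_⟩
      rw [div_mul_eq_mul_div, div_lt_iff₀ (by positivity)]
      nlinarith
    have hball : x₀ + δ • v m ∈ Metric.ball x₀ r := by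
      rw [mem_ball_iff_norm, add_sub_cancel_left, norm_smul, Real.norm_of_nonneg hδ.le]
      exact hδr
    have hpos : ∀ i, i ≠ m → 0 < l i (x₀ + δ • v m - x₀) := by
      intro i hi
      rw [add_sub_cancel_left, map_smul, smul_eq_mul]
      exact mul_pos hδ (hlv i m hi)
    exact ⟨x₀ + δ • v m, ⟨⟨hball, hpos i hi⟩, hball, hpos j hj⟩, hball, hpos k hk⟩

/-- Reflection of the lower half of space in the bounding plane of the closed half-space. -/
noncomputable def foldHalfSpace (z : EuclideanSpace ℝ (Fin 3)) : EuclideanHalfSpace 3 :=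
  ⟨z + (|z 0| - z 0) • EuclideanSpace.single 0 1, by simp⟩

theorem continuous_foldHalfSpace : Continuous foldHalfSpace := by
  unfold foldHalfSpace
  fun_prop

theorem foldHalfSpace_of_nonneg {z : EuclideanSpace ℝ (Fin 3)} (hz : 0 ≤ z 0) :
    (foldHalfSpace z).1 = z := by
  simp [foldHalfSpace, abs_of_nonneg hz]

variable {M : Type*} [TopologicalSpace M] {B : Set M}

namespace IsThreeManifoldWithBoundary

theorem isClosed_boundary (hM : IsThreeManifoldWithBoundary M B) : IsClosed B := by
  rw [← isOpen_compl_iff, isOpen_iff_mem_nhds]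
  intro x hx
  obtain ⟨e, hxe, he⟩ := hM x
  have hcont : Continuous fun z : EuclideanHalfSpace 3 => z.1 0 := by fun_prop
  have hO := e.isOpen_inter_preimage ((isOpen_ne (x := (0 : ℝ))).preimage hcont)
  refine Filter.mem_of_superset (hO.mem_nhds ⟨hxe, fun h => hx ((he x hxe).2 h)⟩) ?_
  rintro y ⟨hy, hy0⟩ hyB
  exact hy0 ((he y hy).1 hyB)

theorem secondCountableTopology [CompactSpace M] (hM : IsThreeManifoldWithBoundary M B) :
    SecondCountableTopology M := by
  choose e hxe he using hM
  obtain ⟨t, -, ht⟩ := isCompact_univ.elim_nhds_subcover (fun x => (e x).source)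
    (fun x _ => (e x).open_source.mem_nhds (hxe x))
  have : SecondCountableTopology (EuclideanHalfSpace 3) :=
    inferInstanceAs (SecondCountableTopology {x : EuclideanSpace ℝ (Fin 3) // 0 ≤ x 0})
  have : ∀ i : t, SecondCountableTopology ((e i.1).source) := fun i =>
    (e i.1).secondCountableTopology_source
  refine TopologicalSpace.secondCountableTopology_of_countable_cover
    (U := fun i : t => (e i.1).source) (fun i => (e i.1).open_source) ?_
  rw [← Set.univ_subset_iff]
  refine ht.trans (Set.iUnion₂_subset fun i hi => ?_)
  exact Set.subset_iUnion (fun i : t => (e i.1).source) ⟨i, hi⟩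

/-- A boundary point has arbitrarily small neighbourhoods whose interior part is homeomorphic to a
half-ball without its bounding disc, hence is connected and without first cohomology. -/
theorem exists_nhds_boundary (hM : IsThreeManifoldWithBoundary M B) {p : M} (hp : p ∈ B)
    {O : Set M} (hO : O ∈ 𝓝 p) : ∃ W, IsOpen W ∧ p ∈ W ∧ W ⊆ O ∧ (W \ B).Nonempty ∧
      IsPreconnected (W \ B) ∧ ∀ c, IsLocalCocycle c (W \ B) → ∃ f, IsPrimitive c f (W \ B) := by
  obtain ⟨e, hpe, he⟩ := hM p
  have hep : foldHalfSpace (e p).1 = e p := Subtype.ext (foldHalfSpace_of_nonneg (e p).2)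
  have h1 : foldHalfSpace ⁻¹' (e.symm ⁻¹' O ∩ e.target) ∈ 𝓝 (e p).1 := by
    refine continuous_foldHalfSpace.continuousAt ?_
    rw [hep]
    exact Filter.inter_mem (e.tendsto_symm hpe hO) (e.open_target.mem_nhds (e.map_source hpe))
  obtain ⟨r, hr, hball⟩ := Metric.mem_nhds_iff.1 h1
  set Q : Set (EuclideanSpace ℝ (Fin 3)) := Metric.ball (e p).1 r ∩ {z | 0 < z 0} with hQ
  have hQc : Convex ℝ Q := (convex_ball _ _).inter
    (convex_halfSpace_gt (f := fun z : EuclideanSpace ℝ (Fin 3) => z 0)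
      ⟨fun _ _ => rfl, fun _ _ => rfl⟩ 0)
  have hfold : ∀ z ∈ Q, (foldHalfSpace z).1 = z := fun z hz =>
    foldHalfSpace_of_nonneg (le_of_lt hz.2)
  set W := e.source ∩ e ⁻¹' (Subtype.val ⁻¹' Metric.ball (e p).1 r) with hW
  have hφ : ContinuousOn (fun z => e.symm (foldHalfSpace z)) Q :=
    e.continuousOn_symm.comp continuous_foldHalfSpace.continuousOn
      (fun z hz => (hball hz.1).2)
  have hψ : ContinuousOn (fun y => (e y).1) (W \ B) :=
    continuous_subtype_val.comp_continuousOn (e.continuousOn.mono fun y hy => hy.1.1)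
  have hφm : Set.MapsTo (fun z => e.symm (foldHalfSpace z)) Q (W \ B) := by
    intro z hz
    have ht := (hball hz.1).2
    refine ⟨⟨e.map_target ht, ?_⟩, fun hB => ?_⟩
    · change (e (e.symm (foldHalfSpace z))).1 ∈ Metric.ball (e p).1 r
      rw [e.right_inv ht, hfold z hz]
      exact hz.1
    · have := (he _ (e.map_target ht)).1 hB
      rw [e.right_inv ht, hfold z hz] at this
      exact hz.2.ne' this
  have hψm : Set.MapsTo (fun y => (e y).1) (W \ B) Q := by
    rintro y ⟨⟨hy, hyb⟩, hyB⟩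
    exact ⟨hyb, lt_of_le_of_ne (e y).2 fun h => hyB ((he y hy).2 h.symm)⟩
  have hφψ : ∀ y ∈ W \ B, e.symm (foldHalfSpace (e y).1) = y := by
    intro y hy
    have : foldHalfSpace (e y).1 = e y := Subtype.ext (foldHalfSpace_of_nonneg (e y).2)
    rw [this, e.left_inv hy.1.1]
  have himage : W \ B = (fun z => e.symm (foldHalfSpace z)) '' Q :=
    Set.Subset.antisymm (fun y hy => ⟨_, hψm hy, hφψ y hy⟩) hφm.image_subset
  refine ⟨W, e.isOpen_inter_preimage (Metric.isOpen_ball.preimage continuous_subtype_val),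
    ⟨hpe, Metric.mem_ball_self hr⟩, ?_, ?_, ?_, exists_isPrimitive_of_retract hφ hψ hφm hψm hφψ
      fun c hc => hc.exists_isPrimitive_of_convex hQc⟩
  · rintro y ⟨hy, hyb⟩
    have := (hball hyb).1
    rwa [Set.mem_preimage, show foldHalfSpace (e y).1 = e y from
      Subtype.ext (foldHalfSpace_of_nonneg (e y).2), e.left_inv hy] at this
  · rw [himage]
    have hp0 : (e p).1 0 = 0 := (he p hpe).1 hp
    refine Set.Nonempty.image _ ⟨(e p).1 + (r / 2) • EuclideanSpace.single 0 1, ?_, ?_⟩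
    · rw [mem_ball_iff_norm, add_sub_cancel_left, norm_smul, Real.norm_of_nonneg (by positivity)]
      simp [hr]
    · change 0 < ((e p).1 + (r / 2) • EuclideanSpace.single 0 (1 : ℝ) : EuclideanSpace ℝ (Fin 3)) 0
      simp [hp0, hr]
  · rw [himage]
    exact hQc.isPreconnected.image _ hφ

/-- An interior point has arbitrarily small neighbourhoods homeomorphic to a ball; deleting the
point leaves a set without first cohomology. -/
theorem exists_nhds_interior (hM : IsThreeManifoldWithBoundary M B) {p : M} (hp : p ∉ B)
    {O : Set M} (hO : O ∈ 𝓝 p) : ∃ W, IsOpen W ∧ p ∈ W ∧ W ⊆ O ∧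
      ∀ c, IsLocalCocycle c (W \ {p}) → ∃ f, IsPrimitive c f (W \ {p}) := by
  obtain ⟨e, hpe, he⟩ := hM p
  have hep : foldHalfSpace (e p).1 = e p := Subtype.ext (foldHalfSpace_of_nonneg (e p).2)
  have h1 : foldHalfSpace ⁻¹' (e.symm ⁻¹' O ∩ e.target) ∈ 𝓝 (e p).1 := by
    refine continuous_foldHalfSpace.continuousAt ?_
    rw [hep]
    exact Filter.inter_mem (e.tendsto_symm hpe hO) (e.open_target.mem_nhds (e.map_source hpe))
  have hp0 : 0 < (e p).1 0 := lt_of_le_of_ne (e p).2 fun h => hp ((he p hpe).2 h.symm)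
  obtain ⟨r₁, hr₁, hball₁⟩ := Metric.mem_nhds_iff.1 h1
  obtain ⟨r₂, hr₂, hball₂⟩ := Metric.mem_nhds_iff.1
    ((isOpen_lt continuous_const (by fun_prop) :
      IsOpen {z : EuclideanSpace ℝ (Fin 3) | 0 < z 0}).mem_nhds hp0)
  set r := min r₁ r₂ with hr
  have hr0 : 0 < r := lt_min hr₁ hr₂
  have hball := (Metric.ball_subset_ball (min_le_left r₁ r₂)).trans hball₁
  have hpos := (Metric.ball_subset_ball (min_le_right r₁ r₂)).trans hball₂
  set Q : Set (EuclideanSpace ℝ (Fin 3)) := Metric.ball (e p).1 r \ {(e p).1} with hQ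
  have hfold : ∀ z ∈ Q, (foldHalfSpace z).1 = z := fun z hz =>
    foldHalfSpace_of_nonneg (le_of_lt (hpos hz.1))
  set W := e.source ∩ e ⁻¹' (Subtype.val ⁻¹' Metric.ball (e p).1 r) with hW
  have hφ : ContinuousOn (fun z => e.symm (foldHalfSpace z)) Q :=
    e.continuousOn_symm.comp continuous_foldHalfSpace.continuousOn
      (fun z hz => (hball hz.1).2)
  have hψ : ContinuousOn (fun y => (e y).1) (W \ {p}) :=
    continuous_subtype_val.comp_continuousOn (e.continuousOn.mono fun y hy => hy.1.1)
  have hφm : Set.MapsTo (fun z => e.symm (foldHalfSpace z)) Q (W \ {p}) := by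
    intro z hz
    have ht := (hball hz.1).2
    refine ⟨⟨e.map_target ht, ?_⟩, fun h => hz.2 ?_⟩
    · change (e (e.symm (foldHalfSpace z))).1 ∈ Metric.ball (e p).1 r
      rw [e.right_inv ht, hfold z hz]
      exact hz.1
    · have h' : e.symm (foldHalfSpace z) = p := h
      rw [Set.mem_singleton_iff, ← hfold z hz, ← h', e.right_inv ht]
  have hψm : Set.MapsTo (fun y => (e y).1) (W \ {p}) Q := by
    rintro y ⟨⟨hy, hyb⟩, hyp⟩
    exact ⟨hyb, fun h => hyp (e.injOn hy hpe (Subtype.ext h))⟩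
  have hφψ : ∀ y ∈ W \ {p}, e.symm (foldHalfSpace (e y).1) = y := by
    intro y hy
    have : foldHalfSpace (e y).1 = e y := Subtype.ext (foldHalfSpace_of_nonneg (e y).2)
    rw [this, e.left_inv hy.1.1]
  refine ⟨W, e.isOpen_inter_preimage (Metric.isOpen_ball.preimage continuous_subtype_val),
    ⟨hpe, Metric.mem_ball_self hr0⟩, ?_, exists_isPrimitive_of_retract hφ hψ hφm hψm hφψ
      (exists_isPrimitive_punctured_ball _ hr0)⟩
  rintro y ⟨hy, hyb⟩
  have := (hball hyb).1
  rwa [Set.mem_preimage, show foldHalfSpace (e y).1 = e y from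
    Subtype.ext (foldHalfSpace_of_nonneg (e y).2), e.left_inv hy] at this

end IsThreeManifoldWithBoundary

end ThreeManifold

/-! ### The topology of a glued space -/

namespace FacePairing

section Topology

variable {d n : ℕ} (P : FacePairing d n) {S : Set (Fin (d + 1) → ℝ)}

variable {P} in
theorem Rel.symm {p q : Fin n × S} (h : P.Rel S p q) : P.Rel S q p := by
  obtain ⟨f, hf, h1, h2⟩ := h
  refine ⟨P.perm p.1 f f, by rw [h2, hf], by rw [h1, P.target_target], fun v => ?_⟩
  rw [h1, P.perm_perm, ← h2, Equiv.Perm.inv_def, Equiv.apply_symm_apply]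

variable {P} in
theorem Rel.eq_comp {p q : Fin n × S} (h : P.Rel S p q) :
    ∃ f, p.2.1 f = 0 ∧ q.1 = P.target p.1 f ∧ q.2.1 = fun v => p.2.1 ((P.perm p.1 f).symm v) := by
  obtain ⟨f, hf, h1, h2⟩ := h
  refine ⟨f, hf, h1, funext fun v => ?_⟩
  rw [← h2, Equiv.apply_symm_apply]

theorem exists_perm_of_mk_eq {p q : Fin n × S} (h : (Quot.mk _ p : P.Glued S) = Quot.mk _ q) :
    ∃ σ : Equiv.Perm (Fin (d + 1)), q.2.1 = fun v => p.2.1 (σ v) := by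
  have h' := Quot.eqvGen_exact h
  induction h' with
  | rel p q h =>
    obtain ⟨f, -, -, hf⟩ := Rel.eq_comp ‹_›
    exact ⟨_, hf⟩
  | refl p => exact ⟨1, rfl⟩
  | symm p q _ ih =>
    obtain ⟨σ, hσ⟩ := ih (Quot.eqvGen_sound ‹_›)
    exact ⟨σ.symm, by simp [hσ]⟩
  | trans p q r _ _ ih ih' =>
    obtain ⟨σ, hσ⟩ := ih (Quot.eqvGen_sound ‹_›)
    obtain ⟨τ, hτ⟩ := ih' (Quot.eqvGen_sound ‹_›)
    exact ⟨τ.trans σ, by simp [hσ, hτ]⟩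

/-- A set is a neighbourhood of a point of the glued space if it is so in each simplex: small balls
of equal radius around the points of the (finite) fibre are compatible with the gluing. -/
theorem mem_nhds_glued (hS : ∀ y ∈ S, ∀ σ : Equiv.Perm (Fin (d + 1)), (fun v => y (σ v)) ∈ S)
    (x : P.Glued S) (s : Set (P.Glued S))
    (h : ∀ p : Fin n × S, (Quot.mk _ p : P.Glued S) = x →
      ∀ᶠ q in 𝓝 p.2, (Quot.mk _ (p.1, q) : P.Glued S) ∈ s) : s ∈ 𝓝 x := by
  classical
  obtain ⟨p₀, rfl⟩ := Quot.exists_rep x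
  -- the fibre is finite
  have hfin : {p : Fin n × S | (Quot.mk _ p : P.Glued S) = Quot.mk _ p₀}.Finite := by
    refine (Set.finite_range fun a : Fin n × Equiv.Perm (Fin (d + 1)) =>
      ((a.1, ⟨fun v => p₀.2.1 (a.2 v), hS _ p₀.2.2 a.2⟩) : Fin n × S)).subset ?_
    intro p hp
    obtain ⟨σ, hσ⟩ := P.exists_perm_of_mk_eq hp.symm
    exact ⟨(p.1, σ), Prod.ext rfl (Subtype.ext hσ.symm)⟩
  have h1 : ∀ᶠ δ in 𝓝[>] (0 : ℝ), ∀ p : Fin n × S, (Quot.mk _ p : P.Glued S) = Quot.mk _ p₀ →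
      ∀ q, dist q p.2 < δ → (Quot.mk _ (p.1, q) : P.Glued S) ∈ s := by
    have := (Filter.eventually_all_finite (l := 𝓝[>] (0 : ℝ)) (p := fun (p : Fin n × S) δ =>
      ∀ q, dist q p.2 < δ → (Quot.mk _ (p.1, q) : P.Glued S) ∈ s) hfin).2 ?_
    · exact this
    · intro p hp
      obtain ⟨δ, hδ, hball⟩ := Metric.eventually_nhds_iff.1 (h p hp)
      filter_upwards [Ioo_mem_nhdsGT hδ] with δ' hδ' q hq
      exact hball (hq.trans hδ'.2)
  have h2 : ∀ᶠ δ in 𝓝[>] (0 : ℝ), ∀ v, p₀.2.1 v ≠ 0 → δ ≤ |p₀.2.1 v| := by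
    rw [Filter.eventually_all]
    intro v
    by_cases hv : p₀.2.1 v = 0
    · exact Filter.Eventually.of_forall fun δ h => (h hv).elim
    · filter_upwards [Ioo_mem_nhdsGT (abs_pos.2 hv)] with δ hδ _ using hδ.2.le
  obtain ⟨δ, ⟨hδ1, hδ2⟩, hδ⟩ := ((h1.and h2).and self_mem_nhdsWithin).exists
  change 0 < δ at hδ
  set N : Set (Fin n × S) := {q | ∃ p : Fin n × S, (Quot.mk _ p : P.Glued S) = Quot.mk _ p₀ ∧
    q.1 = p.1 ∧ dist q.2 p.2 < δ} with hN
  have hsat : ∀ q q', P.Rel S q q' → q ∈ N → q' ∈ N := by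
    rintro q q' hqq ⟨p, hp, hqp, hd⟩
    obtain ⟨f, hf, hq1, hq2⟩ := hqq.eq_comp
    obtain ⟨σ, hσ⟩ := P.exists_perm_of_mk_eq hp.symm
    have hpf : p.2.1 f = 0 := by
      by_contra hne
      have h3 := hδ2 (σ f) (by rwa [hσ] at hne)
      have h4 := (dist_le_pi_dist q.2.1 p.2.1 f).trans_lt hd
      rw [hf, Real.dist_eq, zero_sub, abs_neg, hσ] at h4
      exact h4.not_ge h3
    set p' : Fin n × S := (P.target p.1 f, ⟨fun v => p.2.1 ((P.perm p.1 f).symm v),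
      hS _ p.2.2 _⟩) with hp'
    have hrel : P.Rel S p p' := ⟨f, hpf, rfl, fun v => by simp [hp']⟩
    refine ⟨p', (Quot.sound hrel).symm.trans hp, by rw [hq1, hqp], ?_⟩
    change dist q'.2.1 p'.2.1 < δ
    rw [dist_pi_lt_iff hδ, hq2]
    intro v
    have h4 := (dist_le_pi_dist q.2.1 p.2.1 ((P.perm p.1 f).symm v)).trans_lt hd
    simpa only [hp', hqp] using h4
  have hopen : IsOpen N := by
    have : N = ⋃ p ∈ {p : Fin n × S | (Quot.mk _ p : P.Glued S) = Quot.mk _ p₀},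
        ({p.1} : Set (Fin n)) ×ˢ Metric.ball p.2 δ := by
      ext q
      simp only [hN, Set.mem_iUnion, Set.mem_prod, Set.mem_singleton_iff, Metric.mem_ball]
      constructor
      · rintro ⟨p, h1, h2, h3⟩
        exact ⟨p, h1, h2, h3⟩
      · rintro ⟨p, h1, h2, h3⟩
        exact ⟨p, h1, h2, h3⟩
    rw [this]
    exact isOpen_biUnion fun p _ => (isOpen_discrete _).prod Metric.isOpen_ball
  let N' : Set (P.Glued S) := {z | Quot.lift (fun q => q ∈ N)
    (fun q q' hqq => propext ⟨hsat q q' hqq, hsat q' q hqq.symm⟩) z}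
  have hN' : IsOpen N' := isOpen_coinduced.2 hopen
  refine Filter.mem_of_superset (hN'.mem_nhds ⟨p₀, rfl, rfl, by simpa using hδ⟩) ?_
  intro z
  induction z using Quot.ind with
  | mk q =>
    rintro ⟨p, hp, hqp, hd⟩
    have := hδ1 p hp q.2 hd
    rwa [← hqp] at this

end Topology

/-! ### The closed orientable surfaces -/

section Surface

variable {n : ℕ} (P : FacePairing 2 n)

/-- A face-pairing of triangles as a gluing of triangles. -/
def toTriangleGluing : TriangleGluing (Fin n) where
  target := P.target
  perm := P.perm
  target_target := P.target_target
  perm_perm := P.perm_perm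
  no_fixed_side := P.no_fixed_face

/-- The inverse of the inclusion of the standard triangle (with an arbitrary value outside). -/
noncomputable def toStdTriangle (y : Fin 3 → ℝ) : stdSimplex ℝ (Fin 3) :=
  open Classical in
  if h : y ∈ stdSimplex ℝ (Fin 3) then ⟨y, h⟩ else ⟨Pi.single 0 1, single_mem_stdSimplex ℝ 0⟩

theorem triangleCone_singleton_one : triangleCone {1} = stdSimplex ℝ (Fin 3) := rfl

theorem toStdTriangle_of_mem {y : Fin 3 → ℝ} (h : y ∈ stdSimplex ℝ (Fin 3)) :
    toStdTriangle y = ⟨y, h⟩ := dif_pos h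

theorem image_model {X : Type*} (σ : P.Glued (stdSimplex ℝ (Fin 3)) → X) :
    (fun p : Fin n × (Fin 3 → ℝ) => σ (Quot.mk _ (p.1, toStdTriangle p.2))) ''
      (Set.univ ×ˢ triangleCone {1}) = Set.range σ := by
  ext x
  constructor
  · rintro ⟨p, -, rfl⟩
    exact ⟨_, rfl⟩
  · rintro ⟨z, rfl⟩
    obtain ⟨p, rfl⟩ := Quot.exists_rep z
    refine ⟨(p.1, p.2.1), ⟨trivial, p.2.2⟩, ?_⟩
    simp only [toStdTriangle_of_mem p.2.2]

instance : CompactSpace (P.Glued (stdSimplex ℝ (Fin 3))) := by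
  have : CompactSpace (stdSimplex ℝ (Fin 3)) :=
    isCompact_iff_compactSpace.1 (isCompact_stdSimplex ℝ (Fin 3))
  exact Quot.compactSpace

/-- A glued surface embedded in a Hausdorff space is modelled on its triangles. -/
theorem isModel {X : Type*} [TopologicalSpace X] [T2Space X]
    {σ : P.Glued (stdSimplex ℝ (Fin 3)) → X} (hσ : Continuous σ) (hinj : Function.Injective σ) :
    P.toTriangleGluing.IsModel {1}
      (fun p : Fin n × (Fin 3 → ℝ) => σ (Quot.mk _ (p.1, toStdTriangle p.2))) where
  continuousOn t := by
    have h1 : ContinuousOn toStdTriangle (triangleCone {1}) := by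
      rw [continuousOn_iff_continuous_domRestrict]
      refine continuous_id.congr fun y => ?_
      exact (toStdTriangle_of_mem y.2).symm
    have h2 : Continuous fun y : stdSimplex ℝ (Fin 3) =>
        σ (Quot.mk _ (t, y) : P.Glued (stdSimplex ℝ (Fin 3))) :=
      hσ.comp (continuous_quot_mk.comp (Continuous.prodMk_right t))
    exact h2.comp_continuousOn h1
  glue := by
    rintro ⟨t, y⟩ hy _ ⟨F, hF, rfl⟩
    have hy' := (comp_perm_mem_triangleCone (J := {1}) (P.perm t F).symm).2 hy
    refine congrArg σ (Quot.sound ?_)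
    simp only [toTriangleGluing]
    rw [toStdTriangle_of_mem hy, toStdTriangle_of_mem hy']
    exact ⟨F, hF, rfl, fun v => by simp⟩
  eqvGen := by
    rintro ⟨t, y⟩ ⟨t', y'⟩ hy hy' h
    have h1 := Quot.eqvGen_exact (hinj h)
    rw [toStdTriangle_of_mem hy, toStdTriangle_of_mem hy'] at h1
    have key : ∀ p q, Relation.EqvGen (P.Rel (stdSimplex ℝ (Fin 3))) p q →
        Relation.EqvGen P.toTriangleGluing.PointRel (p.1, p.2.1) (q.1, q.2.1) := by
      intro p q h
      induction h with
      | rel p q h =>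
        obtain ⟨f, hf, h1, h2⟩ := h.eq_comp
        exact .rel _ _ ⟨f, hf, Prod.ext h1 h2⟩
      | refl p => exact .refl _
      | symm p q _ ih => exact ih.symm
      | trans p q r _ _ ih ih' => exact ih.trans _ _ _ ih'
    exact key _ _ h1
  mem_nhds := by
    rw [P.image_model]
    rintro _ ⟨z, rfl⟩ s hs
    have he := (hσ.isClosedEmbedding hinj).isEmbedding
    rw [← he.map_nhds_eq]
    refine P.mem_nhds_glued (fun y hy τ => ?_) z (σ ⁻¹' s) fun p hp => ?_
    · exact (comp_perm_mem_triangleCone (J := {1}) τ).2 hy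
    · have h1 := hs p.1 p.2.1 p.2.2 (by simp only [toStdTriangle_of_mem p.2.2, ← hp])
      rw [triangleCone_singleton_one] at h1
      have h2 : Filter.Tendsto (Subtype.val : stdSimplex ℝ (Fin 3) → _) (𝓝 p.2)
          (𝓝[stdSimplex ℝ (Fin 3)] p.2.1) :=
        tendsto_nhdsWithin_iff.2 ⟨continuous_subtype_val.continuousAt,
          Filter.Eventually.of_forall fun y => y.2⟩
      filter_upwards [h2.eventually h1] with q hq
      rwa [toStdTriangle_of_mem q.2] at hq

end Surface

end FacePairing

open scoped Fin.CommRing in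
theorem isConnected_oppositeSidesPairing (g : ℕ) :
    (oppositeSidesPairing g).toTriangleGluing.IsConnected := by
  intro Q hQ t t' ht
  have key : ∀ m : ℕ, Q (t + (m : Fin (4 * g + 2))) := by
    intro m
    induction m with
    | zero => simpa using ht
    | succ m ih =>
      have := hQ _ 1 ih
      rw [Nat.cast_succ, ← add_assoc]
      exact this
  have := key (t' - t).val
  rwa [Fin.cast_val_eq_self, add_sub_cancel] at this

open scoped Fin.CommRing in
/-- The three vertices are the centre of the polygon and the two classes of its own vertices. -/
theorem card_vertex_oppositeSidesPairing (g : ℕ) :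
    Nat.card (oppositeSidesPairing g).toTriangleGluing.Vertex = 3 := by
  let par : Fin (4 * g + 2) → ZMod 2 := fun j => (j.val : ZMod 2)
  have hpar : ∀ a b : Fin (4 * g + 2), par (a + b) = par a + par b := by
    intro a b
    have h1 : ((a + b : Fin (4 * g + 2)).val : ZMod 2) +
        (((4 * g + 2) * ((a.val + b.val) / (4 * g + 2)) : ℕ) : ZMod 2) =
        ((a.val + b.val : ℕ) : ZMod 2) := by
      rw [Fin.val_add, ← Nat.cast_add, Nat.mod_add_div]
    have h2 : ((4 * g + 2 : ℕ) : ZMod 2) = 0 := by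
      rw [ZMod.natCast_eq_zero_iff]
      exact ⟨2 * g + 1, by omega⟩
    rw [Nat.cast_mul, h2, zero_mul, add_zero, Nat.cast_add] at h1
    exact h1
  have hpar1 : par 1 = 1 := by
    have : (1 : Fin (4 * g + 2)).val = 1 := by
      change 1 % (4 * g + 2) = 1
      exact Nat.mod_eq_of_lt (by omega)
    simp only [par, this, Nat.cast_one]
  have hparh : par ⟨2 * g + 1, by omega⟩ = 1 := by
    simp only [par]
    push_cast
    have : (2 : ZMod 2) = 0 := by decide
    rw [this]
    simp
  -- the invariant: the centre, or the parity of the index of a vertex of the polygon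
  let inv : Fin (4 * g + 2) × Fin 3 → Option (ZMod 2) := fun x => ![none, some (par x.1),
    some (par x.1 + 1)] x.2
  have hinv : ∀ x y, (oppositeSidesPairing g).toTriangleGluing.CornerRel x y → inv x = inv y := by
    rintro ⟨j, u⟩ ⟨j', u'⟩ ⟨F, hF, h1, h2⟩
    dsimp only at h1 h2 hF
    subst h1 h2
    have hsub : par (j - 1) + 1 = par j := by rw [← hpar1, ← hpar, sub_add_cancel]
    have h2 : (2 : ZMod 2) = 0 := by decide
    fin_cases u <;> fin_cases F <;> first | exact (hF rfl).elim | skip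
    · rfl
    · rfl
    · change some (par j) = some (par (j + ⟨2 * g + 1, by omega⟩) + 1)
      rw [hpar, hparh, add_assoc, one_add_one_eq_two, h2, add_zero]
    · change some (par j) = some (par (j - 1) + 1)
      rw [hsub]
    · change some (par j + 1) = some (par (j + ⟨2 * g + 1, by omega⟩))
      rw [hpar, hparh]
    · change some (par j + 1) = some (par (j + 1))
      rw [hpar, hpar1]
  let q : Fin (4 * g + 2) × Fin 3 → (oppositeSidesPairing g).toTriangleGluing.Vertex := Quot.mk _
  have hstep0 : ∀ j, q (j, 0) = q (j + 1, 0) := fun j =>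
    Quot.sound ⟨1, show (1 : Fin 3) ≠ 0 by decide, rfl, rfl⟩
  have hstep2 : ∀ j, q (j, 2) = q (j + 1, 1) := fun j =>
    Quot.sound ⟨1, show (1 : Fin 3) ≠ 2 by decide, rfl, rfl⟩
  have hstep1 : ∀ j, q (j, 1) = q (j + ⟨2 * g + 1, by omega⟩, 2) := fun j =>
    Quot.sound ⟨0, show (0 : Fin 3) ≠ 1 by decide, rfl, rfl⟩
  have hstep : ∀ j, q (j, 1) = q (j + 2, 1) := by
    intro j
    rw [hstep1, hstep2, hstep1, hstep2]
    congr 2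
    have : (⟨2 * g + 1, by omega⟩ : Fin (4 * g + 2)) + ⟨2 * g + 1, by omega⟩ = 0 := by
      apply Fin.ext
      rw [Fin.val_add]
      change (2 * g + 1 + (2 * g + 1)) % (4 * g + 2) = 0
      rw [show 2 * g + 1 + (2 * g + 1) = 4 * g + 2 by omega, Nat.mod_self]
    calc j + ⟨2 * g + 1, _⟩ + 1 + ⟨2 * g + 1, _⟩ + 1
        = j + (⟨2 * g + 1, by omega⟩ + ⟨2 * g + 1, by omega⟩) + (1 + 1) := by abel
      _ = j + 2 := by rw [this, add_zero, one_add_one_eq_two]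
  have h0 : ∀ m : ℕ, q ((m : Fin (4 * g + 2)), 0) = q (0, 0) := by
    intro m
    induction m with
    | zero => simp
    | succ m ih => rw [Nat.cast_succ, ← hstep0, ih]
  have h1 : ∀ m : ℕ, q ((m : Fin (4 * g + 2)), 1) = if Even m then q (0, 1) else q (1, 1) := by
    intro m
    induction m using Nat.twoStepInduction with
    | zero => simp
    | one => simp
    | more m ih _ =>
      have h2 : ((m + 2 : ℕ) : Fin (4 * g + 2)) = (m : Fin (4 * g + 2)) + 2 := by push_cast; rfl
      have h3 : Even (m + 2) ↔ Even m := by simp [Nat.even_add]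
      rw [h2, ← hstep, ih]
      simp only [h3]
  have h1' : ∀ j : Fin (4 * g + 2), q (j, 1) = if par j = 0 then q (0, 1) else q (1, 1) := by
    intro j
    have := h1 j.val
    rw [Fin.cast_val_eq_self] at this
    rw [this]
    simp only [par, ZMod.natCast_eq_zero_iff_even]
  have hrep : ∀ v : (oppositeSidesPairing g).toTriangleGluing.Vertex,
      v = q (0, 0) ∨ v = q (0, 1) ∨ v = q (1, 1) := by
    intro v
    obtain ⟨⟨j, u⟩, rfl⟩ := Quot.exists_rep v
    have h1'' : ∀ j : Fin (4 * g + 2), q (j, 1) = q (0, 1) ∨ q (j, 1) = q (1, 1) := by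
      intro j
      rw [h1']
      split_ifs
      · exact Or.inl rfl
      · exact Or.inr rfl
    fin_cases u
    · left
      have := h0 j.val
      rwa [Fin.cast_val_eq_self] at this
    · exact Or.inr (h1'' j)
    · right
      have := h1'' (j + 1)
      rwa [← hstep2] at this
  let L : (oppositeSidesPairing g).toTriangleGluing.Vertex → Option (ZMod 2) := Quot.lift inv hinv
  have hpar0 : par 0 = 0 := by simp [par]
  have hbij : Function.Bijective L := by
    have e1 : L (q (0, 0)) = none := rfl
    have e2 : L (q (0, 1)) = some 0 := congrArg some hpar0
    have e3 : L (q (1, 1)) = some 1 := congrArg some hpar1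
    constructor
    · intro v w h
      rcases hrep v with rfl | rfl | rfl <;> rcases hrep w with rfl | rfl | rfl <;>
        first | rfl | simp [e1, e2, e3] at h
    · intro o
      have hz : ∀ e : ZMod 2, e = 0 ∨ e = 1 := by decide
      rcases o with _ | e
      · exact ⟨q (0, 0), e1⟩
      · rcases hz e with rfl | rfl
        exacts [⟨q (0, 1), e2⟩, ⟨q (1, 1), e3⟩]
  rw [Nat.card_congr (Equiv.ofBijective L hbij)]
  simp

/-- The first Betti number over `ZMod 2` of the surface of genus `g` is `2 * g`. -/
theorem finrank_transitions_oppositeSidesPairing (g : ℕ) :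
    Module.finrank (ZMod 2) (oppositeSidesPairing g).toTriangleGluing.transitions = 6 * g + 1 ∧
    Module.finrank (ZMod 2) (oppositeSidesPairing g).toTriangleGluing.trivialTransitions =
      4 * g + 1 := by
  obtain ⟨h1, h2⟩ := TriangleGluing.finrank_transitions _ (isConnected_oppositeSidesPairing g)
  rw [card_vertex_oppositeSidesPairing, Fintype.card_fin] at h1
  rw [Fintype.card_fin] at h2
  omega

/-! ### Links of the ideal vertices -/

/-- The bijection induced by a permutation of four labels between the labels other than `v` and
those other than `σ v`, numbered increasingly. -/
def linkPerm (σ : Equiv.Perm (Fin 4)) (v : Fin 4) : Equiv.Perm (Fin 3) :=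
  (finSuccAboveEquiv v).trans
    ((σ.subtypeEquiv fun w => by simp : {w // w ≠ v} ≃ {w // w ≠ σ v}).trans
      (finSuccAboveEquiv (σ v)).symm)

theorem succAbove_linkPerm (σ : Equiv.Perm (Fin 4)) (v : Fin 4) (u : Fin 3) :
    (σ v).succAbove (linkPerm σ v u) = σ (v.succAbove u) := by
  have h := (finSuccAboveEquiv (σ v)).apply_symm_apply
    ((σ.subtypeEquiv fun w => by simp : {w // w ≠ v} ≃ {w // w ≠ σ v}) (finSuccAboveEquiv v u))
  exact congrArg Subtype.val h

theorem linkPerm_inv (σ : Equiv.Perm (Fin 4)) (v : Fin 4) :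
    linkPerm σ⁻¹ (σ v) = (linkPerm σ v)⁻¹ := by
  rw [eq_inv_iff_mul_eq_one]
  ext u : 1
  apply Fin.succAbove_right_injective (p := v)
  have h := succAbove_linkPerm σ⁻¹ (σ v) (linkPerm σ v u)
  rw [show σ⁻¹ (σ v) = v from σ.symm_apply_apply v, succAbove_linkPerm σ v u] at h
  exact h.trans (σ.symm_apply_apply _)

theorem insertNth_comp_symm (σ : Equiv.Perm (Fin 4)) (v : Fin 4) (a : ℝ) (y : Fin 3 → ℝ) :
    (fun w => (v.insertNth a y : Fin 4 → ℝ) (σ.symm w)) =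
      (σ v).insertNth a (fun u => y ((linkPerm σ v).symm u)) := by
  ext w
  induction w using (σ v).succAboveCases with
  | x => simp
  | p u =>
    have h := succAbove_linkPerm σ v ((linkPerm σ v).symm u)
    rw [Equiv.apply_symm_apply] at h
    rw [Fin.insertNth_apply_succAbove, h, Equiv.symm_apply_apply, Fin.insertNth_apply_succAbove]

namespace FacePairing

variable {n : ℕ} (P : FacePairing 3 n)

/-- Vertices of tetrahedra identified by the pairing of a face. -/
def VertexRel (x y : Fin n × Fin 4) : Prop :=
  ∃ f ≠ x.2, y.1 = P.target x.1 f ∧ y.2 = P.perm x.1 f x.2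

/-- The ideal vertices: the (removed) vertices of the tetrahedra after gluing. -/
def IdealVertex : Type := Quot P.VertexRel

/-- The ideal vertex at the vertex `v` of tetrahedron `i`. -/
def idealVertex (i : Fin n) (v : Fin 4) : P.IdealVertex := Quot.mk _ (i, v)

theorem idealVertex_target (i : Fin n) {f v : Fin 4} (h : f ≠ v) :
    P.idealVertex (P.target i f) (P.perm i f v) = P.idealVertex i v :=
  (Quot.sound ⟨f, h, rfl, rfl⟩).symm

instance : Finite P.IdealVertex :=
  Finite.of_surjective (Quot.mk P.VertexRel) Quot.mk_surjective

/-- The corners of tetrahedra at an ideal vertex, which are the triangles of its link. -/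
abbrev LinkTriangle (ν : P.IdealVertex) : Type :=
  {t : Fin n × Fin 4 // P.idealVertex t.1 t.2 = ν}

/-- The link of an ideal vertex. The sides of the triangle at the vertex `v` of a tetrahedron lie
on the faces opposite to the other three vertices, and are numbered as these by `v.succAbove`. -/
def linkGluing (ν : P.IdealVertex) : TriangleGluing (P.LinkTriangle ν) where
  target t F := ⟨(P.target t.1.1 (t.1.2.succAbove F),
      P.perm t.1.1 (t.1.2.succAbove F) t.1.2), by
    rw [P.idealVertex_target _ (Fin.succAbove_ne _ _)]
    exact t.2⟩
  perm t F := linkPerm (P.perm t.1.1 (t.1.2.succAbove F)) t.1.2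
  target_target t F := by
    have h := succAbove_linkPerm (P.perm t.1.1 (t.1.2.succAbove F)) t.1.2 F
    refine Subtype.ext (Prod.ext ?_ ?_)
    · exact (congrArg _ h).trans (P.target_target _ _)
    · refine (congrArg (fun f => P.perm _ f _) h).trans ?_
      rw [P.perm_perm]
      exact Equiv.symm_apply_apply _ _
  perm_perm t F := by
    have h := succAbove_linkPerm (P.perm t.1.1 (t.1.2.succAbove F)) t.1.2 F
    refine (congrArg (fun f => linkPerm (P.perm _ f) _) h).trans ?_
    rw [P.perm_perm]
    exact linkPerm_inv _ _
  no_fixed_side t F h := by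
    have h1 : P.target t.1.1 (t.1.2.succAbove F) = t.1.1 :=
      congrArg (fun x => x.1.1.1) h
    have h2 : P.perm t.1.1 (t.1.2.succAbove F) t.1.2 = t.1.2 :=
      congrArg (fun x => x.1.1.2) h
    have h3 := congrArg Prod.snd h
    dsimp only at h3
    have h4 := succAbove_linkPerm (P.perm t.1.1 (t.1.2.succAbove F)) t.1.2 F
    rw [h3, h2] at h4
    exact P.no_fixed_face t.1.1 (t.1.2.succAbove F) (Prod.ext h1 h4.symm)

variable {P} in
theorem VertexRel.symm {x y : Fin n × Fin 4} (h : P.VertexRel x y) : P.VertexRel y x := by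
  obtain ⟨f, hf, h1, h2⟩ := h
  refine ⟨P.perm x.1 f f, fun h => hf ?_, ?_, ?_⟩
  · rw [h2] at h
    exact (P.perm x.1 f).injective h
  · rw [h1, P.target_target]
  · rw [h1, P.perm_perm, h2, Equiv.Perm.inv_def, Equiv.symm_apply_apply]

theorem isConnected_linkGluing (ν : P.IdealVertex) : (P.linkGluing ν).IsConnected := by
  intro Q hQ t t' ht
  let Q' : Fin n × Fin 4 → Prop := fun x => ∃ h : P.idealVertex x.1 x.2 = ν, Q ⟨x, h⟩
  have hrel : ∀ x y, P.VertexRel x y → Q' x → Q' y := by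
    rintro x ⟨_, _⟩ ⟨f, hf, rfl, rfl⟩ ⟨h, hx⟩
    obtain ⟨F, rfl⟩ := Fin.exists_succAbove_eq hf
    exact ⟨_, hQ ⟨x, h⟩ F hx⟩
  have key : ∀ x y, Relation.EqvGen P.VertexRel x y → (Q' x ↔ Q' y) := by
    intro x y h
    induction h with
    | rel x y h => exact ⟨hrel x y h, hrel y x h.symm⟩
    | refl x => exact Iff.rfl
    | symm x y _ ih => exact ih.symm
    | trans x y z _ _ ih ih' => exact ih.trans ih'
  have h : P.idealVertex t.1.1 t.1.2 = P.idealVertex t'.1.1 t'.1.2 := t.2.trans t'.2.symm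
  obtain ⟨_, h'⟩ := (key _ _ (Quot.eqvGen_exact h)).1 ⟨t.2, ht⟩
  exact h'

instance (ν : P.IdealVertex) : Nonempty (P.LinkTriangle ν) := by
  obtain ⟨t, rfl⟩ := Quot.exists_rep ν
  exact ⟨⟨t, rfl⟩⟩

/-! ### Neighbourhoods of the ideal vertices -/

theorem puncturedSimplex_lt_one {x : Fin 4 → ℝ} (hx : x ∈ puncturedSimplex 3) (v : Fin 4) :
    x v < 1 := by
  obtain ⟨⟨h0, h1⟩, hne⟩ := hx
  have hle : x v ≤ ∑ w, x w := Finset.single_le_sum (fun w _ => h0 w) (Finset.mem_univ v)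
  refine lt_of_le_of_ne (h1 ▸ hle) fun h => hne ⟨v, ?_⟩
  have h2 : ∑ u, x (v.succAbove u) = 0 := by
    have := Fin.sum_univ_succAbove x v
    rw [h1, h] at this
    linarith
  rw [Finset.sum_eq_zero_iff_of_nonneg fun u _ => h0 _] at h2
  ext w
  induction w using v.succAboveCases with
  | x => simp [h]
  | p u => simp [h2 u (Finset.mem_univ u)]

theorem comp_perm_mem_puncturedSimplex {x : Fin 4 → ℝ} (hx : x ∈ puncturedSimplex 3)
    (σ : Equiv.Perm (Fin 4)) : (fun v => x (σ v)) ∈ puncturedSimplex 3 := by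
  refine ⟨⟨fun v => hx.1.1 _, by rw [Equiv.sum_comp σ x]; exact hx.1.2⟩, ?_⟩
  rintro ⟨v, hv⟩
  have h := congrFun hv v
  simp only [Pi.single_eq_same] at h
  exact (puncturedSimplex_lt_one hx (σ v)).ne h.symm

theorem eq_of_half_lt {x : Fin 4 → ℝ} (hx : x ∈ puncturedSimplex 3) {v w : Fin 4}
    (hv : 1 / 2 < x v) (hw : 1 / 2 < x w) : v = w := by
  by_contra h
  have h1 : ∑ u ∈ {v, w}, x u ≤ ∑ u, x u :=
    Finset.sum_le_sum_of_subset_of_nonneg (Finset.subset_univ _) fun u _ _ => hx.1.1 u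
  rw [Finset.sum_pair h, hx.1.2] at h1
  linarith

theorem insertNth_mem_puncturedSimplex {y : Fin 3 → ℝ} (hy : y ∈ triangleCone (Set.Ioo 0 1))
    (v : Fin 4) : (v.insertNth (1 - ∑ u, y u) y : Fin 4 → ℝ) ∈ puncturedSimplex 3 := by
  obtain ⟨h0, h1, h2⟩ := hy
  refine ⟨⟨fun w => ?_, ?_⟩, ?_⟩
  · induction w using v.succAboveCases with
    | x => simpa using h2.le
    | p u => simpa using h0 u
  · rw [Fin.sum_univ_succAbove _ v]
    simp
  · rintro ⟨w, hw⟩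
    have h := congrFun hw v
    dsimp only at h
    rw [Fin.insertNth_apply_same] at h
    by_cases hvw : v = w
    · subst hvw
      rw [Pi.single_eq_same] at h
      linarith
    · rw [Pi.single_eq_of_ne hvw] at h
      linarith

/-- The point of the tetrahedron with barycentric coordinates `y` with respect to the vertices
other than `v` (with an arbitrary value if this is not in the interior or `∑ y ∉ (0, 1)`). -/
noncomputable def cornerPoint (v : Fin 4) (y : Fin 3 → ℝ) : puncturedSimplex 3 :=
  open Classical in
  if h : y ∈ triangleCone (Set.Ioo 0 1) then
    ⟨v.insertNth (1 - ∑ u, y u) y, insertNth_mem_puncturedSimplex h v⟩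
  else ⟨(0 : Fin 4).insertNth (1 - ∑ u, (Pi.single 0 (1 / 2) : Fin 3 → ℝ) u) (Pi.single 0 (1 / 2)),
    insertNth_mem_puncturedSimplex
      (single_mem_triangleCone (by constructor <;> norm_num) (by norm_num) 0) 0⟩

theorem cornerPoint_of_mem {v : Fin 4} {y : Fin 3 → ℝ} (h : y ∈ triangleCone (Set.Ioo 0 1)) :
    cornerPoint v y = ⟨v.insertNth (1 - ∑ u, y u) y, insertNth_mem_puncturedSimplex h v⟩ :=
  dif_pos h

theorem cornerPoint_comp_succAbove {x : puncturedSimplex 3} {v : Fin 4}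
    (h : (fun u => x.1 (v.succAbove u)) ∈ triangleCone (Set.Ioo 0 1)) :
    cornerPoint v (fun u => x.1 (v.succAbove u)) = x := by
  rw [cornerPoint_of_mem h]
  apply Subtype.ext
  ext w
  dsimp only
  have h1 := Fin.sum_univ_succAbove x.1 v
  rw [x.2.1.2] at h1
  induction w using v.succAboveCases with
  | x =>
    rw [Fin.insertNth_apply_same]
    linarith
  | p u => rw [Fin.insertNth_apply_succAbove]

theorem comp_succAbove_mem_triangleCone {ε : ℝ} {x : Fin 4 → ℝ} (hx : x ∈ puncturedSimplex 3)
    {v : Fin 4} (h : 1 - ε < x v) :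
    (fun u => x (v.succAbove u)) ∈ triangleCone (Set.Ioo 0 ε) := by
  have h1 := Fin.sum_univ_succAbove x v
  rw [hx.1.2] at h1
  have h2 := puncturedSimplex_lt_one hx v
  exact ⟨fun u => hx.1.1 _, by constructor <;> linarith⟩

/-- The relation `Rel` being symmetric, points with the same image are related by a chain. -/
theorem reflTransGen_of_mk_eq {d : ℕ} {P : FacePairing d n} {S : Set (Fin (d + 1) → ℝ)}
    {p q : Fin n × S} (h : (Quot.mk _ p : P.Glued S) = Quot.mk _ q) :
    Relation.ReflTransGen (P.Rel S) p q := by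
  have : Std.Symm (P.Rel S) := ⟨fun _ _ h => h.symm⟩
  have h' := Quot.eqvGen_exact h
  clear h
  induction h' with
  | rel p q h => exact .single h
  | refl p => exact .refl
  | symm p q _ ih => exact Std.Symm.symm _ _ ih
  | trans p q r _ _ ih ih' => exact ih.trans ih'

/-- The points of the glued space near an ideal vertex `ν`: those whose barycentric coordinate with
respect to `ν` in some tetrahedron is greater than `1 - ε`. -/
def cusp (ν : P.IdealVertex) (ε : ℝ) : Set (P.Glued (puncturedSimplex 3)) :=
  {z | ∃ (p : Fin n × puncturedSimplex 3) (v : Fin 4), Quot.mk _ p = z ∧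
    P.idealVertex p.1 v = ν ∧ 1 - ε < p.2.1 v}

variable {P} in
theorem mk_mem_cusp {ν : P.IdealVertex} {ε : ℝ} (hε : ε ≤ 1) {p : Fin n × puncturedSimplex 3} :
    (Quot.mk _ p : P.Glued (puncturedSimplex 3)) ∈ P.cusp ν ε ↔
      ∃ v, P.idealVertex p.1 v = ν ∧ 1 - ε < p.2.1 v := by
  constructor
  · have hrel : ∀ p q : Fin n × puncturedSimplex 3, P.Rel _ p q →
        (∃ v, P.idealVertex p.1 v = ν ∧ 1 - ε < p.2.1 v) →
        ∃ v, P.idealVertex q.1 v = ν ∧ 1 - ε < q.2.1 v := by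
      rintro p q ⟨f, hf, h1, h2⟩ ⟨v, hv, hpv⟩
      have hfv : f ≠ v := by
        rintro rfl
        linarith
      exact ⟨P.perm p.1 f v, by rw [h1, P.idealVertex_target _ hfv, hv], by rwa [h2]⟩
    have key : ∀ p q : Fin n × puncturedSimplex 3, Relation.EqvGen (P.Rel _) p q →
        ((∃ v, P.idealVertex p.1 v = ν ∧ 1 - ε < p.2.1 v) ↔
        ∃ v, P.idealVertex q.1 v = ν ∧ 1 - ε < q.2.1 v) := by
      intro p q h
      induction h with
      | rel p q h => exact ⟨hrel p q h, hrel q p h.symm⟩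
      | refl p => exact Iff.rfl
      | symm p q _ ih => exact ih.symm
      | trans p q r _ _ ih ih' => exact ih.trans ih'
    rintro ⟨q, v, hq, hv, hqv⟩
    exact (key q p (Quot.eqvGen_exact hq)).1 ⟨v, hv, hqv⟩
  · rintro ⟨v, hv, hpv⟩
    exact ⟨p, v, rfl, hv, hpv⟩

theorem isOpen_cusp (ν : P.IdealVertex) {ε : ℝ} (hε : ε ≤ 1) : IsOpen (P.cusp ν ε) := by
  refine isOpen_coinduced.2 ?_
  have : Quot.mk (P.Rel (puncturedSimplex 3)) ⁻¹' P.cusp ν ε =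
      ⋃ v, {p | P.idealVertex p.1 v = ν} ∩ {p | 1 - ε < p.2.1 v} := by
    ext p
    rw [Set.mem_preimage, mk_mem_cusp hε]
    simp
  rw [this]
  refine isOpen_iUnion fun v => ?_
  refine IsOpen.inter ?_ (isOpen_lt continuous_const
    ((continuous_apply v).comp (continuous_subtype_val.comp continuous_snd)))
  exact (isOpen_discrete {i : Fin n | P.idealVertex i v = ν}).preimage continuous_fst

variable {P} in
theorem cusp_mono {ν : P.IdealVertex} {ε ε' : ℝ} (h : ε ≤ ε') : P.cusp ν ε ⊆ P.cusp ν ε' := by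
  rintro z ⟨p, v, hp, hv, hpv⟩
  exact ⟨p, v, hp, hv, by linarith⟩

variable {P} in
theorem eq_of_mem_cusp {ν ν' : P.IdealVertex} {ε : ℝ} (hε : ε ≤ 1 / 2)
    {z : P.Glued (puncturedSimplex 3)} (h : z ∈ P.cusp ν ε) (h' : z ∈ P.cusp ν' ε) : ν = ν' := by
  obtain ⟨p, rfl⟩ := Quot.exists_rep z
  obtain ⟨v, rfl, hv⟩ := (mk_mem_cusp (by linarith)).1 h
  obtain ⟨w, rfl, hw⟩ := (mk_mem_cusp (by linarith)).1 h'
  rw [eq_of_half_lt p.2.2 (by linarith : 1 / 2 < p.2.1 v) (by linarith : 1 / 2 < p.2.1 w)]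

section Model

variable {X : Type*} (φ : P.Glued (puncturedSimplex 3) → X) (ν : P.IdealVertex)

/-- The parametrization of a neighbourhood of an ideal vertex by cones over the triangles of its
link. -/
noncomputable def cuspMap (p : P.LinkTriangle ν × (Fin 3 → ℝ)) : X :=
  φ (Quot.mk _ (p.1.1.1, cornerPoint p.1.1.2 p.2))

theorem triangleCone_mono {J J' : Set ℝ} (h : J ⊆ J') : triangleCone J ⊆ triangleCone J' :=
  fun _ hy => ⟨hy.1, h hy.2⟩

theorem image_cuspMap {ε : ℝ} (hε : ε ≤ 1) :
    P.cuspMap φ ν '' (Set.univ ×ˢ triangleCone (Set.Ioo 0 ε)) = φ '' P.cusp ν ε := by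
  have hsub := triangleCone_mono (Set.Ioo_subset_Ioo_right hε : Set.Ioo 0 ε ⊆ Set.Ioo 0 1)
  ext x
  constructor
  · rintro ⟨⟨⟨⟨i, v⟩, ht⟩, y⟩, ⟨-, hy⟩, rfl⟩
    refine ⟨_, ⟨_, v, rfl, ht, ?_⟩, rfl⟩
    have hy2 : ∑ u, y u < ε := hy.2.2
    rw [cornerPoint_of_mem (hsub hy)]
    simpa using hy2
  · rintro ⟨_, ⟨p, v, rfl, hv, hpv⟩, rfl⟩
    have hy := comp_succAbove_mem_triangleCone p.2.2 hpv
    refine ⟨(⟨(p.1, v), hv⟩, fun u => p.2.1 (v.succAbove u)), ⟨trivial, hy⟩, ?_⟩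
    simp only [cuspMap]
    rw [cornerPoint_comp_succAbove (hsub hy)]

theorem isModel_cuspMap [TopologicalSpace X] (hφ : Topology.IsEmbedding φ) {ε : ℝ}
    (hε : ε ≤ 1 / 2) :
    (P.linkGluing ν).IsModel (Set.Ioo 0 ε) (P.cuspMap φ ν) := by
  have hsub := triangleCone_mono
    (Set.Ioo_subset_Ioo_right (by linarith) : Set.Ioo 0 ε ⊆ Set.Ioo 0 1)
  refine ⟨fun t => ?_, ?_, ?_, ?_⟩
  · have h1 : ContinuousOn (cornerPoint t.1.2) (triangleCone (Set.Ioo 0 1)) := by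
      rw [continuousOn_iff_continuous_domRestrict]
      have : Continuous fun y : triangleCone (Set.Ioo 0 1) =>
          (⟨t.1.2.insertNth (1 - ∑ u, y.1 u) y.1, insertNth_mem_puncturedSimplex y.2 t.1.2⟩ :
            puncturedSimplex 3) := by
        refine Continuous.subtype_mk ?_ _
        refine continuous_pi fun w => ?_
        induction w using t.1.2.succAboveCases with
        | x =>
          simp only [Fin.insertNth_apply_same]
          exact continuous_const.sub (continuous_finsetSum _ fun u _ =>
            (continuous_apply u).comp continuous_subtype_val)
        | p u =>
          simp only [Fin.insertNth_apply_succAbove]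
          exact (continuous_apply u).comp continuous_subtype_val
      exact this.congr fun y => (cornerPoint_of_mem y.2).symm
    have h2 : Continuous fun x : puncturedSimplex 3 =>
        φ (Quot.mk _ (t.1.1, x) : P.Glued (puncturedSimplex 3)) :=
      hφ.continuous.comp (continuous_quot_mk.comp (Continuous.prodMk_right t.1.1))
    exact h2.comp_continuousOn (h1.mono hsub)
  · rintro ⟨t, y⟩ hy _ ⟨F, hF, rfl⟩
    have hy' := (comp_perm_mem_triangleCone (J := Set.Ioo 0 ε)
      ((P.linkGluing ν).perm t F).symm).2 hy
    refine congrArg φ (Quot.sound ⟨t.1.2.succAbove F, ?_, rfl, ?_⟩)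
    · rw [cornerPoint_of_mem (hsub hy)]
      simpa using hF
    · intro w
      dsimp only
      rw [cornerPoint_of_mem (hsub hy), cornerPoint_of_mem (hsub hy')]
      have h := congrFun (insertNth_comp_symm (P.perm t.1.1 (t.1.2.succAbove F)) t.1.2
        (1 - ∑ u, y u) y) (P.perm t.1.1 (t.1.2.succAbove F) w)
      rw [Equiv.symm_apply_apply] at h
      dsimp only
      rw [h, Equiv.sum_comp _ y]
      rfl
  · -- a chain of gluings of points near an ideal vertex is a chain of gluings in its link
    have key : ∀ p q : Fin n × puncturedSimplex 3, Relation.ReflTransGen (P.Rel _) p q →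
        ∀ (v : Fin 4) (hv : P.idealVertex p.1 v = ν), 1 / 2 < p.2.1 v →
        ∃ (w : Fin 4) (hw : P.idealVertex q.1 w = ν), 1 / 2 < q.2.1 w ∧
        Relation.EqvGen (P.linkGluing ν).PointRel (⟨(p.1, v), hv⟩, fun u => p.2.1 (v.succAbove u))
          (⟨(q.1, w), hw⟩, fun u => q.2.1 (w.succAbove u)) := by
      intro p q h v hv hpv
      induction h with
      | refl => exact ⟨v, hv, hpv, .refl _⟩
      | @tail q r _ hqr ih =>
        obtain ⟨w, hw, hqw, hgen⟩ := ih
        obtain ⟨f, hf, h1, h2⟩ := hqr.eq_comp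
        have hfw : f ≠ w := by
          rintro rfl
          linarith
        obtain ⟨F, rfl⟩ := Fin.exists_succAbove_eq hfw
        set σ := P.perm q.1 (w.succAbove F)
        refine ⟨σ w, by rw [h1, P.idealVertex_target _ hfw, hw], by rw [h2]; simpa using hqw, ?_⟩
        refine hgen.trans _ _ _ (.rel _ _ ⟨F, hf, ?_⟩)
        refine Prod.ext (Subtype.ext (Prod.ext h1 rfl)) (funext fun u => ?_)
        change r.2.1 ((σ w).succAbove u) = q.2.1 (w.succAbove ((linkPerm σ w).symm u))
        have h3 := succAbove_linkPerm σ w ((linkPerm σ w).symm u)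
        rw [Equiv.apply_symm_apply] at h3
        rw [h2, h3]
        simp only [σ, Equiv.symm_apply_apply]
    rintro ⟨t, y⟩ ⟨t', y'⟩ hy hy' h
    have h1 := reflTransGen_of_mk_eq (hφ.injective h)
    have hlt : ∀ (v : Fin 4) (y : Fin 3 → ℝ), y ∈ triangleCone (Set.Ioo 0 ε) →
        1 / 2 < (cornerPoint v y).1 v ∧ (fun u => (cornerPoint v y).1 (v.succAbove u)) = y := by
      intro v y hy
      have hy2 : ∑ u, y u < ε := hy.2.2
      rw [cornerPoint_of_mem (hsub hy)]
      simp only [Fin.insertNth_apply_same, Fin.insertNth_apply_succAbove, and_true]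
      linarith
    obtain ⟨w, hw, hqw, hgen⟩ := key _ _ h1 t.1.2 t.2 (hlt t.1.2 y hy).1
    have hww := eq_of_half_lt (cornerPoint t'.1.2 y').2 hqw (hlt t'.1.2 y' hy').1
    obtain rfl : w = t'.1.2 := hww
    rwa [(hlt t.1.2 y hy).2, (hlt t'.1.2 y' hy').2] at hgen
  · rw [P.image_cuspMap φ ν (by linarith)]
    rintro _ ⟨z, hz, rfl⟩ s hs
    rw [← hφ.map_nhdsWithin_eq, Filter.mem_map]
    refine mem_nhdsWithin_of_mem_nhds ?_
    refine P.mem_nhds_glued (fun y hy σ => comp_perm_mem_puncturedSimplex hy σ) z _ fun p hp => ?_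
    subst hp
    obtain ⟨v, hv, hpv⟩ := (mk_mem_cusp (by linarith)).1 hz
    have hy := comp_succAbove_mem_triangleCone p.2.2 hpv
    have h1 := hs ⟨(p.1, v), hv⟩ _ hy (by
      simp only [cuspMap]
      rw [cornerPoint_comp_succAbove (hsub hy)])
    have hopen : ∀ᶠ q : puncturedSimplex 3 in 𝓝 p.2, 1 - ε < q.1 v :=
      (isOpen_lt continuous_const ((continuous_apply v).comp continuous_subtype_val)).mem_nhds hpv
    have h2 : Filter.Tendsto (fun q : puncturedSimplex 3 => fun u => q.1 (v.succAbove u)) (𝓝 p.2)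
        (𝓝[triangleCone (Set.Ioo 0 ε)] fun u => p.2.1 (v.succAbove u)) := by
      refine tendsto_nhdsWithin_iff.2 ⟨?_, ?_⟩
      · exact (continuous_pi fun u => (continuous_apply (v.succAbove u)).comp
          continuous_subtype_val : Continuous fun q : puncturedSimplex 3 =>
          fun u => q.1 (v.succAbove u)).continuousAt
      · filter_upwards [hopen] with q hq using comp_succAbove_mem_triangleCone q.2 hq
    filter_upwards [h2.eventually h1, hopen] with q hq hq'
    have hyq := comp_succAbove_mem_triangleCone q.2 hq'
    simp only [cuspMap] at hq
    rwa [cornerPoint_comp_succAbove (hsub hyq)] at hq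

end Model

end FacePairing

/-! ### Ideal vertices and boundary components -/

namespace IdealTriangulation

variable {n : ℕ} {M : Type*} [TopologicalSpace M] {B : Set M} (T : IdealTriangulation n M B)

/-- The glued space, as a subspace of the manifold. -/
def realize (z : T.Glued (puncturedSimplex 3)) : M := T.homeo z

theorem isEmbedding_realize : Topology.IsEmbedding T.realize :=
  Topology.IsEmbedding.subtypeVal.comp T.homeo.isEmbedding

theorem range_realize : Set.range T.realize = Bᶜ := by
  have : T.realize = Subtype.val ∘ T.homeo := rfl
  rw [this, Set.range_comp, T.homeo.surjective.range_eq, Set.image_univ, Subtype.range_coe]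

theorem realize_notMem (z : T.Glued (puncturedSimplex 3)) : T.realize z ∉ B := (T.homeo z).2

theorem exists_realize_eq {x : M} (hx : x ∉ B) : ∃ p, T.realize (Quot.mk _ p) = x := by
  have : x ∈ Set.range T.realize := by rwa [range_realize]
  obtain ⟨z, rfl⟩ := this
  obtain ⟨p, rfl⟩ := Quot.exists_rep z
  exact ⟨p, rfl⟩

/-- The neighbourhood of size `ε` of an ideal vertex, as a subset of the manifold. -/
def cuspSet (ν : T.IdealVertex) (ε : ℝ) : Set M := T.realize '' T.cusp ν ε

variable {T}

theorem cuspSet_mono {ν : T.IdealVertex} {ε ε' : ℝ} (h : ε ≤ ε') :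
    T.cuspSet ν ε ⊆ T.cuspSet ν ε' :=
  Set.image_mono (FacePairing.cusp_mono h)

theorem disjoint_cuspSet_boundary (ν : T.IdealVertex) (ε : ℝ) : Disjoint (T.cuspSet ν ε) B := by
  rw [Set.disjoint_left]
  rintro _ ⟨z, -, rfl⟩
  exact T.realize_notMem z

theorem eq_of_mem_cuspSet {ν ν' : T.IdealVertex} {ε ε' : ℝ} (hε : ε ≤ 1 / 2) (hε' : ε' ≤ 1 / 2)
    {x : M} (h : x ∈ T.cuspSet ν ε) (h' : x ∈ T.cuspSet ν' ε') : ν = ν' := by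
  obtain ⟨z, hz, rfl⟩ := h
  obtain ⟨z', hz', h⟩ := h'
  rw [T.isEmbedding_realize.injective h] at hz'
  exact FacePairing.eq_of_mem_cusp le_rfl (FacePairing.cusp_mono hε hz)
    (FacePairing.cusp_mono hε' hz')

theorem isModel_cuspSet (ν : T.IdealVertex) {ε : ℝ} (hε : ε ≤ 1 / 2) :
    (T.linkGluing ν).IsModel (Set.Ioo 0 ε) (T.cuspMap T.realize ν) :=
  T.isModel_cuspMap T.realize ν T.isEmbedding_realize hε

theorem image_model_cuspSet (ν : T.IdealVertex) {ε : ℝ} (hε : ε ≤ 1 / 2) :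
    T.cuspMap T.realize ν '' (Set.univ ×ˢ triangleCone (Set.Ioo 0 ε)) = T.cuspSet ν ε :=
  T.image_cuspMap T.realize ν (by linarith)

theorem isPreconnected_cuspSet (ν : T.IdealVertex) {ε : ℝ} (h0 : 0 < ε) (hε : ε ≤ 1 / 2) :
    IsPreconnected (T.cuspSet ν ε) := by
  rw [← image_model_cuspSet ν hε]
  exact (isModel_cuspSet ν hε).isPreconnected_range (convex_Ioo 0 ε) (fun s hs => hs.1)
    (Set.nonempty_Ioo.2 h0) (T.isConnected_linkGluing ν)

theorem cuspSet_nonempty (ν : T.IdealVertex) {ε : ℝ} (h0 : 0 < ε) (hε : ε ≤ 1 / 2) :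
    (T.cuspSet ν ε).Nonempty := by
  rw [← image_model_cuspSet ν hε]
  obtain ⟨t⟩ := (inferInstance : Nonempty (T.LinkTriangle ν))
  refine ⟨_, (t, Pi.single 0 (ε / 2)), ⟨trivial, ?_⟩, rfl⟩
  exact single_mem_triangleCone (J := Set.Ioo 0 ε) ⟨by linarith, by linarith⟩ (by linarith) 0

theorem isOpen_cuspSet (hM : IsThreeManifoldWithBoundary M B)
    (ν : T.IdealVertex) {ε : ℝ} (hε : ε ≤ 1 / 2) : IsOpen (T.cuspSet ν ε) := by
  have : Topology.IsOpenEmbedding T.realize :=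
    ⟨T.isEmbedding_realize, by rw [range_realize]; exact hM.isClosed_boundary.isOpen_compl⟩
  exact this.isOpenMap _ (T.isOpen_cusp ν (by linarith))

theorem exists_notMem_boundary (hM : IsThreeManifoldWithBoundary M B)
    {p : M} (hp : p ∈ B) {O : Set M} (hO : O ∈ 𝓝 p) :
    ∃ x ∈ O, x ∉ B := by
  obtain ⟨W, -, -, hWO, ⟨x, hx, hxB⟩, -⟩ := hM.exists_nhds_boundary hp hO
  exact ⟨x, hWO hx, hxB⟩

theorem eq_of_mem_nhds (hM : IsThreeManifoldWithBoundary M B)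
    {p : M} (hp : p ∈ B) {ν ν' : T.IdealVertex} {ε ε' : ℝ} (hε : ε ≤ 1 / 2)
    (hε' : ε' ≤ 1 / 2) (h : B ∪ T.cuspSet ν ε ∈ 𝓝 p) (h' : B ∪ T.cuspSet ν' ε' ∈ 𝓝 p) :
    ν = ν' := by
  obtain ⟨x, ⟨hx, hx'⟩, hxB⟩ := exists_notMem_boundary hM hp (Filter.inter_mem h h')
  exact eq_of_mem_cuspSet hε hε' (hx.resolve_left hxB) (hx'.resolve_left hxB)

variable (T) in
/-- Away from the ideal vertices, the points of an ideal triangulation stay away from the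
boundary. -/
theorem exists_cuspSet_subset [CompactSpace M] {O : Set M} (hO : IsOpen O) (hBO : B ⊆ O) :
    ∃ ε > 0, ε ≤ 1 / 2 ∧ ∀ ν : T.IdealVertex, T.cuspSet ν ε ⊆ O := by
  let μ : T.Glued (puncturedSimplex 3) → ℝ := Quot.lift (fun p => ‖p.2.1‖) (by
    intro p q h
    obtain ⟨f, -, -, h2⟩ := h.eq_comp
    rw [h2]
    refine le_antisymm ?_ ?_ <;> rw [pi_norm_le_iff_of_nonneg (norm_nonneg _)] <;> intro v
    · simpa using norm_le_pi_norm (fun v => p.2.1 ((T.perm p.1 f).symm v)) (T.perm p.1 f v)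
    · exact norm_le_pi_norm p.2.1 _)
  have hμ : Continuous μ :=
    continuous_quot_lift _ (continuous_norm.comp (continuous_subtype_val.comp continuous_snd))
  have hle : ∀ (p : Fin n × puncturedSimplex 3) v, p.2.1 v ≤ μ (Quot.mk _ p) := fun p v =>
    (le_abs_self _).trans (norm_le_pi_norm p.2.1 v)
  have hlt : ∀ z, μ z < 1 := by
    intro z
    obtain ⟨p, rfl⟩ := Quot.exists_rep z
    refine (pi_norm_lt_iff one_pos).2 fun v => ?_
    rw [Real.norm_of_nonneg (p.2.2.1.1 v)]
    exact FacePairing.puncturedSimplex_lt_one p.2.2 v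
  have hK : IsCompact (T.realize ⁻¹' Oᶜ) := by
    refine T.isEmbedding_realize.isInducing.isCompact_preimage' hO.isClosed_compl.isCompact ?_
    rw [range_realize]
    exact Set.compl_subset_compl.2 hBO
  obtain ⟨m, hm, hmK⟩ : ∃ m < 1, ∀ z ∈ T.realize ⁻¹' Oᶜ, μ z ≤ m := by
    rcases (T.realize ⁻¹' Oᶜ).eq_empty_or_nonempty with he | hne
    · exact ⟨0, one_pos, by simp [he]⟩
    · obtain ⟨z, -, hz⟩ := hK.exists_isMaxOn hne hμ.continuousOn
      exact ⟨μ z, hlt z, fun w hw => hz hw⟩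
  refine ⟨min (1 / 2) (1 - m), by simp [hm], min_le_left _ _, ?_⟩
  rintro ν _ ⟨_, ⟨p, v, rfl, -, hv⟩, rfl⟩
  by_contra hx
  have h1 := hmK _ hx
  have h2 := hle p v
  have h3 := min_le_right (1 / 2) (1 - m)
  linarith

variable (T) in
theorem isOpen_boundary_union_iUnion_cuspSet [T2Space M] {ε : ℝ} (h0 : 0 < ε) (hε : ε ≤ 1 / 2) :
    IsOpen (B ∪ ⋃ ν, T.cuspSet ν ε) := by
  let D : Set (Fin 4 → ℝ) := stdSimplex ℝ (Fin 4) ∩ ⋂ v, {x | x v ≤ 1 - ε}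
  have hD : IsCompact D := (isCompact_stdSimplex ℝ (Fin 4)).inter_right
    (isClosed_iInter fun v => isClosed_le (continuous_apply v) continuous_const)
  have hDsub : ∀ x ∈ D, x ∈ puncturedSimplex 3 := by
    rintro x ⟨hx, hx'⟩
    refine ⟨hx, ?_⟩
    rintro ⟨v, rfl⟩
    have := Set.mem_iInter.1 hx' v
    simp only [Set.mem_ofPred_eq, Pi.single_eq_same] at this
    linarith
  have : CompactSpace D := isCompact_iff_compactSpace.1 hD
  have hcont : Continuous fun q : Fin n × D =>
      T.realize (Quot.mk _ (q.1, ⟨q.2.1, hDsub _ q.2.2⟩)) := by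
    refine T.isEmbedding_realize.continuous.comp (continuous_quot_mk.comp ?_)
    exact continuous_fst.prodMk (Continuous.subtype_mk
      (continuous_subtype_val.comp continuous_snd) _)
  rw [← isClosed_compl_iff]
  convert (isCompact_range hcont).isClosed
  ext x
  simp only [Set.mem_compl_iff, Set.mem_union, Set.mem_iUnion, not_or, not_exists, Set.mem_range]
  constructor
  · rintro ⟨hxB, hx⟩
    obtain ⟨p, rfl⟩ := T.exists_realize_eq hxB
    refine ⟨(p.1, ⟨p.2.1, p.2.2.1, Set.mem_iInter.2 fun v => ?_⟩), rfl⟩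
    by_contra hv
    exact hx (T.idealVertex p.1 v) ⟨_, ⟨p, v, rfl, rfl, not_le.1 hv⟩, rfl⟩
  · rintro ⟨q, rfl⟩
    refine ⟨T.realize_notMem _, ?_⟩
    rintro ν ⟨z, hz, hzq⟩
    rw [T.isEmbedding_realize.injective hzq] at hz
    obtain ⟨v, -, hv⟩ := (FacePairing.mk_mem_cusp (by linarith)).1 hz
    have := Set.mem_iInter.1 q.2.2.2 v
    simp only [Set.mem_ofPred_eq] at this
    linarith

variable (T) in
/-- Near each point of the boundary the manifold consists of boundary points and of points near a
single ideal vertex. -/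
theorem exists_boundary_union_cuspSet_mem_nhds [T2Space M]
    (hM : IsThreeManifoldWithBoundary M B) {p : M} (hp : p ∈ B) :
    ∃ ν : T.IdealVertex, ∀ ε > 0, ε ≤ 1 / 2 → B ∪ T.cuspSet ν ε ∈ 𝓝 p := by
  have key : ∀ ε > 0, ε ≤ 1 / 2 → ∃ ν, B ∪ T.cuspSet ν ε ∈ 𝓝 p := by
    intro ε h0 hε
    obtain ⟨W, hW, hpW, hWO, ⟨x, hxW, hxB⟩, hWB, -⟩ := hM.exists_nhds_boundary hp
      ((T.isOpen_boundary_union_iUnion_cuspSet h0 hε).mem_nhds (.inl hp))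
    obtain ⟨ν, hν⟩ := Set.mem_iUnion.1 ((hWO hxW).resolve_left hxB)
    refine ⟨ν, Filter.mem_of_superset (hW.mem_nhds hpW) fun y hy => ?_⟩
    by_cases hyB : y ∈ B
    · exact .inl hyB
    have hy' : y ∈ W \ B := ⟨hy, hyB⟩
    have hne : (W \ B ∩ T.cuspSet ν ε).Nonempty := ⟨x, ⟨hxW, hxB⟩, hν⟩
    refine .inr (IsPreconnected.subset_left_of_subset_union (isOpen_cuspSet hM ν hε)
      (isOpen_iUnion fun ν' : {ν' // ν' ≠ ν} => isOpen_cuspSet hM ν'.1 hε) ?_ ?_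
      hne hWB hy')
    · rw [Set.disjoint_left]
      intro z hz hz'
      obtain ⟨ν', hν'⟩ := Set.mem_iUnion.1 hz'
      exact ν'.2 (eq_of_mem_cuspSet hε hε hν' hz)
    · rintro z ⟨hz, hzB⟩
      obtain ⟨ν', hν'⟩ := Set.mem_iUnion.1 ((hWO hz).resolve_left hzB)
      by_cases h : ν' = ν
      · exact .inl (h ▸ hν')
      · exact .inr (Set.mem_iUnion.2 ⟨⟨ν', h⟩, hν'⟩)
  obtain ⟨ν, hν⟩ := key (1 / 2) (by norm_num) le_rfl
  refine ⟨ν, fun ε h0 hε => ?_⟩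
  obtain ⟨ν', hν'⟩ := key ε h0 hε
  rwa [eq_of_mem_nhds hM hp le_rfl hε hν hν']

variable (T) in
/-- The components of the boundary correspond to the ideal vertices, the small neighbourhoods of
an ideal vertex being the sets of interior points near the corresponding component. -/
theorem exists_equiv_idealVertex [T2Space M] [CompactSpace M]
    (hM : IsThreeManifoldWithBoundary M B) {κ : Type*} [Finite κ] (C : κ → Set M)
    (hcomp : ∀ c, IsCompact (C c)) (hconn : ∀ c, IsPreconnected (C c))
    (hne : ∀ c, (C c).Nonempty) (hdisj : ∀ c d, c ≠ d → Disjoint (C c) (C d))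
    (hB : B = ⋃ c, C c) :
    ∃ e : κ ≃ T.IdealVertex,
      (∀ c U, IsOpen U → C c ⊆ U → ∃ ε > 0, ε ≤ 1 / 2 ∧ T.cuspSet (e c) ε ⊆ U) ∧
      (∀ c, ∀ ε > 0, ε ≤ 1 / 2 → IsOpen (C c ∪ T.cuspSet (e c) ε)) ∧
      ∀ i v c, T.VertexOn i v (C c) ↔ T.idealVertex i v = e c := by
  classical
  have hCB : ∀ c, C c ⊆ B := fun c => hB ▸ Set.subset_iUnion C c
  have hatt : ∀ p ∈ B, ∃ ν : T.IdealVertex, ∀ ε > 0, ε ≤ 1 / 2 → B ∪ T.cuspSet ν ε ∈ 𝓝 p :=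
    fun p hp => T.exists_boundary_union_cuspSet_mem_nhds hM hp
  -- all points of a component are attached to the same ideal vertex
  have hattC : ∀ c, ∃ ν : T.IdealVertex, ∀ p ∈ C c, ∀ ε > 0, ε ≤ 1 / 2 →
      B ∪ T.cuspSet ν ε ∈ 𝓝 p := by
    intro c
    obtain ⟨p₀, hp₀⟩ := hne c
    obtain ⟨ν₀, -⟩ := hatt p₀ (hCB c hp₀)
    have : Nonempty T.IdealVertex := ⟨ν₀⟩
    choose! a ha using hatt
    let _ : TopologicalSpace T.IdealVertex := ⊥
    have : DiscreteTopology T.IdealVertex := ⟨rfl⟩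
    have hcont : ContinuousOn a (C c) := by
      intro p hp
      rw [ContinuousWithinAt, nhds_discrete, Filter.tendsto_pure]
      have h1 := ha p (hCB c hp) (1 / 2) (by norm_num) le_rfl
      filter_upwards [mem_nhdsWithin_of_mem_nhds (eventually_mem_nhds_iff.2 h1),
        self_mem_nhdsWithin] with q hq hqC
      exact eq_of_mem_nhds hM (hCB c hqC) le_rfl le_rfl
        (ha q (hCB c hqC) (1 / 2) (by norm_num) le_rfl) hq
    refine ⟨a p₀, fun p hp => ?_⟩
    rw [(hconn c).constant hcont hp₀ hp]
    exact ha p (hCB c hp)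
  choose e he using hattC
  -- being connected, the neighbourhood of an ideal vertex cannot be close to other components
  have hOthers : ∀ c, IsCompact (⋃ d : {d // d ≠ c}, C d) := fun c =>
    isCompact_iUnion fun d => hcomp d.1
  have hOthersDisj : ∀ c, Disjoint (C c) (⋃ d : {d // d ≠ c}, C d) := fun c =>
    Set.disjoint_iUnion_right.2 fun d => hdisj c d d.2.symm
  have hBsub : ∀ c, B ⊆ C c ∪ ⋃ d : {d // d ≠ c}, C d := by
    intro c p hp
    rw [hB] at hp
    obtain ⟨d, hd⟩ := Set.mem_iUnion.1 hp
    by_cases h : d = c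
    · exact .inl (h ▸ hd)
    · exact .inr (Set.mem_iUnion.2 ⟨⟨d, h⟩, hd⟩)
  have ha : ∀ c U, IsOpen U → C c ⊆ U → ∃ ε > 0, ε ≤ 1 / 2 ∧ T.cuspSet (e c) ε ⊆ U := by
    intro c U hU hCU
    obtain ⟨U₁, U₂, h1, h2, hC1, hC2, h12⟩ :=
      SeparatedNhds.of_isCompact_isCompact (hcomp c) (hOthers c) (hOthersDisj c)
    obtain ⟨ε, h0, hε, hsub⟩ := T.exists_cuspSet_subset ((hU.inter h1).union h2)
      ((hBsub c).trans (Set.union_subset_union (Set.subset_inter hCU hC1) hC2))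
    refine ⟨ε, h0, hε, ?_⟩
    obtain ⟨p, hp⟩ := hne c
    obtain ⟨x, ⟨hx1, hx2⟩, hxB⟩ := exists_notMem_boundary hM (hCB c hp)
      (Filter.inter_mem ((hU.inter h1).mem_nhds ⟨hCU hp, hC1 hp⟩) (he c p hp ε h0 hε))
    exact (IsPreconnected.subset_left_of_subset_union (hU.inter h1) h2
      (h12.mono_left Set.inter_subset_right) (hsub _) ⟨x, hx2.resolve_left hxB, hx1⟩
      (isPreconnected_cuspSet _ h0 hε)).trans Set.inter_subset_left
  have hinj : Function.Injective e := by
    intro c d hcd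
    by_contra hne'
    obtain ⟨U₁, U₂, h1, h2, hC1, hC2, h12⟩ :=
      SeparatedNhds.of_isCompact_isCompact (hcomp c) (hcomp d) (hdisj c d hne')
    obtain ⟨ε, h0, hε, hsub⟩ := ha c U₁ h1 hC1
    obtain ⟨ε', h0', hε', hsub'⟩ := ha d U₂ h2 hC2
    obtain ⟨x, hx⟩ := cuspSet_nonempty (e c) (lt_min h0 h0') ((min_le_left ε ε').trans hε)
    refine Set.disjoint_left.1 h12 (hsub (cuspSet_mono (min_le_left _ _) hx)) (hsub' ?_)
    rw [← hcd]
    exact cuspSet_mono (min_le_right _ _) hx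
  have hsurj : Function.Surjective e := by
    intro ν
    obtain ⟨ε, h0, hε, hsub⟩ := T.exists_cuspSet_subset
      (O := ⋃ c, ⋃ p : C c, interior (B ∪ T.cuspSet (e c) (1 / 2)))
      (isOpen_iUnion fun c => isOpen_iUnion fun p => isOpen_interior) (by
        intro p hp
        rw [hB] at hp
        obtain ⟨c, hc⟩ := Set.mem_iUnion.1 hp
        exact Set.mem_iUnion.2 ⟨c, Set.mem_iUnion.2 ⟨⟨p, hc⟩,
          mem_interior_iff_mem_nhds.2 (he c p hc _ (by norm_num) le_rfl)⟩⟩)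
    obtain ⟨x, hx⟩ := cuspSet_nonempty ν h0 hε
    obtain ⟨c, hc⟩ := Set.mem_iUnion.1 (hsub ν hx)
    obtain ⟨p, hp⟩ := Set.mem_iUnion.1 hc
    exact ⟨c, eq_of_mem_cuspSet le_rfl hε ((interior_subset hp).resolve_left
      (Set.disjoint_left.1 (disjoint_cuspSet_boundary ν ε) hx)) hx⟩
  refine ⟨Equiv.ofBijective e ⟨hinj, hsurj⟩, ha, ?_, ?_⟩
  · intro c ε h0 hε
    rw [isOpen_iff_mem_nhds]
    rintro p (hp | hp)
    · filter_upwards [he c p hp ε h0 hε, (hOthers c).isClosed.isOpen_compl.mem_nhds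
        (Set.disjoint_left.1 (hOthersDisj c) hp)] with q hq hq'
      rcases hq with hq | hq
      · exact .inl ((hBsub c hq).resolve_right hq')
      · exact .inr hq
    · exact Filter.mem_of_superset ((isOpen_cuspSet hM _ hε).mem_nhds hp) Set.subset_union_right
  · have htend : ∀ i v c, T.idealVertex i v = e c → T.VertexOn i v (C c) := by
      intro i v c hv
      rw [VertexOn, (hasBasis_nhdsSet (C c)).tendsto_right_iff]
      rintro U ⟨hU, hCU⟩
      obtain ⟨ε, h0, hε, hsub⟩ := ha c U hU hCU
      have hmem : {x : Fin 4 → ℝ | 1 - ε < x v} ∈ 𝓝 (Pi.single v 1) :=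
        (isOpen_lt continuous_const (continuous_apply v)).mem_nhds (by simpa using h0)
      filter_upwards [Filter.preimage_mem_comap hmem] with x hx
      exact hsub ⟨_, ⟨(i, x), v, rfl, hv, hx⟩, rfl⟩
    intro i v c
    refine ⟨fun h => ?_, htend i v c⟩
    obtain ⟨d, hd⟩ := hsurj (T.idealVertex i v)
    rw [← hd]
    by_contra hdc
    have hdc' : c ≠ d := fun h => hdc (h ▸ rfl)
    obtain ⟨U₁, U₂, h1, h2, hC1, hC2, h12⟩ :=
      SeparatedNhds.of_isCompact_isCompact (hcomp c) (hcomp d) (hdisj c d hdc')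
    have hbot := (Filter.Tendsto.disjoint h
      (Filter.disjoint_iff.2 ⟨U₁, h1.mem_nhdsSet.2 hC1, U₂, h2.mem_nhdsSet.2 hC2, h12⟩)
      (htend i v d hd.symm))
    rw [disjoint_self] at hbot
    -- a vertex of the tetrahedron is a limit of points of the punctured tetrahedron
    have : (Filter.comap (Subtype.val : puncturedSimplex 3 → _) (𝓝 (Pi.single v 1))).NeBot := by
      rw [Filter.comap_neBot_iff]
      intro t ht
      have hcont : Continuous fun s : ℝ =>
          (v.insertNth (1 - s) (Pi.single 0 s : Fin 3 → ℝ) : Fin 4 → ℝ) := by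
        refine continuous_pi fun w => ?_
        induction w using v.succAboveCases with
        | x =>
          simp only [Fin.insertNth_apply_same]
          fun_prop
        | p u =>
          simp only [Fin.insertNth_apply_succAbove]
          exact (continuous_apply u).comp (continuous_single (A := fun _ : Fin 3 => ℝ) 0)
      have h0 : (v.insertNth (1 - 0) (Pi.single 0 0 : Fin 3 → ℝ) : Fin 4 → ℝ) = Pi.single v 1 := by
        ext w
        induction w using v.succAboveCases with
        | x => simp
        | p u => simp
      have h1 := (hcont.tendsto 0).mono_left (nhdsWithin_le_nhds (s := Set.Ioi 0))
      rw [h0] at h1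
      obtain ⟨s, hs, hs0, hs1⟩ := ((h1.eventually ht).and (Ioo_mem_nhdsGT one_pos)).exists
      have hy : (Pi.single 0 s : Fin 3 → ℝ) ∈ triangleCone (Set.Ioo 0 1) :=
        single_mem_triangleCone (J := Set.Ioo 0 1) ⟨hs0, hs1⟩ (le_of_lt hs0) 0
      refine ⟨⟨_, FacePairing.insertNth_mem_puncturedSimplex hy v⟩, ?_⟩
      simpa using (show _ ∈ t from hs)
    exact this.ne hbot

/-! ### Connectedness -/

/-- The interior of a connected 3-manifold with boundary is connected. -/
theorem isPreconnected_compl_boundary [PreconnectedSpace M]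
    (hM : IsThreeManifoldWithBoundary M B) : IsPreconnected Bᶜ := by
  rw [isPreconnected_iff_subset_of_disjoint]
  intro A A' hA hA' hsub hinter
  have hcover : Set.univ ⊆ interior (A ∪ B) ∪ interior (A' ∪ B) := by
    intro p _
    by_cases hp : p ∈ B
    · obtain ⟨W, hW, hpW, -, -, hconn, -⟩ := hM.exists_nhds_boundary hp Filter.univ_mem
      have h : W \ B ⊆ A ∨ W \ B ⊆ A' := by
        refine isPreconnected_iff_subset_of_disjoint.1 hconn A A' hA hA'
          (fun x hx => hsub hx.2) ?_
        rw [← Set.subset_empty_iff, ← hinter]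
        exact Set.inter_subset_inter_left _ fun x hx => hx.2
      refine h.imp (fun h => ?_) fun h => ?_ <;>
      · refine mem_interior.2 ⟨W, fun x hx => ?_, hW, hpW⟩
        by_cases hxB : x ∈ B
        · exact .inr hxB
        · exact .inl (h ⟨hx, hxB⟩)
    · exact (hsub hp).imp (fun h => interior_mono Set.subset_union_left (hA.interior_eq.symm ▸ h))
        fun h => interior_mono Set.subset_union_left (hA'.interior_eq.symm ▸ h)
  have hempty : Set.univ ∩ (interior (A ∪ B) ∩ interior (A' ∪ B)) = ∅ := by
    rw [Set.univ_inter, ← Set.not_nonempty_iff_eq_empty]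
    rintro ⟨p, hp⟩
    have hoff : ∀ x ∈ interior (A ∪ B) ∩ interior (A' ∪ B), x ∈ B := by
      rintro x ⟨h1, h2⟩
      by_contra hx
      have : x ∈ Bᶜ ∩ (A ∩ A') := ⟨hx, (interior_subset h1).resolve_right hx,
        (interior_subset h2).resolve_right hx⟩
      rwa [hinter] at this
    obtain ⟨x, hx, hxB⟩ := exists_notMem_boundary hM (hoff p hp)
      ((isOpen_interior.inter isOpen_interior).mem_nhds hp)
    exact hxB (hoff x hx)
  refine (isPreconnected_iff_subset_of_disjoint.1 isPreconnected_univ _ _ isOpen_interior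
    isOpen_interior hcover hempty).imp (fun h x hx => ?_) fun h x hx => ?_
  · exact (interior_subset (h trivial)).resolve_right hx
  · exact (interior_subset (h trivial)).resolve_right hx

variable (T) in
/-- The tetrahedra cannot be divided into two families without common faces. -/
theorem forall_of_forall_target [PreconnectedSpace M]
    (hM : IsThreeManifoldWithBoundary M B) (Q : Fin n → Prop)
    (hQ : ∀ i f, Q i → Q (T.target i f)) (i j : Fin n) (hi : Q i) : Q j := by
  have : PreconnectedSpace ↥(Bᶜ) := Subtype.preconnectedSpace (isPreconnected_compl_boundary hM)
  have : PreconnectedSpace (T.Glued (puncturedSimplex 3)) :=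
    T.homeo.symm.surjective.denseRange.preconnectedSpace T.homeo.symm.continuous
  have hrel : ∀ p q : Fin n × puncturedSimplex 3, T.Rel _ p q → (Q p.1 = Q q.1) := by
    have h : ∀ p q : Fin n × puncturedSimplex 3, T.Rel _ p q → Q p.1 → Q q.1 := by
      rintro p q ⟨f, -, h, -⟩ hp
      rw [h]
      exact hQ _ _ hp
    exact fun p q hpq => propext ⟨h p q hpq, h q p hpq.symm⟩
  have hclopen : IsClopen
      {z : T.Glued (puncturedSimplex 3) | Quot.lift (fun p => Q p.1) hrel z} := by
    constructor
    · exact ⟨isOpen_coinduced.2 ((isOpen_discrete {i | ¬ Q i}).preimage continuous_fst)⟩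
    · exact isOpen_coinduced.2 ((isOpen_discrete {i | Q i}).preimage continuous_fst)
  let x := FacePairing.cornerPoint 0 0
  have huniv := hclopen.eq_univ ⟨Quot.mk _ (i, x), hi⟩
  exact (huniv ▸ Set.mem_univ _ : (Quot.mk _ (j, x) : T.Glued (puncturedSimplex 3)) ∈ _)

end IdealTriangulation

/-! ### Cocycles near the boundary -/

section Boundary

variable {M : Type*} [TopologicalSpace M] {B : Set M}

theorem IsThreeManifoldWithBoundary.neBot_nhdsWithin_compl_boundary
    (hM : IsThreeManifoldWithBoundary M B) (p : M) : (𝓝[Bᶜ] p).NeBot := by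
  rw [← mem_closure_iff_nhdsWithin_neBot, mem_closure_iff_nhds]
  intro O hO
  by_cases hp : p ∈ B
  · obtain ⟨x, hx, hxB⟩ := IdealTriangulation.exists_notMem_boundary hM hp hO
    exact ⟨x, hx, hxB⟩
  · exact ⟨p, mem_of_mem_nhds hO, hp⟩

/-- The cocycles of the interior of a 3-manifold extend across its boundary. -/
theorem IsThreeManifoldWithBoundary.exists_isLocalCocycle_extension
    (hM : IsThreeManifoldWithBoundary M B) {U : Set M} (hU : IsOpen U) {c : M → M → ZMod 2}
    (hc : IsLocalCocycle c (U \ B)) :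
    ∃ c', IsLocalCocycle c' U ∧ ∀ x ∈ U \ B, ∀ y ∈ U \ B, c' x y = c x y := by
  have hneBot := hM.neBot_nhdsWithin_compl_boundary
  -- primitives near each point
  have hloc : ∀ p ∈ U, ∃ W f, IsOpen W ∧ p ∈ W ∧ W ⊆ U ∧ IsPrimitive c f (W \ B) ∧
      (p ∉ B → f = c p) := by
    intro p hpU
    by_cases hp : p ∈ B
    · obtain ⟨W, hW, hpW, hWU, -, -, h⟩ := hM.exists_nhds_boundary hp (hU.mem_nhds hpU)
      obtain ⟨f, hf⟩ := h c (hc.mono (Set.sdiff_subset_sdiff_left hWU))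
      exact ⟨W, f, hW, hpW, hWU, hf, fun h => (h hp).elim⟩
    · obtain ⟨O, hO, hpO, h⟩ := hc.exists_isOpen (p := p) ⟨hpU, hp⟩
      exact ⟨U ∩ O, c p, hU.inter hO, ⟨hpU, hpO⟩, Set.inter_subset_left,
        h.mono fun x hx => ⟨⟨hx.1.1, hx.2⟩, hx.1.2⟩, fun _ => rfl⟩
  choose! W f hW hpW hWU hf hfc using hloc
  have hex : ∀ p ∈ U, ∀ q ∈ W p, ∃ a, (∀ᶠ x in 𝓝[Bᶜ] q, f p x + f q x = a) ∧
      (p ∉ B → q ∉ B → a = c p q) := by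
    intro p hp q hq
    have hqU := hWU p hp hq
    by_cases hqB : q ∈ B
    · obtain ⟨O, hO, hqO, hOW, ⟨y, hy⟩, hconn, -⟩ := hM.exists_nhds_boundary hqB
        (((hW p hp).inter (hW q hqU)).mem_nhds ⟨hq, hpW q hqU⟩)
      refine ⟨f p y + f q y, ?_, fun _ h => (h hqB).elim⟩
      filter_upwards [mem_nhdsWithin_of_mem_nhds (hO.mem_nhds hqO), self_mem_nhdsWithin]
        with x hxO hxB
      exact ((hf p hp).mono (Set.sdiff_subset_sdiff_left (hOW.trans
        Set.inter_subset_left))).add_eq_add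
        ((hf q hqU).mono (Set.sdiff_subset_sdiff_left (hOW.trans Set.inter_subset_right))) hconn
        ⟨hxO, hxB⟩ hy
    · refine ⟨f p q, ?_, fun hpB _ => by rw [hfc p hp hpB]⟩
      have h := hf p hp q ⟨hq, hqB⟩
      rw [nhdsWithin_eq_nhds.2 (((hW p hp).sdiff hM.isClosed_boundary).mem_nhds ⟨hq, hqB⟩)] at h
      filter_upwards [mem_nhdsWithin_of_mem_nhds h] with x hx
      rw [hfc q hqU hqB]
      grind
  classical
  let c' : M → M → ZMod 2 := fun p q =>
    if h : ∃ a, (∀ᶠ x in 𝓝[Bᶜ] q, f p x + f q x = a) ∧ (p ∉ B → q ∉ B → a = c p q) then h.choose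
    else c p q
  have hc' : ∀ p ∈ U, ∀ q ∈ W p, ∀ᶠ x in 𝓝[Bᶜ] q, f p x + f q x = c' p q := by
    intro p hp q hq
    have h := hex p hp q hq
    simp only [c', dif_pos h]
    exact h.choose_spec.1
  refine ⟨c', fun p hp => ?_, fun p hp q hq => ?_⟩
  · have hUW : 𝓝[U] p = 𝓝 p := nhdsWithin_eq_nhds.2 (hU.mem_nhds hp)
    rw [hUW]
    filter_upwards [(hW p hp).mem_nhds (hpW p hp)] with q hq
    have hqU := hWU p hp hq
    have h := hc' p hp q hq
    rw [eventually_nhdsWithin_iff, ← eventually_eventually_nhds] at h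
    refine mem_nhdsWithin_of_mem_nhds ?_
    filter_upwards [h, (hW p hp).mem_nhds hq, (hW q hqU).mem_nhds (hpW q hqU)] with x hx hxp hxq
    rw [← eventually_nhdsWithin_iff] at hx
    obtain ⟨y, hy1, hy2, hy3⟩ :=
      (hx.and ((hc' p hp x hxp).and (hc' q hqU x hxq))).exists
    grind
  · by_cases h : ∃ a, (∀ᶠ x in 𝓝[Bᶜ] q, f p x + f q x = a) ∧ (p ∉ B → q ∉ B → a = c p q)
    · simp only [c', dif_pos h]
      exact h.choose_spec.2 hp.2 hq.2
    · simp only [c', dif_neg h]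

/-- Primitives on the interior of a 3-manifold of a cocycle extend across its boundary. -/
theorem IsThreeManifoldWithBoundary.exists_isPrimitive_extension
    (hM : IsThreeManifoldWithBoundary M B) {U : Set M} (hU : IsOpen U) {c : M → M → ZMod 2}
    (hc : IsLocalCocycle c U) {f : M → ZMod 2} (hf : IsPrimitive c f (U \ B)) :
    ∃ f', IsPrimitive c f' U := by
  have hneBot := hM.neBot_nhdsWithin_compl_boundary
  have hex : ∀ p ∈ U, ∃ a, ∀ᶠ x in 𝓝[Bᶜ] p, f x + c p x = a := by
    intro p hp
    obtain ⟨O, hO, hpO, h⟩ := hc.exists_isOpen hp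
    have hOU := (hU.inter hO).mem_nhds ⟨hp, hpO⟩
    by_cases hpB : p ∈ B
    · obtain ⟨W, hW, hpW, hWO, ⟨y, hy⟩, hconn, -⟩ := hM.exists_nhds_boundary hpB hOU
      refine ⟨f y + c p y, ?_⟩
      filter_upwards [mem_nhdsWithin_of_mem_nhds (hW.mem_nhds hpW), self_mem_nhdsWithin]
        with x hxW hxB
      exact (hf.mono (Set.sdiff_subset_sdiff_left (hWO.trans Set.inter_subset_left))).add_eq_add
        (h.mono (Set.sdiff_subset.trans hWO)) hconn ⟨hxW, hxB⟩ hy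
    · refine ⟨f p, ?_⟩
      have h := hf p ⟨hp, hpB⟩
      rw [nhdsWithin_eq_nhds.2 ((hU.sdiff hM.isClosed_boundary).mem_nhds ⟨hp, hpB⟩)] at h
      filter_upwards [mem_nhdsWithin_of_mem_nhds h] with x hx
      grind
  choose! f' hf' using hex
  refine ⟨f', fun p hp => ?_⟩
  have h1 := hf' p hp
  rw [eventually_nhdsWithin_iff, ← eventually_eventually_nhds] at h1
  filter_upwards [hc p hp, mem_nhdsWithin_of_mem_nhds h1, self_mem_nhdsWithin] with q hq hq1 hqU
  rw [← eventually_nhdsWithin_iff] at hq1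
  rw [nhdsWithin_eq_nhds.2 (hU.mem_nhds hqU)] at hq
  obtain ⟨x, hx1, hx2, hx3⟩ :=
    (hq1.and ((hf' q hqU).and (mem_nhdsWithin_of_mem_nhds hq))).exists
  grind

end Boundary

/-! ### The genus of a link -/

/-- An additive relation between `A` and `A'` that is defined on all of `A` and under which only
elements of `S` correspond to elements of `S'` bounds the dimension of `A / S` by that of
`A' / S'`. -/
theorem finrank_add_finrank_le_of_relation {V V' : Type*} [AddCommGroup V] [Module (ZMod 2) V]
    [Finite V] [AddCommGroup V'] [Module (ZMod 2) V'] [Finite V'] {A S : Submodule (ZMod 2) V}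
    {A' S' : Submodule (ZMod 2) V'} (hS : S ≤ A) (hS' : S' ≤ A') (R : V → V' → Prop)
    (hadd : ∀ a b a' b', R a a' → R b b' → R (a + b) (a' + b'))
    (hex : ∀ a ∈ A, ∃ a' ∈ A', R a a') (hmem : ∀ a a', R a a' → a' ∈ S' → a ∈ S) :
    Module.finrank (ZMod 2) A + Module.finrank (ZMod 2) S' ≤
      Module.finrank (ZMod 2) A' + Module.finrank (ZMod 2) S := by
  have h1 := Submodule.finrank_quotient_add_finrank (S.submoduleOf A)
  have h2 := Submodule.finrank_quotient_add_finrank (S'.submoduleOf A')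
  rw [(Submodule.submoduleOfEquivOfLe hS).finrank_eq] at h1
  rw [(Submodule.submoduleOfEquivOfLe hS').finrank_eq] at h2
  have hex' : ∀ a : A, ∃ a' : A', R a a' := fun a => by
    obtain ⟨a', h, h'⟩ := hex a a.2
    exact ⟨⟨a', h⟩, h'⟩
  choose φ hφ using hex'
  have hinj : Function.Injective fun q : A ⧸ S.submoduleOf A =>
      (Submodule.Quotient.mk (φ q.out) : A' ⧸ S'.submoduleOf A') := by
    intro q q' h
    have h3 : (φ q.out - φ q'.out : A') ∈ S'.submoduleOf A' := (Submodule.Quotient.eq _).1 h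
    change (φ q.out : V') - φ q'.out ∈ S' at h3
    rw [ZModModule.sub_eq_add] at h3
    have h4 := hmem _ _ (hadd _ _ _ _ (hφ q.out) (hφ q'.out)) h3
    have h5 : (q.out - q'.out : A) ∈ S.submoduleOf A := by
      change (q.out : V) - q'.out ∈ S
      rwa [ZModModule.sub_eq_add]
    have h6 := (Submodule.Quotient.eq _).2 h5
    have hout : ∀ q : A ⧸ S.submoduleOf A, Submodule.Quotient.mk q.out = q :=
      fun q => Quotient.out_eq q
    rwa [hout, hout] at h6
  have : Finite (A' ⧸ S'.submoduleOf A') := Finite.of_surjective _ (Submodule.mkQ_surjective _)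
  have hcard := Nat.card_le_card_of_injective _ hinj
  rw [Module.natCard_eq_pow_finrank (K := ZMod 2) (V := A ⧸ S.submoduleOf A),
    Module.natCard_eq_pow_finrank (K := ZMod 2) (V := A' ⧸ S'.submoduleOf A'),
    Nat.card_zmod] at hcard
  have := (Nat.pow_le_pow_iff_right (by norm_num : 1 < 2)).1 hcard
  omega

namespace IdealTriangulation

variable {n : ℕ} {M : Type*} [TopologicalSpace M] [T2Space M] [CompactSpace M] {B : Set M}
  {T : IdealTriangulation n M B}

/-- The link of an ideal vertex has the same first Betti number (over `ZMod 2`) as the corresponding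
component `C` of the boundary: the cocycles on neighbourhoods of `C` restrict both to `C` and to
neighbourhoods of the ideal vertex, and are trivial on one if and only if they are so on the other,
up to shrinking the neighbourhood. -/
theorem finrank_transitions_linkGluing (hM : IsThreeManifoldWithBoundary M B) {ν : T.IdealVertex}
    {C : Set M} (hC : IsCompact C) (hCB : C ⊆ B)
    (hU : ∀ U, IsOpen U → C ⊆ U → ∃ ε > 0, ε ≤ 1 / 2 ∧ T.cuspSet ν ε ⊆ U)
    (hopen : ∀ ε > 0, ε ≤ 1 / 2 → IsOpen (C ∪ T.cuspSet ν ε)) {J : Type*} [Fintype J]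
    {P : TriangleGluing J} {π : J × (Fin 3 → ℝ) → M} (hπ : P.IsModel {1} π)
    (hπC : π '' (Set.univ ×ˢ triangleCone {1}) = C) :
    Module.finrank (ZMod 2) (T.linkGluing ν).transitions +
        Module.finrank (ZMod 2) P.trivialTransitions =
      Module.finrank (ZMod 2) P.transitions +
        Module.finrank (ZMod 2) (T.linkGluing ν).trivialTransitions := by
  have := hM.secondCountableTopology
  have := TopologicalSpace.metrizableSpace_of_t3_secondCountable M
  let _ := Fintype.ofFinite (T.LinkTriangle ν)
  let ψ := T.cuspMap T.realize ν
  let L := T.linkGluing ν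
  have hI0 : ∀ ε : ℝ, ∀ s ∈ Set.Ioo 0 ε, 0 < s := fun ε s hs => hs.1
  have hIn : ∀ ε : ℝ, 0 < ε → (Set.Ioo 0 ε).Nonempty := fun ε h => Set.nonempty_Ioo.2 h
  have h10 : ∀ s ∈ ({1} : Set ℝ), 0 < s := by simp
  have hdiff : ∀ ε, (C ∪ T.cuspSet ν ε) \ B = T.cuspSet ν ε := by
    intro ε
    rw [Set.union_sdiff_distrib, Set.sdiff_eq_empty.2 hCB, Set.empty_union,
      (disjoint_cuspSet_boundary ν ε).sdiff_eq_left]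
  -- transition cocycles that are restrictions of the same cocycle on a neighbourhood of `C`
  let R : (T.LinkTriangle ν × Fin 3 → ZMod 2) → (J × Fin 3 → ZMod 2) → Prop := fun a a' =>
    ∃ c U ε, IsOpen U ∧ C ⊆ U ∧ IsLocalCocycle c U ∧ 0 < ε ∧ ε ≤ 1 / 2 ∧ T.cuspSet ν ε ⊆ U ∧
      L.HasTransitions (Set.Ioo 0 ε) ψ c a ∧ P.HasTransitions {1} π c a'
  have hRadd : ∀ a b a' b', R a a' → R b b' → R (a + b) (a' + b') := by
    rintro a b a' b' ⟨c, U, ε, h1, h2, h3, h4, h5, h6, h7, h8⟩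
      ⟨c', U', ε', h1', h2', h3', h4', h5', h6', h7', h8'⟩
    refine ⟨_, U ∩ U', min ε ε', h1.inter h1', Set.subset_inter h2 h2',
      (h3.mono Set.inter_subset_left).add (h3'.mono Set.inter_subset_right), lt_min h4 h4',
      (min_le_left _ _).trans h5, Set.subset_inter ?_ ?_,
      (h7.mono (Set.Ioo_subset_Ioo_right (min_le_left _ _))).add
      (h7'.mono (Set.Ioo_subset_Ioo_right (min_le_right _ _))), h8.add h8'⟩
    · exact (cuspSet_mono (min_le_left _ _)).trans h6
    · exact (cuspSet_mono (min_le_right _ _)).trans h6'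
  have hex : ∀ a ∈ L.transitions, ∃ a' ∈ P.transitions, R a a' := by
    intro a ha
    have hmodel := isModel_cuspSet (T := T) ν le_rfl
    have himage := image_model_cuspSet (T := T) ν le_rfl
    obtain ⟨c, hc, hca⟩ := hmodel.exists_isStrictCocycle (hI0 _) ha
    rw [himage] at hc
    have hop := hopen (1 / 2) (by norm_num) le_rfl
    obtain ⟨c', hc', hcc⟩ := hM.exists_isLocalCocycle_extension hop (c := c)
      (by rw [hdiff]; exact hc.isLocalCocycle)
    rw [hdiff] at hcc
    obtain ⟨a', ha', h'⟩ := hπ.exists_hasTransitions (convex_singleton 1) h10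
      (Set.singleton_nonempty 1) (hπC.symm ▸ hc'.mono Set.subset_union_left)
    refine ⟨a', ha', c', _, 1 / 2, hop, Set.subset_union_left, hc', by norm_num, le_rfl,
      Set.subset_union_right, hca.congr ?_, h'⟩
    rw [himage]
    exact fun x hx y hy => (hcc x hx y hy).symm
  have hex' : ∀ a' ∈ P.transitions, ∃ a ∈ L.transitions, R a a' := by
    intro a' ha'
    obtain ⟨c, hc, hca⟩ := hπ.exists_isStrictCocycle h10 ha'
    rw [hπC] at hc
    obtain ⟨U, c', hUo, hCU, hc', hcc⟩ := hc.exists_extension hC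
    obtain ⟨ε, h0, hε, hsub⟩ := hU U hUo hCU
    obtain ⟨a, ha, h⟩ := (isModel_cuspSet (T := T) ν hε).exists_hasTransitions (convex_Ioo 0 ε)
      (hI0 ε) (hIn ε h0) ((image_model_cuspSet (T := T) ν hε).symm ▸ hc'.mono hsub)
    refine ⟨a, ha, c', U, ε, hUo, hCU, hc', h0, hε, hsub, h, hca.congr ?_⟩
    rw [hπC]
    exact fun x hx y hy => (hcc x hx y hy).symm
  have hmem : ∀ a a', R a a' → a' ∈ P.trivialTransitions → a ∈ L.trivialTransitions := by
    rintro a a' ⟨c, U, ε, h1, h2, h3, h4, h5, h6, h7, h8⟩ ha'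
    obtain ⟨f, hf⟩ := hπ.exists_isPrimitive ha' h8
    rw [hπC] at hf
    obtain ⟨U', f', hU', hCU', -, hf'⟩ := hf.exists_extension hC h1 h2 h3
    obtain ⟨ε', h0, hε', hsub⟩ := hU U' hU' hCU'
    have hle := (min_le_left ε ε').trans h5
    refine (isModel_cuspSet (T := T) ν hle).mem_trivialTransitions (convex_Ioo _ _) (hI0 _)
      (hIn _ (lt_min h4 h0)) (hf'.mono ?_) (h7.mono (Set.Ioo_subset_Ioo_right (min_le_left _ _)))
    rw [image_model_cuspSet (T := T) ν hle]
    exact (cuspSet_mono (min_le_right _ _)).trans hsub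
  have hmem' : ∀ a' a, R a a' → a ∈ L.trivialTransitions → a' ∈ P.trivialTransitions := by
    rintro a' a ⟨c, U, ε, h1, h2, h3, h4, h5, h6, h7, h8⟩ ha
    obtain ⟨f, hf⟩ := (isModel_cuspSet (T := T) ν h5).exists_isPrimitive ha h7
    rw [image_model_cuspSet (T := T) ν h5, ← hdiff] at hf
    obtain ⟨f', hf'⟩ := hM.exists_isPrimitive_extension (hopen ε h4 h5)
      (h3.mono (Set.union_subset h2 h6)) hf
    exact hπ.mem_trivialTransitions (convex_singleton 1) h10 (Set.singleton_nonempty 1)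
      (hπC.symm ▸ hf'.mono Set.subset_union_left) h8
  exact le_antisymm
    (finrank_add_finrank_le_of_relation L.trivialTransitions_le P.trivialTransitions_le R hRadd hex
      hmem)
    (finrank_add_finrank_le_of_relation P.trivialTransitions_le L.trivialTransitions_le
      (fun a' a => R a a') (fun a' b' a b => hRadd a b a' b') hex' hmem')

/-- The Euler characteristic of the link of an ideal vertex at a component of genus `γ` of the
boundary is `2 - 2 γ`. -/
theorem two_mul_card_vertex_linkGluing (hM : IsThreeManifoldWithBoundary M B) {ν : T.IdealVertex}
    {C : Set M} (hCB : C ⊆ B)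
    (hU : ∀ U, IsOpen U → C ⊆ U → ∃ ε > 0, ε ≤ 1 / 2 ∧ T.cuspSet ν ε ⊆ U)
    (hopen : ∀ ε > 0, ε ≤ 1 / 2 → IsOpen (C ∪ T.cuspSet ν ε)) {γ : ℕ} {σ : ClosedSurface γ → M}
    (hσ : Continuous σ) (hinj : Function.Injective σ) (hσC : Set.range σ = C) :
    2 * Nat.card (T.linkGluing ν).Vertex + 4 * γ = Nat.card (T.LinkTriangle ν) + 4 := by
  let _ := Fintype.ofFinite (T.LinkTriangle ν)
  have hπ := (oppositeSidesPairing γ).isModel hσ hinj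
  have hπC := ((oppositeSidesPairing γ).image_model σ).trans hσC
  have h1 := finrank_transitions_linkGluing hM (hσC ▸ isCompact_range hσ) hCB hU hopen hπ hπC
  have h2 := finrank_transitions_oppositeSidesPairing γ
  have h3 := (T.linkGluing ν).finrank_transitions (T.isConnected_linkGluing ν)
  rw [Nat.card_eq_fintype_card (α := T.LinkTriangle ν)]
  omega

end IdealTriangulation

/-! ### No edge is glued to itself with reversed orientation -/

namespace FacePairing

variable {n : ℕ} (P : FacePairing 3 n)

/-- The oriented edges of the tetrahedra before gluing: a tetrahedron and an ordered pair of its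
vertices. -/
abbrev OrderedEdge (n : ℕ) : Type := {q : Fin n × Fin 4 × Fin 4 // q.2.1 ≠ q.2.2}

/-- The reversed edge. -/
def OrderedEdge.swap (q : OrderedEdge n) : OrderedEdge n := ⟨(q.1.1, q.1.2.2, q.1.2.1), q.2.symm⟩

/-- The edge to which `q` is glued by the pairing of the face `f`, if this contains `q`. -/
def glueEdge (f : Fin 4) (q : OrderedEdge n) : OrderedEdge n :=
  ⟨(P.target q.1.1 f, P.perm q.1.1 f q.1.2.1, P.perm q.1.1 f q.1.2.2),
    fun h => q.2 ((P.perm q.1.1 f).injective h)⟩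

/-- Oriented edges identified by the pairing of a face that contains them. -/
def OrderedEdgeRel (q r : OrderedEdge n) : Prop :=
  ∃ f, f ≠ q.1.2.1 ∧ f ≠ q.1.2.2 ∧ r = P.glueEdge f q

/-- An oriented edge with a face, opposite to the vertex `d`, seen from the tetrahedron on the other
side of this face. -/
def flipFlag (q : Fin n × Fin 4 × Fin 4 × Fin 4) : Fin n × Fin 4 × Fin 4 × Fin 4 :=
  (P.target q.1 q.2.2.2, P.perm q.1 q.2.2.2 q.2.1, P.perm q.1 q.2.2.2 q.2.2.1,
    P.perm q.1 q.2.2.2 q.2.2.2)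

/-- An oriented edge with a face, with reversed orientation. -/
def swapFlag (q : Fin n × Fin 4 × Fin 4 × Fin 4) : Fin n × Fin 4 × Fin 4 × Fin 4 :=
  (q.1, q.2.2.1, q.2.1, q.2.2.2)

theorem flipFlag_flipFlag (q : Fin n × Fin 4 × Fin 4 × Fin 4) :
    P.flipFlag (P.flipFlag q) = q := by
  simp [flipFlag, P.target_target, P.perm_perm]

/-- A vector that does not depend on the side from which a face is seen, and that changes its sign
with the orientation of the edge. -/
def flagVector (q : Fin n × Fin 4 × Fin 4 × Fin 4) : Fin n × Fin 4 × Fin 4 × Fin 4 → ℝ :=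
  Pi.single q 1 + Pi.single (P.flipFlag q) 1 - Pi.single (swapFlag q) 1 -
    Pi.single (swapFlag (P.flipFlag q)) 1

theorem flagVector_flipFlag (q : Fin n × Fin 4 × Fin 4 × Fin 4) :
    P.flagVector (P.flipFlag q) = P.flagVector q := by
  simp only [flagVector, flipFlag_flipFlag]
  abel

theorem flagVector_swapFlag (q : Fin n × Fin 4 × Fin 4 × Fin 4) :
    P.flagVector (swapFlag q) = -P.flagVector q := by
  have h1 : P.flipFlag (swapFlag q) = swapFlag (P.flipFlag q) := rfl
  have h2 : ∀ q : Fin n × Fin 4 × Fin 4 × Fin 4, swapFlag (swapFlag q) = q := fun _ => rfl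
  simp only [flagVector, h1, h2]
  abel

theorem flagVector_ne_zero {q : Fin n × Fin 4 × Fin 4 × Fin 4} (hq : q.2.1 ≠ q.2.2.1) :
    P.flagVector q ≠ 0 := by
  intro h
  have h0 := congrFun h q
  have h1 : swapFlag q ≠ q := fun h => hq (congrArg (fun r => r.2.1) h).symm
  have h2 : swapFlag (P.flipFlag q) ≠ q := fun h => P.no_fixed_face q.1 q.2.2.2
    (Prod.ext (congrArg (fun r => r.1) h) (congrArg (fun r => r.2.2.2) h))
  simp only [flagVector, Pi.add_apply, Pi.sub_apply, Pi.single_eq_same, Pi.zero_apply,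
    Pi.single_eq_of_ne h1.symm, Pi.single_eq_of_ne h2.symm] at h0
  have h3 : (0 : ℝ) ≤ (Pi.single (P.flipFlag q) 1 : _ → ℝ) q := by
    rw [Pi.single_apply]
    split_ifs <;> norm_num
  linarith

/-- A vector-valued function near an edge that is compatible with the gluing, changes its sign with
the orientation of the edge, and vanishes only at the midpoint of the edge. -/
noncomputable def edgeSection (q : OrderedEdge n) (x : Fin 4 → ℝ) :
    Unit ⊕ (Fin n × Fin 4 × Fin 4 × Fin 4) ⊕ OrderedEdge n → ℝ :=
  Sum.elim (fun _ => x q.1.2.1 - x q.1.2.2) (Sum.elim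
    (∑ d, (if d = q.1.2.1 ∨ d = q.1.2.2 then 0 else 1 - x q.1.2.1 - x q.1.2.2 - x d) •
      P.flagVector (q.1.1, q.1.2.1, q.1.2.2, d))
    ((∏ d, if d = q.1.2.1 ∨ d = q.1.2.2 then 1 else x d) •
      (Pi.single q 1 - Pi.single q.swap 1)))

theorem continuous_edgeSection (q : OrderedEdge n) : Continuous (P.edgeSection q) := by
  refine continuous_pi fun i => ?_
  rcases i with _ | i | i
  · simp only [edgeSection, Sum.elim_inl]
    fun_prop
  · simp only [edgeSection, Sum.elim_inl, Sum.elim_inr, Finset.sum_apply, Pi.smul_apply,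
      smul_eq_mul]
    refine continuous_finsetSum _ fun d _ => Continuous.mul ?_ continuous_const
    split_ifs <;> fun_prop
  · simp only [edgeSection, Sum.elim_inr, Pi.smul_apply, smul_eq_mul]
    refine Continuous.mul (continuous_finsetProd _ fun d _ => ?_) continuous_const
    split_ifs <;> fun_prop

theorem edgeSection_swap (q : OrderedEdge n) (x : Fin 4 → ℝ) :
    P.edgeSection q.swap x = -P.edgeSection q x := by
  ext i
  rcases i with _ | i | i
  · simp [edgeSection, OrderedEdge.swap]
  · simp only [edgeSection, Sum.elim_inl, Sum.elim_inr, Pi.neg_apply, ← Finset.sum_neg_distrib,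
      Finset.sum_apply]
    refine Finset.sum_congr rfl fun d _ => ?_
    have h : P.flagVector (q.1.1, q.1.2.2, q.1.2.1, d) =
        -P.flagVector (q.1.1, q.1.2.1, q.1.2.2, d) :=
      P.flagVector_swapFlag (q.1.1, q.1.2.1, q.1.2.2, d)
    simp only [OrderedEdge.swap, h, or_comm (a := d = q.1.2.2), Pi.smul_apply, Pi.neg_apply,
      smul_neg, sub_right_comm _ (x q.1.2.2)]
  · have h : q.swap.swap = q := rfl
    simp only [edgeSection, Sum.elim_inr, Pi.neg_apply, Pi.smul_apply, Pi.sub_apply, h]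
    simp only [OrderedEdge.swap, or_comm (a := _ = q.1.2.2), smul_eq_mul]
    ring

theorem sum_eq_of_ne {a b c d : Fin 4} (hab : a ≠ b) (hac : a ≠ c) (had : a ≠ d) (hbc : b ≠ c)
    (hbd : b ≠ d) (hcd : c ≠ d) (x : Fin 4 → ℝ) : ∑ v, x v = x a + x b + x c + x d := by
  have h : ({a, b, c, d} : Finset (Fin 4)) = Finset.univ := by
    apply Finset.eq_univ_of_card
    rw [Finset.card_insert_of_notMem (by simp [*]), Finset.card_insert_of_notMem (by simp [*]),
      Finset.card_pair hcd, Fintype.card_fin]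
  rw [← h, Finset.sum_insert (by simp [*]), Finset.sum_insert (by simp [*]),
    Finset.sum_pair hcd]
  ring

theorem edgeSection_glueEdge {q : OrderedEdge n} {x : Fin 4 → ℝ} (hx : ∑ v, x v = 1) {f : Fin 4}
    (ha : f ≠ q.1.2.1) (hb : f ≠ q.1.2.2) (hf : x f = 0) :
    P.edgeSection (P.glueEdge f q) (fun v => x ((P.perm q.1.1 f).symm v)) = P.edgeSection q x := by
  set σ := P.perm q.1.1 f with hσ
  have hga : (P.glueEdge f q).1.2.1 = σ q.1.2.1 := rfl
  have hgb : (P.glueEdge f q).1.2.2 = σ q.1.2.2 := rfl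
  ext i
  rcases i with _ | i | i
  · simp [edgeSection, hga, hgb]
  · simp only [edgeSection, Sum.elim_inl, Sum.elim_inr, hga, hgb, Equiv.symm_apply_apply]
    refine congrFun ?_ i
    rw [← Equiv.sum_comp σ]
    refine Finset.sum_congr rfl fun d _ => ?_
    simp only [EmbeddingLike.apply_eq_iff_eq, Equiv.symm_apply_apply]
    by_cases hd : d = f
    · subst hd
      congr 1
      exact P.flagVector_flipFlag (q.1.1, q.1.2.1, q.1.2.2, d)
    · -- the other face at the edge contributes nothing on the face `f`
      split_ifs with h
      · simp
      · rw [not_or] at h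
        have h1 := sum_eq_of_ne q.2 ha.symm (Ne.symm h.1) hb.symm (Ne.symm h.2) (Ne.symm hd) x
        have h2 : 1 - x q.1.2.1 - x q.1.2.2 - x d = 0 := by
          rw [hx, hf] at h1
          linarith
        rw [h2, zero_smul, zero_smul]
  · simp only [edgeSection, Sum.elim_inr, hga, hgb]
    rw [Finset.prod_eq_zero (Finset.mem_univ (σ f)), Finset.prod_eq_zero (Finset.mem_univ f)]
    · simp
    · simp [ha, hb, hf]
    · simp [ha, hb, hf]

theorem eq_half_of_edgeSection_eq_zero {q : OrderedEdge n} {x : Fin 4 → ℝ} (hx : ∑ v, x v = 1)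
    (h : P.edgeSection q x = 0) : x q.1.2.1 = 1 / 2 ∧ x q.1.2.2 = 1 / 2 := by
  have h1 : x q.1.2.1 - x q.1.2.2 = 0 := congrFun h (.inl ())
  have h3 := congrFun h (.inr (.inr q))
  have hswap : q ≠ q.swap := fun h => q.2 (congrArg (fun q => q.1.2.1) h)
  simp only [edgeSection, Sum.elim_inr, Pi.smul_apply, Pi.sub_apply, Pi.single_eq_same,
    Pi.single_eq_of_ne hswap, sub_zero, smul_eq_mul, mul_one, Pi.zero_apply,
    Finset.prod_eq_zero_iff, Finset.mem_univ, true_and] at h3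
  obtain ⟨d, hd⟩ := h3
  split_ifs at hd with hdab
  · norm_num at hd
  rw [not_or] at hdab
  obtain ⟨c, hca, hcb, hcd⟩ : ∃ c, c ≠ q.1.2.1 ∧ c ≠ q.1.2.2 ∧ c ≠ d := by
    have : ∀ a b d : Fin 4, ∃ c, c ≠ a ∧ c ≠ b ∧ c ≠ d := by decide
    exact this _ _ _
  have hsum := sum_eq_of_ne q.2 hca.symm (Ne.symm hdab.1) hcb.symm (Ne.symm hdab.2) hcd x
  rw [hx, hd] at hsum
  have h2 : ∑ d, (if d = q.1.2.1 ∨ d = q.1.2.2 then 0 else 1 - x q.1.2.1 - x q.1.2.2 - x d) •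
      P.flagVector (q.1.1, q.1.2.1, q.1.2.2, d) = 0 :=
    funext fun i => congrFun h (.inr (.inl i))
  rw [Finset.sum_eq_single d] at h2
  · rw [if_neg (by simp [hdab]), smul_eq_zero] at h2
    have h4 := h2.resolve_right (P.flagVector_ne_zero q.2)
    constructor <;> linarith
  · intro e _ hed
    split_ifs with he
    · simp
    · rw [not_or] at he
      have hec : e = c := by
        have : ∀ a b c d e : Fin 4, a ≠ b → c ≠ a → c ≠ b → c ≠ d → d ≠ a → d ≠ b → e ≠ a →
            e ≠ b → e ≠ d → e = c := by decide
        exact this _ _ _ _ _ q.2 hca hcb hcd hdab.1 hdab.2 he.1 he.2 hed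
      have h5 : 1 - x q.1.2.1 - x q.1.2.2 - x e = 0 := by
        rw [hec]
        linarith
      rw [h5, zero_smul]
  · simp

/-- An edge to which a point is close can be followed through the gluing. -/
theorem exists_orderedEdge_of_mk_eq {p p' : Fin n × puncturedSimplex 3}
    (h : (Quot.mk _ p : P.Glued (puncturedSimplex 3)) = Quot.mk _ p') (q : OrderedEdge n)
    (hq : q.1.1 = p.1) (ha : 1 / 3 < p.2.1 q.1.2.1) (hb : 1 / 3 < p.2.1 q.1.2.2) :
    ∃ r : OrderedEdge n, r.1.1 = p'.1 ∧ p'.2.1 r.1.2.1 = p.2.1 q.1.2.1 ∧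
      p'.2.1 r.1.2.2 = p.2.1 q.1.2.2 ∧ P.edgeSection r p'.2.1 = P.edgeSection q p.2.1 := by
  have h' := reflTransGen_of_mk_eq h
  clear h
  induction h' with
  | refl => exact ⟨q, hq, rfl, rfl, rfl⟩
  | @tail p' p'' _ hrel ih =>
    obtain ⟨r, hr, h1, h2, h3⟩ := ih
    obtain ⟨f, hf, ht, hp⟩ := hrel.eq_comp
    have hfa : f ≠ r.1.2.1 := by
      rintro rfl
      linarith
    have hfb : f ≠ r.1.2.2 := by
      rintro rfl
      linarith
    rw [← hr] at ht hp
    refine ⟨P.glueEdge f r, ht.symm, ?_, ?_, ?_⟩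
    · rw [hp, ← h1]
      simp [glueEdge]
    · rw [hp, ← h2]
      simp [glueEdge]
    · rw [hp, P.edgeSection_glueEdge p'.2.2.1.2 hfa hfb hf, h3]

theorem eq_or_eq_swap {x : Fin 4 → ℝ} (hx : x ∈ puncturedSimplex 3) {q r : OrderedEdge n}
    (hqr : q.1.1 = r.1.1) (h1 : 1 / 3 < x q.1.2.1) (h2 : 1 / 3 < x q.1.2.2)
    (h3 : 1 / 3 < x r.1.2.1) (h4 : 1 / 3 < x r.1.2.2) : r = q ∨ r = q.swap := by
  have key : ∀ c, 1 / 3 < x c → c = q.1.2.1 ∨ c = q.1.2.2 := by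
    intro c hc
    by_contra h
    rw [not_or] at h
    obtain ⟨d, hda, hdb, hdc⟩ : ∃ d, d ≠ q.1.2.1 ∧ d ≠ q.1.2.2 ∧ d ≠ c := by
      have : ∀ a b d : Fin 4, ∃ c, c ≠ a ∧ c ≠ b ∧ c ≠ d := by decide
      exact this _ _ _
    have hsum := sum_eq_of_ne q.2 (Ne.symm h.1) hda.symm (Ne.symm h.2) hdb.symm hdc.symm x
    rw [hx.1.2] at hsum
    have := hx.1.1 d
    linarith
  have hne := r.2
  rcases key _ h3 with h5 | h5 <;> rcases key _ h4 with h6 | h6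
  · exact (hne (h5.trans h6.symm)).elim
  · exact .inl (Subtype.ext (Prod.ext hqr.symm (Prod.ext h5 h6)))
  · exact .inr (Subtype.ext (Prod.ext hqr.symm (Prod.ext h5 h6)))
  · exact (hne (h5.trans h6.symm)).elim

end FacePairing

namespace FacePairing

variable {n : ℕ}

/-- The point of an edge at signed distance `r` from its midpoint. -/
noncomputable def edgePoint (q : OrderedEdge n) (r : ℝ) : Fin 4 → ℝ :=
  (Pi.single q.1.2.1 (1 / 2 + r) : Fin 4 → ℝ) + (Pi.single q.1.2.2 (1 / 2 - r) : Fin 4 → ℝ)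

theorem edgePoint_swap (q : OrderedEdge n) (r : ℝ) : edgePoint q.swap (-r) = edgePoint q r := by
  simp only [edgePoint, OrderedEdge.swap]
  rw [add_comm]
  congr 2
  ring

theorem edgePoint_glueEdge (P : FacePairing 3 n) (f : Fin 4) (q : OrderedEdge n) (r : ℝ)
    (v : Fin 4) : edgePoint (P.glueEdge f q) r (P.perm q.1.1 f v) = edgePoint q r v := by
  simp [edgePoint, glueEdge, Pi.single_apply]

/-- An arc around the midpoint of an edge, in a face with third vertex `c`. -/
noncomputable def edgeArc (q : OrderedEdge n) (c : Fin 4) (s t : ℝ) : Fin 4 → ℝ :=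
  (Pi.single q.1.2.1 (1 / 2 + s / 2 * (Real.sin t - Real.cos t ^ 2)) : Fin 4 → ℝ) +
    (Pi.single q.1.2.2 (1 / 2 + s / 2 * (-Real.sin t - Real.cos t ^ 2)) : Fin 4 → ℝ) +
    (Pi.single c (s * Real.cos t ^ 2) : Fin 4 → ℝ)

theorem continuous_edgeArc (q : OrderedEdge n) (c : Fin 4) (s : ℝ) :
    Continuous (edgeArc q c s) := by
  have h := fun v => continuous_single (A := fun _ : Fin 4 => ℝ) v
  have h1 : Continuous fun t => 1 / 2 + s / 2 * (Real.sin t - Real.cos t ^ 2) := by fun_prop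
  have h2 : Continuous fun t => 1 / 2 + s / 2 * (-Real.sin t - Real.cos t ^ 2) := by fun_prop
  have h3 : Continuous fun t => s * Real.cos t ^ 2 := by fun_prop
  exact (((h q.1.2.1).comp h1).add ((h q.1.2.2).comp h2)).add ((h c).comp h3)

theorem edgeArc_pi_div_two (q : OrderedEdge n) (c : Fin 4) (s : ℝ) :
    edgeArc q c s (Real.pi / 2) = edgePoint q (s / 2) := by
  simp [edgeArc, edgePoint, sub_eq_add_neg]

theorem edgeArc_neg_pi_div_two (q : OrderedEdge n) (c : Fin 4) (s : ℝ) :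
    edgeArc q c s (-(Real.pi / 2)) = edgePoint q (-(s / 2)) := by
  simp [edgeArc, edgePoint, sub_eq_add_neg]

theorem edgePoint_left (q : OrderedEdge n) (r : ℝ) : edgePoint q r q.1.2.1 = 1 / 2 + r := by
  simp [edgePoint, q.2]

theorem edgePoint_right (q : OrderedEdge n) (r : ℝ) : edgePoint q r q.1.2.2 = 1 / 2 - r := by
  simp [edgePoint, q.2.symm]

theorem edgeArc_left (q : OrderedEdge n) {c : Fin 4} (hc : c ≠ q.1.2.1) (s t : ℝ) :
    edgeArc q c s t q.1.2.1 = 1 / 2 + s / 2 * (Real.sin t - Real.cos t ^ 2) := by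
  simp [edgeArc, q.2, hc.symm]

theorem edgeArc_right (q : OrderedEdge n) {c : Fin 4} (hc : c ≠ q.1.2.2) (s t : ℝ) :
    edgeArc q c s t q.1.2.2 = 1 / 2 + s / 2 * (-Real.sin t - Real.cos t ^ 2) := by
  simp [edgeArc, q.2.symm, hc.symm]

theorem mem_puncturedSimplex_of_pos {x : Fin 4 → ℝ} (hx : x ∈ stdSimplex ℝ (Fin 4)) {a b : Fin 4}
    (hab : a ≠ b) (ha : 0 < x a) (hb : 0 < x b) : x ∈ puncturedSimplex 3 := by
  refine ⟨hx, ?_⟩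
  rintro ⟨v, rfl⟩
  simp only [Pi.single_apply] at ha hb
  split_ifs at ha hb with h1 h2
  · exact hab (h1.trans h2.symm)
  · exact hb.false
  · exact ha.false
  · exact ha.false

theorem third_lt_edgeArc {s : ℝ} (h0 : 0 ≤ s) (h1 : s ≤ 1 / 6) (t : ℝ) :
    1 / 3 < 1 / 2 + s / 2 * (Real.sin t - Real.cos t ^ 2) ∧
    1 / 3 < 1 / 2 + s / 2 * (-Real.sin t - Real.cos t ^ 2) := by
  have h := Real.sin_sq_add_cos_sq t
  have h2 : -(5 / 4) ≤ Real.sin t - Real.cos t ^ 2 := by nlinarith [sq_nonneg (Real.sin t + 1 / 2)]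
  have h3 : -(5 / 4) ≤ -Real.sin t - Real.cos t ^ 2 := by nlinarith [sq_nonneg (Real.sin t - 1 / 2)]
  constructor <;> nlinarith

theorem edgeArc_mem (q : OrderedEdge n) {c : Fin 4} (ha : c ≠ q.1.2.1) (hb : c ≠ q.1.2.2) {s : ℝ}
    (h0 : 0 ≤ s) (h1 : s ≤ 1 / 6) (t : ℝ) : edgeArc q c s t ∈ puncturedSimplex 3 := by
  obtain ⟨h2, h3⟩ := third_lt_edgeArc h0 h1 t
  refine mem_puncturedSimplex_of_pos ⟨fun v => ?_, ?_⟩ q.2 ?_ ?_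
  · simp only [edgeArc, Pi.add_apply, Pi.single_apply]
    have h4 : 0 ≤ s * Real.cos t ^ 2 := by positivity
    split_ifs <;> linarith
  · simp only [edgeArc, Pi.add_apply, Finset.sum_add_distrib, Finset.sum_pi_single',
      Finset.mem_univ,
      if_true]
    ring
  · rw [edgeArc_left q ha]
    linarith
  · rw [edgeArc_right q hb]
    linarith

theorem edgePoint_mem (q : OrderedEdge n) {r : ℝ} (hr : |r| < 1 / 2) :
    edgePoint q r ∈ puncturedSimplex 3 := by
  rw [abs_lt] at hr
  refine mem_puncturedSimplex_of_pos ⟨fun v => ?_, ?_⟩ q.2 ?_ ?_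
  · simp only [edgePoint, Pi.add_apply, Pi.single_apply]
    split_ifs <;> linarith
  · simp only [edgePoint, Pi.add_apply, Finset.sum_add_distrib, Finset.sum_pi_single',
      Finset.mem_univ, if_true]
    ring
  · rw [edgePoint_left]
    linarith
  · rw [edgePoint_right]
    linarith

theorem eq_edgePoint_zero {x : Fin 4 → ℝ} (hx : x ∈ puncturedSimplex 3) {q : OrderedEdge n}
    (ha : x q.1.2.1 = 1 / 2) (hb : x q.1.2.2 = 1 / 2) : x = edgePoint q 0 := by
  ext c
  by_cases hca : c = q.1.2.1
  · rw [hca, edgePoint_left, ha, add_zero]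
  by_cases hcb : c = q.1.2.2
  · rw [hcb, edgePoint_right, hb, sub_zero]
  obtain ⟨d, hda, hdb, hdc⟩ : ∃ d, d ≠ q.1.2.1 ∧ d ≠ q.1.2.2 ∧ d ≠ c := by
    have : ∀ a b d : Fin 4, ∃ c, c ≠ a ∧ c ≠ b ∧ c ≠ d := by decide
    exact this _ _ _
  have hsum := sum_eq_of_ne q.2 (Ne.symm hca) hda.symm (Ne.symm hcb) hdb.symm hdc.symm x
  rw [hx.1.2] at hsum
  have h1 := hx.1.1 c
  have h2 := hx.1.1 d
  simp only [edgePoint, Pi.add_apply, Pi.single_apply, hca, hcb, if_false]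
  linarith

end FacePairing

namespace IdealTriangulation

open FacePairing

variable {n : ℕ} {M : Type*} [TopologicalSpace M] {B : Set M} (T : IdealTriangulation n M B)

theorem isOpenEmbedding_realize (hM : IsThreeManifoldWithBoundary M B) :
    Topology.IsOpenEmbedding T.realize :=
  ⟨T.isEmbedding_realize, by rw [range_realize]; exact hM.isClosed_boundary.isOpen_compl⟩

/-- If an edge were glued to itself with reversed orientation, then its midpoint would have the cone
over a projective plane as a neighbourhood. The double cover of this projective plane is encoded by
the cocycle of the twisted function `edgeSection`, which would have a primitive in a punctured ball
of the manifold. -/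
theorem not_eqvGen_swap (hM : IsThreeManifoldWithBoundary M B) (q₀ : OrderedEdge n) :
    ¬ Relation.EqvGen T.OrderedEdgeRel q₀ q₀.swap := by
  intro hrev
  let π : OrderedEdge n × puncturedSimplex 3 → M := fun y => T.realize (Quot.mk _ (y.1.1.1, y.2))
  let F : OrderedEdge n × puncturedSimplex 3 → EuclideanSpace ℝ
      (Unit ⊕ (Fin n × Fin 4 × Fin 4 × Fin 4) ⊕ OrderedEdge n) :=
    fun y => WithLp.toLp 2 (T.edgeSection y.1 y.2.1)
  let V : Set (OrderedEdge n × puncturedSimplex 3) :=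
    {y | 1 / 3 < y.2.1 y.1.1.2.1 ∧ 1 / 3 < y.2.1 y.1.1.2.2 ∧ F y ≠ 0}
  have hF0 : ∀ y, F y = 0 ↔ T.edgeSection y.1 y.2.1 = 0 := fun y => WithLp.toLp_eq_zero 2
  have hπc : Continuous π := by
    rw [continuous_prod_of_discrete_left]
    exact fun q => T.isEmbedding_realize.continuous.comp
      (continuous_quot_mk.comp (Continuous.prodMk_right q.1.1))
  have hFc : Continuous F := by
    rw [continuous_prod_of_discrete_left]
    exact fun q => (PiLp.continuous_toLp 2 _).comp
      ((T.continuous_edgeSection q).comp continuous_subtype_val)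
  have hVo : IsOpen V := by
    have h : ∀ v : OrderedEdge n → Fin 4, IsOpen {y : OrderedEdge n × puncturedSimplex 3 |
        1 / 3 < y.2.1 (v y.1)} := by
      intro v
      refine isOpen_lt continuous_const ?_
      rw [continuous_prod_of_discrete_left]
      exact fun q => (continuous_apply (v q)).comp continuous_subtype_val
    exact (h fun q => q.1.2.1).inter ((h fun q => q.1.2.2).inter
      (isOpen_ne_fun hFc continuous_const))
  -- following an edge through the gluing
  have hfollow : ∀ y : OrderedEdge n × puncturedSimplex 3, 1 / 3 < y.2.1 y.1.1.2.1 →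
      1 / 3 < y.2.1 y.1.1.2.2 → ∀ p' : Fin n × puncturedSimplex 3,
      T.realize (Quot.mk _ p') = π y → ∃ r : OrderedEdge n, r.1.1 = p'.1 ∧
      p'.2.1 r.1.2.1 = y.2.1 y.1.1.2.1 ∧ p'.2.1 r.1.2.2 = y.2.1 y.1.1.2.2 ∧
      F (r, p'.2) = F y := by
    intro y h1 h2 p' hp'
    obtain ⟨r, hr1, hr2, hr3, hr4⟩ := T.exists_orderedEdge_of_mk_eq
      (p := (y.1.1.1, y.2)) (p' := p') (T.isEmbedding_realize.injective hp').symm y.1 rfl h1 h2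
    exact ⟨r, hr1, hr2, hr3, congrArg (WithLp.toLp 2) hr4⟩
  have hFswap : ∀ q x, F (OrderedEdge.swap q, x) = -F (q, x) := fun q x =>
    congrArg (WithLp.toLp 2) (T.edgeSection_swap q x.1)
  have hpm : ∀ y ∈ V, ∀ y' ∈ V, π y = π y' → ∃ e, F y' = zmodSign e • F y := by
    rintro y ⟨h1, h2, -⟩ y' ⟨h1', h2', -⟩ h
    obtain ⟨r, hr1, hr2, hr3, hr4⟩ := hfollow y h1 h2 (y'.1.1.1, y'.2) h.symm
    rcases eq_or_eq_swap y'.2.2 hr1.symm h1' h2' (hr2 ▸ h1) (hr3 ▸ h2) with rfl | rfl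
    · exact ⟨0, by rw [← hr4]; simp [zmodSign]⟩
    · refine ⟨1, ?_⟩
      rw [← hr4, hFswap]
      simp [zmodSign]
  have hnhds' : ∀ z s, (∀ p : Fin n × puncturedSimplex 3, (Quot.mk _ p : T.Glued _) = z →
      ∀ᶠ x in 𝓝 p.2, T.realize (Quot.mk _ (p.1, x)) ∈ s) → s ∈ 𝓝 (T.realize z) := by
    intro z s hs
    rw [← (T.isOpenEmbedding_realize hM).map_nhds_eq, Filter.mem_map]
    exact T.mem_nhds_glued (fun y hy σ => comp_perm_mem_puncturedSimplex hy σ) z _ hs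
  have hnhds : ∀ x ∈ π '' V, ∀ s : Set M, (∀ y ∈ V, π y = x → ∀ᶠ y' in 𝓝[V] y, π y' ∈ s) →
      s ∈ 𝓝[π '' V] x := by
    rintro _ ⟨y, ⟨h1, h2, h3⟩, rfl⟩ s hs
    refine mem_nhdsWithin_of_mem_nhds (hnhds' _ s fun p hp => ?_)
    obtain ⟨r, hr1, hr2, hr3, hr4⟩ := hfollow y h1 h2 p (congrArg T.realize hp)
    have hV : (r, p.2) ∈ V := ⟨hr2 ▸ h1, hr3 ▸ h2, hr4 ▸ h3⟩
    have hπ : π (r, p.2) = π y := by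
      simp only [π, hr1]
      exact congrArg T.realize hp
    have h := hs _ hV hπ
    rw [hVo.nhdsWithin_eq hV] at h
    have h' := ((Continuous.prodMk_right r).tendsto p.2).eventually h
    simpa only [π, hr1] using h'
  obtain ⟨c, ε, hc, hε, hsign⟩ :=
    exists_isStrictCocycle_of_section hFc.continuousOn (fun y hy => hy.2.2) hpm hnhds
  have hεeq : ∀ y ∈ V, ∀ y' ∈ V, π y = π y' → F y' = F y → ε y = ε y' := by
    intro y hy y' hy' h h'
    have h1 := hsign y hy y' hy' h
    rw [h', eq_comm, ← sub_eq_zero] at h1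
    have h2 : (zmodSign (ε y + ε y') - 1) • F y = 0 := by rw [sub_smul, one_smul, h1]
    have h3 := (smul_eq_zero.1 h2).resolve_right hy.2.2
    have h4 : ε y + ε y' = 0 := by
      apply zmodSign_injective
      simp only [zmodSign, if_true] at h3 ⊢
      linarith
    grind
  have hεne : ∀ y ∈ V, ∀ y' ∈ V, π y = π y' → F y' = -F y → ε y + ε y' = 1 := by
    intro y hy y' hy' h h'
    have h1 := hsign y hy y' hy' h
    rw [h', eq_comm, ← sub_eq_zero] at h1
    have h2 : (zmodSign (ε y + ε y') + 1) • F y = 0 := by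
      rw [add_smul, one_smul, ← h1, sub_neg_eq_add]
    have h3 := (smul_eq_zero.1 h2).resolve_right hy.2.2
    apply zmodSign_injective
    simp only [zmodSign, one_ne_zero, if_false] at h3 ⊢
    linarith
  -- the midpoint has a neighbourhood on which the cocycle is trivial
  have h0 : |(0 : ℝ)| < 1 / 2 := by norm_num
  let mid : OrderedEdge n → M := fun q => π (q, ⟨edgePoint q 0, edgePoint_mem q h0⟩)
  have hmid13 : ∀ q : OrderedEdge n, 1 / 3 < edgePoint q 0 q.1.2.1 ∧
      1 / 3 < edgePoint q 0 q.1.2.2 := by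
    intro q
    rw [edgePoint_left, edgePoint_right]
    norm_num
  have hO : π '' V ∪ {mid q₀} ∈ 𝓝 (mid q₀) := by
    refine hnhds' _ _ fun p hp => ?_
    obtain ⟨r, hr1, hr2, hr3, -⟩ := hfollow (q₀, ⟨edgePoint q₀ 0, edgePoint_mem q₀ h0⟩)
      (hmid13 q₀).1 (hmid13 q₀).2 p (congrArg T.realize hp)
    have hra : p.2.1 r.1.2.1 = 1 / 2 := hr2.trans ((edgePoint_left q₀ 0).trans (add_zero _))
    have hrb : p.2.1 r.1.2.2 = 1 / 2 := hr3.trans ((edgePoint_right q₀ 0).trans (sub_zero _))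
    have hlt : ∀ v, p.2.1 v = 1 / 2 → ∀ᶠ x : puncturedSimplex 3 in 𝓝 p.2, 1 / 3 < x.1 v := by
      intro v hv
      refine (isOpen_lt continuous_const
        ((continuous_apply v).comp continuous_subtype_val)).mem_nhds ?_
      change 1 / 3 < p.2.1 v
      rw [hv]
      norm_num
    filter_upwards [hlt _ hra, hlt _ hrb] with x hxa hxb
    by_cases hx : F (r, x) = 0
    · right
      have h := T.eq_half_of_edgeSection_eq_zero x.2.1.2 ((hF0 (r, x)).1 hx)
      have hxp : x = p.2 := Subtype.ext ((eq_edgePoint_zero x.2 h.1 h.2).trans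
        (eq_edgePoint_zero p.2.2 hra hrb).symm)
      rw [hxp]
      exact congrArg T.realize hp
    · refine .inl ⟨(r, x), ⟨hxa, hxb, hx⟩, ?_⟩
      simp only [π, hr1]
  obtain ⟨W, hW, hpW, hWO, hWc⟩ := hM.exists_nhds_interior (T.realize_notMem _) hO
  obtain ⟨f, hf⟩ := hWc c (hc.isLocalCocycle.mono fun x hx => (hWO hx.1).resolve_right hx.2)
  -- arcs around the midpoints in this neighbourhood
  obtain ⟨s, hs0, hs6, hsW⟩ : ∃ s : ℝ, 0 < s ∧ s ≤ 1 / 6 ∧ ∀ q, mid q = mid q₀ →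
      ∀ x : puncturedSimplex 3, (∀ v, |x.1 v - edgePoint q 0 v| ≤ s) → π (q, x) ∈ W := by
    have h : ∀ᶠ s in 𝓝[>] (0 : ℝ), ∀ q, mid q = mid q₀ →
        ∀ x : puncturedSimplex 3, (∀ v, |x.1 v - edgePoint q 0 v| ≤ s) → π (q, x) ∈ W := by
      rw [Filter.eventually_all]
      intro q
      by_cases hq : mid q = mid q₀
      · have hcont : Continuous fun x => π (q, x) := hπc.comp (Continuous.prodMk_right q)
        have hqW : mid q ∈ W := hq ▸ hpW
        have hmem := hcont.continuousAt.eventually (hW.mem_nhds hqW)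
        obtain ⟨δ, hδ, hball⟩ := Metric.eventually_nhds_iff.1 hmem
        filter_upwards [Ioo_mem_nhdsGT hδ] with s hs _ x hx
        refine hball (lt_of_le_of_lt ?_ hs.2)
        exact (dist_pi_le_iff hs.1.le).2 hx
      · exact Filter.Eventually.of_forall fun s h => (hq h).elim
    obtain ⟨s, h, hs⟩ := (h.and (Ioo_mem_nhdsGT (by norm_num : (0 : ℝ) < 1 / 6))).exists
    exact ⟨s, hs.1, hs.2.le, h⟩
  have hs2 : |s / 2| < 1 / 2 := by
    rw [abs_of_pos (by linarith)]
    linarith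
  have hs2' : |-(s / 2)| < 1 / 2 := by rwa [abs_neg]
  have hV : ∀ (q : OrderedEdge n) (r : ℝ) (hr : |r| < 1 / 2), r ≠ 0 → |r| < 1 / 6 →
      ((q, ⟨edgePoint q r, edgePoint_mem q hr⟩) : OrderedEdge n × puncturedSimplex 3) ∈ V := by
    intro q r hr hr0 hr6
    rw [abs_lt] at hr6
    refine ⟨?_, ?_, fun h => ?_⟩
    · change 1 / 3 < edgePoint q r q.1.2.1
      rw [edgePoint_left]
      linarith
    · change 1 / 3 < edgePoint q r q.1.2.2
      rw [edgePoint_right]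
      linarith
    · have h1 := (T.eq_half_of_edgeSection_eq_zero (edgePoint_mem q hr).1.2 ((hF0 _).1 h)).1
      rw [edgePoint_left] at h1
      exact hr0 (by linarith)
  have hs12 : |s / 2| < 1 / 6 := by
    rw [abs_of_pos (by linarith)]
    linarith
  have hs12' : |-(s / 2)| < 1 / 6 := by rwa [abs_neg]
  let y₁ : OrderedEdge n → OrderedEdge n × puncturedSimplex 3 :=
    fun q => (q, ⟨edgePoint q (s / 2), edgePoint_mem q hs2⟩)
  let y₂ : OrderedEdge n → OrderedEdge n × puncturedSimplex 3 :=
    fun q => (q, ⟨edgePoint q (-(s / 2)), edgePoint_mem q hs2'⟩)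
  have hy₁ : ∀ q, y₁ q ∈ V := fun q => hV q _ hs2 (by linarith) hs12
  have hy₂ : ∀ q, y₂ q ∈ V := fun q => hV q _ hs2' (by linarith) hs12'
  let h : OrderedEdge n × puncturedSimplex 3 → ZMod 2 := fun y => f (π y) + ε y
  -- the primitives `f ∘ π` and `ε` of the same cocycle differ by a constant along an arc between
  -- the points `y₁ q` and `y₂ q` on the two sides of the midpoint of an edge
  have harc : ∀ q, mid q = mid q₀ → h (y₁ q) = h (y₂ q) := by
    intro q hq
    obtain ⟨d, hda, hdb⟩ : ∃ d, d ≠ q.1.2.1 ∧ d ≠ q.1.2.2 := by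
      have : ∀ a b : Fin 4, ∃ c, c ≠ a ∧ c ≠ b := by decide
      exact this _ _
    let φ : ℝ → OrderedEdge n × puncturedSimplex 3 :=
      fun t => (q, ⟨edgeArc q d s t, edgeArc_mem q hda hdb hs0.le hs6 t⟩)
    have hφc : Continuous φ := continuous_const.prodMk
      (Continuous.subtype_mk (continuous_edgeArc q d s) _)
    have h13 : ∀ t, 1 / 3 < edgeArc q d s t q.1.2.1 ∧ 1 / 3 < edgeArc q d s t q.1.2.2 := by
      intro t
      rw [edgeArc_left q hda, edgeArc_right q hdb]
      exact third_lt_edgeArc hs0.le hs6 t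
    have hhalf : ∀ t, ¬ (edgeArc q d s t q.1.2.1 = 1 / 2 ∧ edgeArc q d s t q.1.2.2 = 1 / 2) := by
      rintro t ⟨h1, h2⟩
      rw [edgeArc_left q hda] at h1
      rw [edgeArc_right q hdb] at h2
      have h3 : Real.sin t - Real.cos t ^ 2 = 0 := by
        have : s / 2 * (Real.sin t - Real.cos t ^ 2) = 0 := by linarith
        exact (mul_eq_zero.1 this).resolve_left (by linarith)
      have h4 : -Real.sin t - Real.cos t ^ 2 = 0 := by
        have : s / 2 * (-Real.sin t - Real.cos t ^ 2) = 0 := by linarith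
        exact (mul_eq_zero.1 this).resolve_left (by linarith)
      have h5 : Real.sin t = 0 := by linarith
      have := Real.sin_sq_add_cos_sq t
      rw [h5] at this h3
      linarith
    have hφV : ∀ t, φ t ∈ V := fun t => ⟨(h13 t).1, (h13 t).2, fun h => hhalf t
      (T.eq_half_of_edgeSection_eq_zero (edgeArc_mem q hda hdb hs0.le hs6 t).1.2 ((hF0 _).1 h))⟩
    have hφW : ∀ t, π (φ t) ∈ W \ {mid q₀} := by
      intro t
      refine ⟨hsW q hq _ fun v => ?_, fun hmid => ?_⟩
      · have h1 := Real.sin_sq_add_cos_sq t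
        have h2 : edgeArc q d s t v - edgePoint q 0 v =
            (Pi.single q.1.2.1 (s / 2 * (Real.sin t - Real.cos t ^ 2)) : Fin 4 → ℝ) v +
            (Pi.single q.1.2.2 (s / 2 * (-Real.sin t - Real.cos t ^ 2)) : Fin 4 → ℝ) v +
            (Pi.single d (s * Real.cos t ^ 2) : Fin 4 → ℝ) v := by
          simp only [edgeArc, edgePoint, Pi.add_apply, Pi.single_apply]
          split_ifs <;> ring
        change |edgeArc q d s t v - edgePoint q 0 v| ≤ s
        rw [h2, abs_le]
        have h3 := Real.sin_le_one t
        have h4 := Real.neg_one_le_sin t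
        have h5 := sq_nonneg (Real.cos t)
        have h6 := Real.cos_sq_le_one t
        simp only [Pi.single_apply]
        have hne := q.2
        by_cases hva : v = q.1.2.1
        · have hvb : v ≠ q.1.2.2 := hva ▸ hne
          have hvd : v ≠ d := hva ▸ hda.symm
          simp only [hva, hne, hda.symm, if_true, if_false]
          constructor <;> nlinarith
        · by_cases hvb : v = q.1.2.2
          · simp only [hvb, hne.symm, hdb.symm, if_true, if_false]
            constructor <;> nlinarith
          · simp only [hva, hvb, if_false]
            split_ifs <;> constructor <;> nlinarith
      · obtain ⟨r, hr1, hr2, hr3, -⟩ := hfollow (φ t) (h13 t).1 (h13 t).2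
          (q₀.1.1, ⟨edgePoint q₀ 0, edgePoint_mem q₀ h0⟩) (Set.mem_singleton_iff.1 hmid).symm
        have hr2' : edgePoint q₀ 0 r.1.2.1 = edgeArc q d s t q.1.2.1 := hr2
        have hr3' : edgePoint q₀ 0 r.1.2.2 = edgeArc q d s t q.1.2.2 := hr3
        refine hhalf t ?_
        rw [← hr2', ← hr3']
        rcases eq_or_eq_swap (edgePoint_mem q₀ h0) hr1.symm (hmid13 q₀).1 (hmid13 q₀).2
          (hr2' ▸ (h13 t).1) (hr3' ▸ (h13 t).2) with rfl | rfl
        · rw [edgePoint_left, edgePoint_right]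
          norm_num
        · simp only [OrderedEdge.swap]
          rw [edgePoint_left, edgePoint_right]
          norm_num
    have hprim1 := hf.comp (φ := fun t => π (φ t)) (V := Set.univ) (hπc.comp hφc).continuousOn
      fun t _ => hφW t
    have hprim2 := hε.comp (φ := φ) (V := Set.univ) hφc.continuousOn fun t _ => hφV t
    have hconst := hprim1.add_eq_add hprim2 isPreconnected_univ
      (Set.mem_univ (Real.pi / 2)) (Set.mem_univ (-(Real.pi / 2)))
    have e1 : φ (Real.pi / 2) = y₁ q := Prod.ext rfl (Subtype.ext (edgeArc_pi_div_two q d s))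
    have e2 : φ (-(Real.pi / 2)) = y₂ q := Prod.ext rfl (Subtype.ext (edgeArc_neg_pi_div_two q d s))
    rw [e1, e2] at hconst
    exact hconst
  -- the point `y₁ q` is `y₂ q.swap`, but the section has the opposite sign when seen from `q.swap`
  have hswap : ∀ q, h (y₁ q) + h (y₂ q.swap) = 1 := by
    intro q
    have hx : (y₂ q.swap).2 = (y₁ q).2 := Subtype.ext (edgePoint_swap q (s / 2))
    have hπ : π (y₁ q) = π (y₂ q.swap) := by
      simp only [π, hx]
      rfl
    have hF : F (y₂ q.swap) = -F (y₁ q) := by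
      refine Eq.trans ?_ (hFswap q (y₁ q).2)
      rw [← hx]
    have := hεne _ (hy₁ q) _ (hy₂ q.swap) hπ hF
    simp only [h, ← hπ]
    grind
  have hglue : ∀ q r, T.OrderedEdgeRel q r → mid q = mid r ∧ h (y₁ q) = h (y₁ r) := by
    rintro q _ ⟨k, hka, hkb, rfl⟩
    have hk : ∀ t, edgePoint q t k = 0 := fun t => by
      simp [edgePoint, hka, hkb]
    have hπ : ∀ t (ht : |t| < 1 / 2), π (q, ⟨edgePoint q t, edgePoint_mem q ht⟩) =
        π (T.glueEdge k q, ⟨edgePoint (T.glueEdge k q) t, edgePoint_mem _ ht⟩) := fun t ht =>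
      congrArg T.realize (Quot.sound ⟨k, hk t, rfl, fun v => T.edgePoint_glueEdge k q t v⟩)
    refine ⟨hπ 0 h0, ?_⟩
    have hF : F (y₁ (T.glueEdge k q)) = F (y₁ q) := by
      refine congrArg (WithLp.toLp 2) ?_
      rw [← T.edgeSection_glueEdge (edgePoint_mem q hs2).1.2 hka hkb (hk _)]
      congr 1
      ext v
      have := T.edgePoint_glueEdge k q (s / 2) ((T.perm q.1.1 k).symm v)
      rw [Equiv.apply_symm_apply] at this
      exact this
    have h1 := hεeq _ (hy₁ q) _ (hy₁ _) (hπ (s / 2) hs2) hF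
    simp only [h, h1]
    rw [show π (y₁ q) = π (y₁ (T.glueEdge k q)) from hπ (s / 2) hs2]
  have hclass : ∀ q r, Relation.EqvGen T.OrderedEdgeRel q r →
      mid q = mid r ∧ h (y₁ q) = h (y₁ r) := by
    intro q r hqr
    induction hqr with
    | rel q r hqr => exact hglue q r hqr
    | refl q => exact ⟨rfl, rfl⟩
    | symm q r _ ih => exact ⟨ih.1.symm, ih.2.symm⟩
    | trans q r r' _ _ ih ih' => exact ⟨ih.1.trans ih'.1, ih.2.trans ih'.2⟩
  -- along the identification of the edge with its reverse, `h` is both preserved and changed by one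
  obtain ⟨h1, h2⟩ := hclass _ _ hrev
  have h3 := harc q₀.swap h1.symm
  have h4 := hswap q₀
  rw [h2, h3] at h4
  have : ∀ a : ZMod 2, a + a ≠ 1 := by decide
  exact this _ h4

end IdealTriangulation

/-! ### Counting edges -/

namespace FacePairing

variable {n : ℕ} (P : FacePairing 3 n)

/-- The edge of the triangulation at the vertices `a` and `b` of tetrahedron `i`. -/
def edge (i : Fin n) {a b : Fin 4} (h : a ≠ b) : P.Edge :=
  Quot.mk _ (i, ⟨{a, b}, Finset.card_pair h⟩)

theorem edge_comm (i : Fin n) {a b : Fin 4} (h : a ≠ b) : P.edge i h = P.edge i h.symm :=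
  congrArg (fun s => Quot.mk P.EdgeRel (i, s)) (Subtype.ext (Finset.pair_comm a b))

theorem exists_edge_eq (E : P.Edge) : ∃ (i : Fin n) (a b : Fin 4) (h : a ≠ b), P.edge i h = E := by
  obtain ⟨⟨i, s, hs⟩, rfl⟩ := Quot.exists_rep E
  obtain ⟨a, b, h, rfl⟩ := Finset.card_eq_two.1 hs
  exact ⟨i, a, b, h, rfl⟩

/-- The edge of the triangulation given by an oriented edge of a tetrahedron. -/
def OrderedEdge.toEdge (q : OrderedEdge n) : P.Edge := P.edge q.1.1 q.2

/-- The oriented edges after gluing. -/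
abbrev OrientedEdge : Type := Quot P.OrderedEdgeRel

theorem edgeRel_glueEdge {q : OrderedEdge n} {f : Fin 4} (ha : f ≠ q.1.2.1) (hb : f ≠ q.1.2.2) :
    P.EdgeRel (q.1.1, ⟨{q.1.2.1, q.1.2.2}, Finset.card_pair q.2⟩)
      ((P.glueEdge f q).1.1, ⟨{(P.glueEdge f q).1.2.1, (P.glueEdge f q).1.2.2},
        Finset.card_pair (P.glueEdge f q).2⟩) := by
  refine ⟨f, by simp [ha, hb], rfl, ?_⟩
  ext v
  simp [glueEdge, Finset.map_insert]

theorem toEdge_eq_of_orderedEdgeRel {q r : OrderedEdge n} (h : P.OrderedEdgeRel q r) :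
    q.toEdge P = r.toEdge P := by
  obtain ⟨f, ha, hb, rfl⟩ := h
  exact Quot.sound (P.edgeRel_glueEdge ha hb)

theorem orderedEdgeRel_swap {q r : OrderedEdge n} (h : P.OrderedEdgeRel q r) :
    P.OrderedEdgeRel q.swap r.swap := by
  obtain ⟨f, ha, hb, rfl⟩ := h
  exact ⟨f, hb, ha, rfl⟩

/-- The underlying edge of an oriented edge. -/
def OrientedEdge.toEdge : P.OrientedEdge → P.Edge :=
  Quot.lift (fun q => q.toEdge P) fun _ _ h => P.toEdge_eq_of_orderedEdgeRel h

theorem mk_eq_or_mk_swap_eq {q r : OrderedEdge n} (h : q.toEdge P = r.toEdge P) :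
    (Quot.mk _ r : P.OrientedEdge) = Quot.mk _ q ∨
      (Quot.mk _ r : P.OrientedEdge) = Quot.mk _ q.swap := by
  -- the set of orientations of an edge
  let K : TetrahedronEdge n → Set P.OrientedEdge := fun p =>
    {x | ∃ q : OrderedEdge n, q.1.1 = p.1 ∧ ({q.1.2.1, q.1.2.2} : Finset (Fin 4)) = p.2.1 ∧
      Quot.mk _ q = x}
  have hK : ∀ q : OrderedEdge n, K (q.1.1, ⟨{q.1.2.1, q.1.2.2}, Finset.card_pair q.2⟩) =
      {Quot.mk _ q, Quot.mk _ q.swap} := by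
    intro q
    ext x
    constructor
    · rintro ⟨r, hr1, hr2, rfl⟩
      have hr2' : ({r.1.2.1, r.1.2.2} : Finset (Fin 4)) = {q.1.2.1, q.1.2.2} := hr2
      have hmem : r.1.2.1 ∈ ({q.1.2.1, q.1.2.2} : Finset (Fin 4)) := hr2' ▸ by simp
      have hmem' : r.1.2.2 ∈ ({q.1.2.1, q.1.2.2} : Finset (Fin 4)) := hr2' ▸ by simp
      rw [Finset.mem_insert, Finset.mem_singleton] at hmem hmem'
      have hne := r.2
      rcases hmem with h | h <;> rcases hmem' with h' | h'
      · exact (hne (h.trans h'.symm)).elim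
      · exact .inl (congrArg _ (Subtype.ext (Prod.ext hr1 (Prod.ext h h'))))
      · exact .inr (congrArg _ (Subtype.ext (Prod.ext hr1 (Prod.ext h h'))))
      · exact (hne (h.trans h'.symm)).elim
    · rintro (rfl | rfl)
      · exact ⟨q, rfl, rfl, rfl⟩
      · exact ⟨q.swap, rfl, Finset.pair_comm _ _, rfl⟩
  have hrel : ∀ p p', P.EdgeRel p p' → K p = K p' := by
    rintro ⟨i, s, hs⟩ ⟨i', s', hs'⟩ ⟨f, hf, h1, h2⟩
    obtain ⟨a, b, hab, rfl⟩ := Finset.card_eq_two.1 hs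
    have hfa : f ≠ a ∧ f ≠ b := by simpa using hf
    let q : OrderedEdge n := ⟨(i, a, b), hab⟩
    have hg : ((i', ⟨s', hs'⟩) : TetrahedronEdge n) = ((P.glueEdge f q).1.1,
        ⟨{(P.glueEdge f q).1.2.1, (P.glueEdge f q).1.2.2},
          Finset.card_pair (P.glueEdge f q).2⟩) := by
      refine Prod.ext h1 (Subtype.ext ?_)
      rw [h2]
      ext v
      simp [glueEdge, q, Finset.map_insert]
    rw [hg, hK (P.glueEdge f q)]
    have hr : P.OrderedEdgeRel q (P.glueEdge f q) := ⟨f, hfa.1, hfa.2, rfl⟩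
    rw [← Quot.sound hr, ← Quot.sound (P.orderedEdgeRel_swap hr)]
    exact hK q
  have h' := congrArg (Quot.lift K hrel) h
  change K _ = K _ at h'
  rw [hK, hK] at h'
  have : (Quot.mk _ r : P.OrientedEdge) ∈ ({Quot.mk _ q, Quot.mk _ q.swap} : Set P.OrientedEdge) :=
    h' ▸ Set.mem_insert _ _
  exact this

theorem card_orientedEdge (hswap : ∀ q, ¬ Relation.EqvGen P.OrderedEdgeRel q q.swap) :
    Nat.card P.OrientedEdge = 2 * Nat.card P.Edge := by
  have : Finite P.Edge := Finite.of_surjective (Quot.mk P.EdgeRel) Quot.mk_surjective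
  have : Fintype P.Edge := Fintype.ofFinite _
  rw [Nat.card_congr (Equiv.sigmaFiberEquiv (OrientedEdge.toEdge P)).symm, Nat.card_sigma,
    Finset.sum_const_nat (m := 2), Finset.card_univ, Nat.card_eq_fintype_card, mul_comm]
  intro E _
  obtain ⟨i, a, b, h, rfl⟩ := P.exists_edge_eq E
  let q : OrderedEdge n := ⟨(i, a, b), h⟩
  have hfib : {x | OrientedEdge.toEdge P x = P.edge i h} =
      {(Quot.mk _ q : P.OrientedEdge), Quot.mk _ q.swap} := by
    ext x
    constructor
    · intro hx
      obtain ⟨r, rfl⟩ := Quot.exists_rep x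
      exact P.mk_eq_or_mk_swap_eq (q := q) hx.symm
    · rintro (rfl | rfl)
      · rfl
      · exact (P.edge_comm i h).symm
  have hne : (Quot.mk _ q : P.OrientedEdge) ≠ Quot.mk _ q.swap := fun h =>
    hswap q (Quot.eqvGen_exact h)
  change Nat.card {x | OrientedEdge.toEdge P x = P.edge i h} = 2
  rw [hfib, Nat.card_coe_set_eq, Set.ncard_pair hne]

/-- The oriented edge from the vertex of a link triangle through one of its corners. -/
def cornerEdge {ν : P.IdealVertex} (x : P.LinkTriangle ν × Fin 3) : OrderedEdge n :=
  ⟨(x.1.1.1, x.1.1.2, x.1.1.2.succAbove x.2), (Fin.succAbove_ne _ _).symm⟩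

theorem orderedEdgeRel_cornerEdge {ν : P.IdealVertex} {x y : P.LinkTriangle ν × Fin 3}
    (h : (P.linkGluing ν).CornerRel x y) :
    P.OrderedEdgeRel (P.cornerEdge x) (P.cornerEdge y) := by
  obtain ⟨F, hF, h1, h2⟩ := h
  refine ⟨x.1.1.2.succAbove F, Fin.succAbove_ne _ _, fun h => hF (Fin.succAbove_right_injective h),
    Subtype.ext (Prod.ext ?_ (Prod.ext ?_ ?_))⟩
  · exact congrArg (fun t => t.1.1) h1
  · exact congrArg (fun t => t.1.2) h1
  · simp only [cornerEdge, h1, h2]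
    exact succAbove_linkPerm _ _ _

theorem exists_cornerEdge_eq (q : OrderedEdge n) :
    ∃ x : P.LinkTriangle (P.idealVertex q.1.1 q.1.2.1) × Fin 3, P.cornerEdge x = q := by
  obtain ⟨u, hu⟩ := Fin.exists_succAbove_eq q.2.symm
  exact ⟨(⟨(q.1.1, q.1.2.1), rfl⟩, u), Subtype.ext (Prod.ext rfl (Prod.ext rfl hu))⟩

/-- The corners of the links after gluing are the oriented edges. -/
noncomputable def linkVertexEquiv :
    (Σ ν, (P.linkGluing ν).Vertex) ≃ P.OrientedEdge := by
  let G : OrderedEdge n → Σ ν, (P.linkGluing ν).Vertex := fun q =>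
    ⟨_, Quot.mk _ (P.exists_cornerEdge_eq q).choose⟩
  have hG : ∀ (ν) (x : P.LinkTriangle ν × Fin 3), G (P.cornerEdge x) = ⟨ν, Quot.mk _ x⟩ := by
    rintro ν ⟨⟨⟨i, v⟩, rfl⟩, u⟩
    have h := (P.exists_cornerEdge_eq (P.cornerEdge (ν := P.idealVertex i v)
      (⟨(i, v), rfl⟩, u))).choose_spec
    refine Sigma.ext rfl (heq_of_eq (congrArg _ ?_))
    have h1 := congrArg (fun q => (q.1.1, q.1.2.1)) h
    refine Prod.ext (Subtype.ext h1) ?_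
    have h2 := congrArg (fun q => q.1.2.2) h
    have h3 := congrArg Prod.snd h1
    simp only [cornerEdge] at h2 h3
    rw [h3] at h2
    exact Fin.succAbove_right_injective h2
  have hrel : ∀ q r, P.OrderedEdgeRel q r → G q = G r := by
    rintro q _ ⟨f, ha, hb, rfl⟩
    obtain ⟨ν, ⟨t, u⟩, rfl⟩ : ∃ (ν : P.IdealVertex) (x : P.LinkTriangle ν × Fin 3),
        P.cornerEdge x = q := ⟨_, P.exists_cornerEdge_eq q⟩
    obtain ⟨F, rfl⟩ := Fin.exists_succAbove_eq ha
    have hF : F ≠ u := fun h => hb (h ▸ rfl)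
    have hr : P.glueEdge ((P.cornerEdge (t, u)).1.2.1.succAbove F) (P.cornerEdge (t, u)) =
        P.cornerEdge ((P.linkGluing _).target t F, (P.linkGluing _).perm t F u) :=
      Subtype.ext (Prod.ext rfl (Prod.ext rfl (succAbove_linkPerm _ _ _).symm))
    rw [hr, hG, hG]
    exact Sigma.ext rfl (heq_of_eq (Quot.sound ⟨F, hF, rfl, rfl⟩))
  exact
    { toFun := fun x => Quot.lift (fun y => (Quot.mk _ (P.cornerEdge y) : P.OrientedEdge))
        (fun _ _ h => Quot.sound (P.orderedEdgeRel_cornerEdge h)) x.2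
      invFun := Quot.lift G hrel
      left_inv := by
        rintro ⟨ν, x⟩
        obtain ⟨x, rfl⟩ := Quot.exists_rep x
        exact hG ν x
      right_inv := by
        intro x
        obtain ⟨q, rfl⟩ := Quot.exists_rep x
        exact congrArg _ (P.exists_cornerEdge_eq q).choose_spec }

instance (ν : P.IdealVertex) : Finite (P.linkGluing ν).Vertex :=
  Finite.of_surjective (Quot.mk _) Quot.mk_surjective

theorem sum_card_vertex_linkGluing [Fintype P.IdealVertex]
    (hswap : ∀ q, ¬ Relation.EqvGen P.OrderedEdgeRel q q.swap) :
    ∑ ν, Nat.card (P.linkGluing ν).Vertex = 2 * Nat.card P.Edge := by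
  rw [← P.card_orientedEdge hswap, ← Nat.card_congr P.linkVertexEquiv, Nat.card_sigma]

theorem sum_card_linkTriangle [Fintype P.IdealVertex] :
    ∑ ν, Nat.card (P.LinkTriangle ν) = 4 * n := by
  rw [← Nat.card_sigma, Nat.card_congr (Equiv.sigmaFiberEquiv fun t : Fin n × Fin 4 =>
    P.idealVertex t.1 t.2)]
  simp [mul_comm]

end FacePairing

/-! ### Gluings with few edges -/

namespace FacePairing

variable {n : ℕ} (P : FacePairing 3 n)

theorem sum_idealVertex_eq_of_edgeRel {R : Type*} [AddCommMonoid R] (f : P.IdealVertex → R)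
    {p p' : TetrahedronEdge n} (h : P.EdgeRel p p') :
    ∑ a ∈ p.2.1, f (P.idealVertex p.1 a) = ∑ a ∈ p'.2.1, f (P.idealVertex p'.1 a) := by
  obtain ⟨k, hk, h1, h2⟩ := h
  rw [h1, h2, Finset.sum_map]
  refine Finset.sum_congr rfl fun a ha => ?_
  have hka : k ≠ a := fun h => hk (h ▸ ha)
  exact congrArg f (P.idealVertex_target p.1 hka).symm

/-- The coboundary of a function on the ideal vertices, a function on the edges. -/
noncomputable def coboundary : (P.IdealVertex → ZMod 2) →ₗ[ZMod 2] (P.Edge → ZMod 2) where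
  toFun f := Quot.lift (fun p => ∑ a ∈ p.2.1, f (P.idealVertex p.1 a))
    fun _ _ h => P.sum_idealVertex_eq_of_edgeRel f h
  map_add' f f' := by
    ext E
    obtain ⟨p, rfl⟩ := Quot.exists_rep E
    exact Finset.sum_add_distrib
  map_smul' r f := by
    ext E
    obtain ⟨p, rfl⟩ := Quot.exists_rep E
    exact (Finset.mul_sum _ _ _).symm

theorem coboundary_edge (f : P.IdealVertex → ZMod 2) (i : Fin n) {a b : Fin 4} (h : a ≠ b) :
    P.coboundary f (P.edge i h) = f (P.idealVertex i a) + f (P.idealVertex i b) :=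
  Finset.sum_pair h

/-- The ideal vertices at the ends of an edge. -/
def ends (E : P.Edge) : Set P.IdealVertex :=
  Quot.lift (fun p : TetrahedronEdge n => P.idealVertex p.1 '' (p.2.1 : Set (Fin 4)))
    (by
      rintro p p' ⟨k, hk, h1, h2⟩
      rw [h1, h2, Finset.coe_map, Set.image_image]
      refine Set.image_congr fun a ha => ?_
      have hka : k ≠ a := fun h => hk (h ▸ ha)
      exact (P.idealVertex_target p.1 hka).symm) E

theorem ends_edge (i : Fin n) {a b : Fin 4} (h : a ≠ b) :
    P.ends (P.edge i h) = {P.idealVertex i a, P.idealVertex i b} := by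
  change P.idealVertex i '' (({a, b} : Finset (Fin 4)) : Set (Fin 4)) = _
  rw [Finset.coe_pair, Set.image_pair]

instance : Finite P.Edge := Finite.of_surjective (Quot.mk P.EdgeRel) Quot.mk_surjective

/-- The triangulation being connected, only the constants have coboundary zero. -/
theorem finrank_range_coboundary
    (hconn : ∀ Q : Fin n → Prop, (∀ i f, Q i → Q (P.target i f)) → ∀ i j, Q i → Q j) (i₀ : Fin n) :
    Module.finrank (ZMod 2) (LinearMap.range P.coboundary) + 1 = Nat.card P.IdealVertex := by
  let _ := Fintype.ofFinite P.IdealVertex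
  have hker : LinearMap.ker P.coboundary = Submodule.span (ZMod 2) {1} := by
    refine le_antisymm (fun f hf => ?_) ?_
    · rw [LinearMap.mem_ker] at hf
      have htet : ∀ i a b, f (P.idealVertex i a) = f (P.idealVertex i b) := by
        intro i a b
        by_cases h : a = b
        · rw [h]
        · have h1 := P.coboundary_edge f i h
          rw [hf, Pi.zero_apply] at h1
          grind
      have hall := hconn (fun i => ∀ a, f (P.idealVertex i a) = f (P.idealVertex i₀ 0)) (by
        intro i k hi a
        obtain ⟨b, hb⟩ := exists_ne k
        rw [htet _ a (P.perm i k b), P.idealVertex_target i hb.symm, hi b]) i₀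
      refine Submodule.mem_span_singleton.2 ⟨f (P.idealVertex i₀ 0), ?_⟩
      ext ν
      obtain ⟨⟨i, a⟩, rfl⟩ := Quot.exists_rep ν
      change f (P.idealVertex i₀ 0) * 1 = f (P.idealVertex i a)
      rw [mul_one, hall i (fun a => htet i₀ a 0) a]
    · rw [Submodule.span_singleton_le_iff_mem, LinearMap.mem_ker]
      ext E
      obtain ⟨i, a, b, h, rfl⟩ := P.exists_edge_eq E
      rw [P.coboundary_edge]
      exact (by decide : (1 : ZMod 2) + 1 = 0)
  have h1 := LinearMap.finrank_range_add_finrank_ker P.coboundary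
  have hne : (1 : P.IdealVertex → ZMod 2) ≠ 0 := fun h =>
    one_ne_zero (congrFun h (P.idealVertex i₀ 0))
  rw [hker, finrank_span_singleton hne, Module.finrank_fintype_fun_eq_card] at h1
  rw [h1, Nat.card_eq_fintype_card]

/-- The sum of the values at the three edges of a face. -/
noncomputable def faceSum (i : Fin n) {a b c : Fin 4} (hab : a ≠ b) (hbc : b ≠ c) (hca : c ≠ a) :
    (P.Edge → ZMod 2) →ₗ[ZMod 2] ZMod 2 :=
  LinearMap.proj (R := ZMod 2) (φ := fun _ => ZMod 2) (P.edge i hab) +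
    LinearMap.proj (R := ZMod 2) (φ := fun _ => ZMod 2) (P.edge i hbc) +
    LinearMap.proj (R := ZMod 2) (φ := fun _ => ZMod 2) (P.edge i hca)

theorem faceSum_apply (i : Fin n) {a b c : Fin 4} (hab : a ≠ b) (hbc : b ≠ c) (hca : c ≠ a)
    (x : P.Edge → ZMod 2) :
    P.faceSum i hab hbc hca x = x (P.edge i hab) + x (P.edge i hbc) + x (P.edge i hca) := rfl

theorem faceSum_one (i : Fin n) {a b c : Fin 4} (hab : a ≠ b) (hbc : b ≠ c) (hca : c ≠ a) :
    P.faceSum i hab hbc hca 1 = 1 :=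
  (by decide : (1 : ZMod 2) + 1 + 1 = 1)

theorem faceSum_coboundary (i : Fin n) {a b c : Fin 4} (hab : a ≠ b) (hbc : b ≠ c) (hca : c ≠ a)
    (f : P.IdealVertex → ZMod 2) : P.faceSum i hab hbc hca (P.coboundary f) = 0 := by
  rw [faceSum_apply, coboundary_edge, coboundary_edge, coboundary_edge]
  grind

theorem one_notMem_range_coboundary (i₀ : Fin n) : 1 ∉ LinearMap.range P.coboundary := by
  rintro ⟨f, hf⟩
  have h1 := P.faceSum_one i₀ (a := 0) (b := 1) (c := 2) (by decide) (by decide) (by decide)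
  rw [← hf, faceSum_coboundary] at h1
  exact zero_ne_one h1

/-- The boundary of a face is a cycle and, having odd weight, is not zero. Hence the coboundaries
are a proper subspace of the functions on the edges. -/
theorem card_idealVertex_le_card_edge
    (hconn : ∀ Q : Fin n → Prop, (∀ i f, Q i → Q (P.target i f)) → ∀ i j, Q i → Q j) (i₀ : Fin n) :
    Nat.card P.IdealVertex ≤ Nat.card P.Edge := by
  let _ := Fintype.ofFinite P.Edge
  rw [← P.finrank_range_coboundary hconn i₀, Nat.card_eq_fintype_card,
    ← Module.finrank_fintype_fun_eq_card (ZMod 2)]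
  refine Submodule.finrank_lt fun h => P.one_notMem_range_coboundary i₀ ?_
  rw [h]
  trivial

/-- If there are as few edges as possible, then the boundaries of all faces are the same cycle,
since the coboundaries are a hyperplane. -/
theorem faceSum_eq_faceSum
    (hconn : ∀ Q : Fin n → Prop, (∀ i f, Q i → Q (P.target i f)) → ∀ i j, Q i → Q j)
    (hcard : Nat.card P.Edge = Nat.card P.IdealVertex) {i j : Fin n} {a b c a' b' c' : Fin 4}
    (hab : a ≠ b) (hbc : b ≠ c) (hca : c ≠ a) (hab' : a' ≠ b') (hbc' : b' ≠ c') (hca' : c' ≠ a') :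
    P.faceSum i hab hbc hca = P.faceSum j hab' hbc' hca' := by
  let _ := Fintype.ofFinite P.Edge
  let S := LinearMap.eqLocus (P.faceSum i hab hbc hca) (P.faceSum j hab' hbc' hca')
  have hlt : LinearMap.range P.coboundary < S := by
    refine lt_of_le_of_ne ?_ fun h => P.one_notMem_range_coboundary i ?_
    · rintro _ ⟨f, rfl⟩
      exact (P.faceSum_coboundary i hab hbc hca f).trans
        (P.faceSum_coboundary j hab' hbc' hca' f).symm
    · rw [h]
      exact (P.faceSum_one i hab hbc hca).trans (P.faceSum_one j hab' hbc' hca').symm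
  have h1 := Submodule.finrank_lt_finrank_of_lt hlt
  have h2 := P.finrank_range_coboundary hconn i
  have h3 : Module.finrank (ZMod 2) S = Module.finrank (ZMod 2) (P.Edge → ZMod 2) := by
    refine le_antisymm (Submodule.finrank_le _) ?_
    rw [Module.finrank_fintype_fun_eq_card, ← Nat.card_eq_fintype_card, hcard]
    omega
  exact LinearMap.eqLocus_eq_top.1 (Submodule.eq_top_of_finrank_eq h3)

/-- If there are as few edges as possible, then the common boundary of all faces is a single edge:
if it consisted of three edges, then all three of them would occur at each vertex of a tetrahedron,
so that their ends could not be different. -/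
theorem exists_faceSum_eq_apply
    (hconn : ∀ Q : Fin n → Prop, (∀ i f, Q i → Q (P.target i f)) → ∀ i j, Q i → Q j) (i₀ : Fin n)
    (hcard : Nat.card P.Edge = Nat.card P.IdealVertex) :
    ∃ E₀, ∀ (i : Fin n) {a b c : Fin 4} (hab : a ≠ b) (hbc : b ≠ c) (hca : c ≠ a)
      (x : P.Edge → ZMod 2), P.faceSum i hab hbc hca x = x E₀ := by
  classical
  let h01 : (0 : Fin 4) ≠ 1 := by decide
  let h12 : (1 : Fin 4) ≠ 2 := by decide
  let h20 : (2 : Fin 4) ≠ 0 := by decide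
  set X := P.edge i₀ h01
  set Y := P.edge i₀ h12
  set Z := P.edge i₀ h20
  have key : ∀ (i : Fin n) {a b c : Fin 4} (hab : a ≠ b) (hbc : b ≠ c) (hca : c ≠ a)
      (x : P.Edge → ZMod 2), x (P.edge i hab) + x (P.edge i hbc) + x (P.edge i hca) =
        x X + x Y + x Z := fun i a b c hab hbc hca x => by
    rw [← P.faceSum_apply, P.faceSum_eq_faceSum hconn hcard (j := i₀) hab hbc hca h01 h12 h20]
    rfl
  simp only [faceSum_apply]
  by_cases hXY : X = Y
  · refine ⟨Z, fun i a b c hab hbc hca x => ?_⟩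
    rw [key i hab hbc hca, hXY]
    grind
  by_cases hYZ : Y = Z
  · refine ⟨X, fun i a b c hab hbc hca x => ?_⟩
    rw [key i hab hbc hca, hYZ]
    grind
  by_cases hXZ : X = Z
  · refine ⟨Y, fun i a b c hab hbc hca x => ?_⟩
    rw [key i hab hbc hca, hXZ]
    grind
  exfalso
  have hne : ∀ (i : Fin n) {a b c : Fin 4} (hab : a ≠ b) (hbc : b ≠ c), c ≠ a →
      P.edge i hab ≠ P.edge i hbc := by
    intro i a b c hab hbc hca h
    have h1 := key i hab hbc hca (fun E => if E = X then 1 else 0)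
    have h2 := key i hab hbc hca (fun E => if E = Y then 1 else 0)
    simp only [h, if_true, hXY, Ne.symm hXY, Ne.symm hYZ, Ne.symm hXZ, if_false] at h1 h2
    have h3 : P.edge i hca = X := by
      by_contra h
      simp only [h, if_false] at h1
      split_ifs at h1 <;> revert h1 <;> decide
    have h4 : P.edge i hca = Y := by
      by_contra h
      simp only [h, if_false] at h2
      split_ifs at h2 <;> revert h2 <;> decide
    exact hXY (h3.symm.trans h4)
  have hthird : ∀ a b : Fin 4, ∃ c, c ≠ a ∧ b ≠ c := by decide
  have hmem : ∀ E : P.Edge, E = X ∨ E = Y ∨ E = Z := by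
    intro E
    obtain ⟨i, a, b, hab, rfl⟩ := P.exists_edge_eq E
    obtain ⟨c, hca, hbc⟩ := hthird a b
    have h1 := key i hab hbc hca (fun E => if E = P.edge i hab then 1 else 0)
    have h2 := hne i hab hbc hca
    have h3 := hne i hca hab hbc
    simp only [if_true, h2.symm, h3, if_false, add_zero] at h1
    by_contra h
    rw [not_or, not_or] at h
    simp only [Ne.symm h.1, Ne.symm h.2.1, Ne.symm h.2.2, if_false, add_zero] at h1
    exact one_ne_zero h1
  -- the three edges of a tetrahedron at a given vertex are different, hence are `X`, `Y` and `Z`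
  have hends : ∀ ν, ν ∈ P.ends X := by
    intro ν
    obtain ⟨⟨i, a⟩, rfl⟩ := Quot.exists_rep ν
    have : ∀ a : Fin 4, ∃ b c d, a ≠ b ∧ a ≠ c ∧ a ≠ d ∧ b ≠ c ∧ b ≠ d ∧ c ≠ d := by decide
    obtain ⟨b, c, d, hab, hac, had, hbc, hbd, hcd⟩ := this a
    have h1 := hne i hab.symm hac hbc.symm
    have h2 := hne i hab.symm had hbd.symm
    have h3 := hne i hac.symm had hcd.symm
    rw [← P.edge_comm i hab] at h1 h2
    rw [← P.edge_comm i hac] at h3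
    have hin : ∀ {b : Fin 4} (h : a ≠ b), P.idealVertex i a ∈ P.ends (P.edge i h) := fun h => by
      rw [P.ends_edge]
      exact .inl rfl
    have : P.edge i hab = X ∨ P.edge i hac = X ∨ P.edge i had = X := by
      have h4 := hmem (P.edge i hab)
      have h5 := hmem (P.edge i hac)
      have h6 := hmem (P.edge i had)
      grind
    rcases this with h | h | h <;> rw [← h] <;> exact hin _
  have h3 : 3 ≤ Nat.card P.Edge := by
    rw [← Set.ncard_univ, ← Set.ncard_eq_three.2 ⟨X, Y, Z, hXY, hXZ, hYZ, rfl⟩]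
    exact Set.ncard_le_ncard (Set.subset_univ _)
  have h2 : Nat.card P.IdealVertex ≤ 2 := by
    have h : (Set.univ : Set P.IdealVertex) ⊆ P.ends X := fun ν _ => hends ν
    rw [P.ends_edge] at h
    rw [← Set.ncard_univ]
    exact (Set.ncard_le_ncard h).trans (Set.ncard_insert_le _ _ |>.trans (by simp))
  omega

theorem eq_of_pair_eq {α : Type*} {a b c : α} (h : ({a, c} : Set α) = {b, c}) : a = b := by
  have h1 : a ∈ ({b, c} : Set α) := h ▸ Set.mem_insert _ _
  have h2 : b ∈ ({a, c} : Set α) := h ▸ Set.mem_insert _ _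
  rcases h1 with h1 | h1
  · exact h1
  · rcases h2 with h2 | h2
    · exact h2.symm
    · exact h1.trans h2.symm

/-- If there are as few edges as possible, then there is an ideal vertex `v₀` such that the edges
join it to all the ideal vertices, and such that every tetrahedron has at most one vertex not
at `v₀`. -/
theorem exists_equiv_edge
    (hconn : ∀ Q : Fin n → Prop, (∀ i f, Q i → Q (P.target i f)) → ∀ i j, Q i → Q j) (i₀ : Fin n)
    (hcard : Nat.card P.Edge = Nat.card P.IdealVertex) :
    ∃ v₀, (∀ i a b, a ≠ b → P.idealVertex i a ≠ v₀ → P.idealVertex i b = v₀) ∧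
      ∃ D : P.IdealVertex ≃ P.Edge, ∀ w, P.ends (D w) = {w, v₀} := by
  classical
  obtain ⟨E₀, hE₀⟩ := P.exists_faceSum_eq_apply hconn i₀ hcard
  simp only [faceSum_apply] at hE₀
  have hother : ∀ (i : Fin n) {a b c : Fin 4} (hab : a ≠ b) (hbc : b ≠ c) (hca : c ≠ a),
      P.edge i hab = E₀ → P.edge i hbc = P.edge i hca := by
    intro i a b c hab hbc hca h
    by_contra hne
    have h1 := hE₀ i hab hbc hca (fun E => if E = P.edge i hbc then 1 else 0)
    simp only [h, if_true, Ne.symm hne, if_false] at h1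
    split_ifs at h1 <;> revert h1 <;> decide
  have hsome : ∀ (i : Fin n) {a b c : Fin 4} (hab : a ≠ b) (hbc : b ≠ c) (hca : c ≠ a),
      P.edge i hab = E₀ ∨ P.edge i hbc = E₀ ∨ P.edge i hca = E₀ := by
    intro i a b c hab hbc hca
    by_contra h
    rw [not_or, not_or] at h
    have h1 := hE₀ i hab hbc hca (fun E => if E = E₀ then 1 else 0)
    simp only [h.1, h.2.1, h.2.2, if_true, if_false, add_zero] at h1
    exact zero_ne_one h1
  -- in a face containing `E₀`, the other two sides are the same edge, so that `E₀` is a loop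
  have hloop : ∀ (i : Fin n) {a b c : Fin 4} (hab : a ≠ b), b ≠ c → c ≠ a →
      P.edge i hab = E₀ → ∃ v₀, P.ends E₀ = {v₀} := by
    intro i a b c hab hbc hca h
    have h1 := congrArg P.ends (hother i hab hbc hca h)
    rw [P.edge_comm i hca, P.ends_edge, P.ends_edge] at h1
    refine ⟨P.idealVertex i a, ?_⟩
    rw [← h, P.ends_edge, eq_of_pair_eq h1, Set.pair_eq_singleton]
  obtain ⟨v₀, hv₀⟩ : ∃ v₀, P.ends E₀ = {v₀} := by
    have h01 : (0 : Fin 4) ≠ 1 := by decide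
    have h12 : (1 : Fin 4) ≠ 2 := by decide
    have h20 : (2 : Fin 4) ≠ 0 := by decide
    rcases hsome i₀ h01 h12 h20 with h | h | h
    · exact hloop i₀ h01 h12 h20 h
    · exact hloop i₀ h12 h20 h01 h
    · exact hloop i₀ h20 h01 h12 h
  have htet : ∀ i a b, a ≠ b → P.idealVertex i a ≠ v₀ → P.idealVertex i b = v₀ := by
    intro i a b hab ha
    obtain ⟨c, hca, hbc⟩ : ∃ c, c ≠ a ∧ b ≠ c := by
      have : ∀ a b : Fin 4, ∃ c, c ≠ a ∧ b ≠ c := by decide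
      exact this a b
    have hnot : ∀ {d : Fin 4} (h : a ≠ d), P.edge i h ≠ E₀ := by
      intro d h hE
      have h1 := hE ▸ P.ends_edge i h
      rw [hv₀] at h1
      have h2 : P.idealVertex i a ∈ ({v₀} : Set P.IdealVertex) := h1 ▸ Set.mem_insert _ _
      exact ha h2
    rcases hsome i hab hbc hca with h | h | h
    · exact (hnot _ h).elim
    · have h1 := h ▸ P.ends_edge i hbc
      rw [hv₀] at h1
      have h2 : P.idealVertex i b ∈ ({v₀} : Set P.IdealVertex) := h1 ▸ Set.mem_insert _ _
      exact h2
    · rw [P.edge_comm] at h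
      exact (hnot _ h).elim
  refine ⟨v₀, htet, ?_⟩
  have hex : ∀ w, ∃ E, P.ends E = {w, v₀} := by
    intro w
    by_cases hw : w = v₀
    · exact ⟨E₀, by rw [hv₀, hw, Set.pair_eq_singleton]⟩
    · obtain ⟨⟨i, a⟩, rfl⟩ := Quot.exists_rep w
      obtain ⟨b, hb⟩ := exists_ne a
      refine ⟨P.edge i hb.symm, ?_⟩
      rw [P.ends_edge, htet i a b hb.symm hw]
      rfl
  choose D hD using hex
  have hinj : Function.Injective D := by
    intro w w' h
    have h1 := congrArg P.ends h
    rw [hD, hD] at h1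
    exact eq_of_pair_eq h1
  exact ⟨Equiv.ofBijective D (hinj.bijective_of_nat_card_le hcard.le), hD⟩

theorem exists_edge_eq_of_ends_eq {E : P.Edge} {w v₀ : P.IdealVertex} (hE : P.ends E = {w, v₀}) :
    ∃ (i : Fin n) (a b : Fin 4) (h : a ≠ b), E = P.edge i h ∧ P.idealVertex i a = v₀ ∧
      P.idealVertex i b = w := by
  obtain ⟨i, a, b, h, rfl⟩ := P.exists_edge_eq E
  rw [P.ends_edge] at hE
  have ha : P.idealVertex i a ∈ ({w, v₀} : Set P.IdealVertex) := hE ▸ Set.mem_insert _ _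
  rcases ha with ha | ha
  · rw [ha] at hE
    have hb : P.idealVertex i b = v₀ := by
      rw [Set.pair_comm, Set.pair_comm w v₀] at hE
      exact eq_of_pair_eq hE
    exact ⟨i, b, a, h.symm, P.edge_comm i h, hb, ha⟩
  · have ha' : P.idealVertex i a = v₀ := ha
    rw [ha', Set.pair_comm] at hE
    exact ⟨i, a, b, h, rfl, ha', eq_of_pair_eq hE⟩

theorem sum_incidence [Fintype P.Edge] : ∑ E, P.incidence E = 6 * n := by
  let m : TetrahedronEdge n → P.Edge := Quot.mk _
  have h := Nat.card_congr (Equiv.sigmaFiberEquiv m)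
  rw [Nat.card_sigma, Nat.card_prod, Nat.card_fin, Nat.card_eq_fintype_card,
    Fintype.card_finset_len, Fintype.card_fin] at h
  exact h.trans (mul_comm n 6)

theorem linkVertexEquiv_mk {ν : P.IdealVertex} (x : P.LinkTriangle ν × Fin 3) :
    P.linkVertexEquiv ⟨ν, Quot.mk _ x⟩ = Quot.mk _ (P.cornerEdge x) := rfl

section FewEdges

variable {P} {v₀ : P.IdealVertex} {D : P.IdealVertex ≃ P.Edge}

theorem edge_eq_of_ends_eq (hD : ∀ w, P.ends (D w) = {w, v₀})
    {E : P.Edge} {w : P.IdealVertex} (h : P.ends E = {w, v₀}) : E = D w := by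
  obtain ⟨w', rfl⟩ := D.surjective E
  rw [hD] at h
  rw [eq_of_pair_eq h]

theorem toEdge_cornerEdge
    (htet : ∀ i a b, a ≠ b → P.idealVertex i a ≠ v₀ → P.idealVertex i b = v₀)
    (hD : ∀ w, P.ends (D w) = {w, v₀}) {w : P.IdealVertex} (hw : w ≠ v₀)
    (x : P.LinkTriangle w × Fin 3) :
    (P.cornerEdge x).toEdge P = D w := by
  refine edge_eq_of_ends_eq hD ?_
  rw [OrderedEdge.toEdge, P.ends_edge]
  have h1 : P.idealVertex (P.cornerEdge x).1.1 (P.cornerEdge x).1.2.1 = w := x.1.2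
  rw [htet _ _ _ (P.cornerEdge x).2 (h1.trans_ne hw), h1]

/-- All edges starting at an ideal vertex `w` other than `v₀` are the edge `D w`, which is not a
loop. Hence the link of `w` has a single vertex. -/
theorem card_vertex_linkGluing_eq_one
    (htet : ∀ i a b, a ≠ b → P.idealVertex i a ≠ v₀ → P.idealVertex i b = v₀)
    (hD : ∀ w, P.ends (D w) = {w, v₀}) {w : P.IdealVertex} (hw : w ≠ v₀) :
    Nat.card (P.linkGluing w).Vertex = 1 := by
  rw [Nat.card_eq_one_iff_unique]
  obtain ⟨t⟩ : Nonempty (P.LinkTriangle w) := inferInstance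
  refine ⟨⟨fun x y => ?_⟩, ⟨Quot.mk _ (t, 0)⟩⟩
  obtain ⟨x, rfl⟩ := Quot.exists_rep x
  obtain ⟨y, rfl⟩ := Quot.exists_rep y
  have h1 : P.idealVertex (P.cornerEdge x).1.1 (P.cornerEdge x).1.2.1 = w := x.1.2
  have h2 : P.idealVertex (P.cornerEdge y).1.1 (P.cornerEdge y).1.2.1 = w := y.1.2
  have h : (Quot.mk _ (P.cornerEdge y) : P.OrientedEdge) = Quot.mk _ (P.cornerEdge x) := by
    refine (P.mk_eq_or_mk_swap_eq ((toEdge_cornerEdge htet hD hw x).trans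
      (toEdge_cornerEdge htet hD hw y).symm)).resolve_right fun h => hw ?_
    -- the initial points of the edges are different
    have h3 := congrArg (Quot.lift (fun q : OrderedEdge n => P.idealVertex q.1.1 q.1.2.1) (by
      rintro q _ ⟨f, ha, hb, rfl⟩
      exact (P.idealVertex_target _ ha).symm)) h
    change P.idealVertex _ _ = P.idealVertex _ _ at h3
    rw [h2] at h3
    rw [h3]
    exact htet _ _ _ (P.cornerEdge x).2 (h1.trans_ne hw)
  rw [← P.linkVertexEquiv_mk, ← P.linkVertexEquiv_mk] at h
  have h4 := P.linkVertexEquiv.injective h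
  exact (eq_of_heq (Sigma.mk.inj h4).2).symm

/-- The edge `D w` is met once by each corner of each triangle of the link of `w`. -/
theorem incidence_eq
    (htet : ∀ i a b, a ≠ b → P.idealVertex i a ≠ v₀ → P.idealVertex i b = v₀)
    (hD : ∀ w, P.ends (D w) = {w, v₀}) {w : P.IdealVertex} (hw : w ≠ v₀) :
    P.incidence (D w) = 3 * Nat.card (P.LinkTriangle w) := by
  let φ : P.LinkTriangle w × Fin 3 →
      {p : TetrahedronEdge n // (Quot.mk P.EdgeRel p : P.Edge) = D w} :=
    fun x => ⟨((P.cornerEdge x).1.1, ⟨_, Finset.card_pair (P.cornerEdge x).2⟩),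
      toEdge_cornerEdge htet hD hw x⟩
  have hbij : Function.Bijective φ := by
    constructor
    · intro x y h
      have h1 := congrArg (fun p => p.1.1) h
      have h2 := congrArg (fun p => p.1.2.1) h
      simp only [φ] at h1 h2
      have hx : P.idealVertex (P.cornerEdge x).1.1 (P.cornerEdge x).1.2.1 = w := x.1.2
      have hy : P.idealVertex (P.cornerEdge y).1.1 (P.cornerEdge y).1.2.1 = w := y.1.2
      have hy' := htet _ _ _ (P.cornerEdge y).2 (hy.trans_ne hw)
      have h3 : (P.cornerEdge x).1.2.1 ∈
          ({(P.cornerEdge y).1.2.1, (P.cornerEdge y).1.2.2} : Finset (Fin 4)) := h2 ▸ by simp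
      have h4 : (P.cornerEdge x).1.2.2 ∈
          ({(P.cornerEdge y).1.2.1, (P.cornerEdge y).1.2.2} : Finset (Fin 4)) := h2 ▸ by simp
      rw [Finset.mem_insert, Finset.mem_singleton] at h3 h4
      have h5 : (P.cornerEdge x).1.2.1 = (P.cornerEdge y).1.2.1 := by
        refine h3.resolve_right fun h => hw ?_
        rw [h1, h, hy'] at hx
        exact hx.symm
      have h6 : (P.cornerEdge x).1.2.2 = (P.cornerEdge y).1.2.2 := by
        refine h4.resolve_left fun h => (P.cornerEdge x).2 (h5.trans h.symm)
      have ht : x.1 = y.1 := Subtype.ext (Prod.ext h1 h5)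
      refine Prod.ext ht ?_
      have h7 : x.1.1.2.succAbove x.2 = y.1.1.2.succAbove y.2 := h6
      rw [ht] at h7
      exact Fin.succAbove_right_injective h7
    · rintro ⟨⟨i, s, hs⟩, hp⟩
      obtain ⟨a, b, hab, rfl⟩ := Finset.card_eq_two.1 hs
      have key : ∀ (a b : Fin 4) (hab : a ≠ b), P.idealVertex i a = w →
          ∃ x, (φ x).1 = (i, ⟨{a, b}, Finset.card_pair hab⟩) := by
        rintro a b hab rfl
        obtain ⟨u, rfl⟩ := Fin.exists_succAbove_eq hab.symm
        exact ⟨(⟨(i, a), rfl⟩, u), rfl⟩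
      have hends : ({P.idealVertex i a, P.idealVertex i b} : Set P.IdealVertex) = {w, v₀} := by
        rw [← P.ends_edge i hab, ← hD, ← hp]
        rfl
      have hw' : w ∈ ({P.idealVertex i a, P.idealVertex i b} : Set P.IdealVertex) :=
        hends ▸ Set.mem_insert _ _
      rcases hw' with h | h
      · obtain ⟨x, hx⟩ := key a b hab h.symm
        exact ⟨x, Subtype.ext hx⟩
      · obtain ⟨x, hx⟩ := key b a hab.symm (Set.mem_singleton_iff.1 h).symm
        refine ⟨x, Subtype.ext (hx.trans (Prod.ext rfl (Subtype.ext (Finset.pair_comm b a))))⟩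
  rw [incidence, ← Nat.card_congr (Equiv.ofBijective φ hbij), Nat.card_prod, Nat.card_fin, mul_comm]

end FewEdges

end FacePairing

/-! ### The boundary components -/

namespace IdealTriangulation

open FacePairing

variable {n : ℕ} {M : Type*} [TopologicalSpace M] {B : Set M}

theorem exists_tetrahedron [Nonempty M] (T : IdealTriangulation n M B)
    (hM : IsThreeManifoldWithBoundary M B) :
    Nonempty (Fin n) := by
  obtain ⟨x⟩ := ‹Nonempty M›
  obtain ⟨y, hy⟩ : ∃ y, y ∉ B := by
    by_cases hx : x ∈ B
    · obtain ⟨y, -, hy⟩ := exists_notMem_boundary hM hx Filter.univ_mem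
      exact ⟨y, hy⟩
    · exact ⟨x, hx⟩
  obtain ⟨p, -⟩ := T.exists_realize_eq hy
  exact ⟨p.1⟩

end IdealTriangulation

section Components

variable {M : Type*} {B : Set M} {g k : ℕ}

/-- The genus of a boundary component. -/
def componentGenus (g : ℕ) {k : ℕ} : Fin (k + 1) → ℕ := Fin.cons g fun _ => 1

variable [TopologicalSpace M] (h : B ≃ₜ ClosedSurface g ⊕ (Fin k × ClosedSurface 1))

/-- The boundary components, that of genus `g` being the first one. -/
def boundaryComponent : Fin (k + 1) → Set M := Fin.cons (genusComponent h) (torusComponent h)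

theorem exists_surface_range_eq (c : Fin (k + 1)) :
    ∃ σ : ClosedSurface (componentGenus g c) → M, Continuous σ ∧ Function.Injective σ ∧
      Set.range σ = boundaryComponent h c := by
  induction c using Fin.cases with
  | zero =>
    refine ⟨fun s => (h.symm (Sum.inl s) : M), ?_, ?_, rfl⟩
    · exact continuous_subtype_val.comp (h.symm.continuous.comp continuous_inl)
    · exact Subtype.val_injective.comp (h.symm.injective.comp Sum.inl_injective)
  | succ i =>
    refine ⟨fun s => (h.symm (Sum.inr (i, s)) : M), ?_, ?_, rfl⟩
    · exact continuous_subtype_val.comp (h.symm.continuous.comp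
        (continuous_inr.comp (Continuous.prodMk_right i)))
    · exact Subtype.val_injective.comp (h.symm.injective.comp
        (Sum.inr_injective.comp (Prod.mk_right_injective i)))

theorem disjoint_boundaryComponent {c d : Fin (k + 1)} (hcd : c ≠ d) :
    Disjoint (boundaryComponent h c) (boundaryComponent h d) := by
  rw [Set.disjoint_left]
  induction c using Fin.cases with
  | zero =>
    induction d using Fin.cases with
    | zero => exact (hcd rfl).elim
    | succ j =>
      rintro _ ⟨s, rfl⟩ ⟨s', hs⟩
      have := h.symm.injective (Subtype.val_injective hs)
      exact Sum.inr_ne_inl this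
  | succ i =>
    induction d using Fin.cases with
    | zero =>
      rintro _ ⟨s, rfl⟩ ⟨s', hs⟩
      have := h.symm.injective (Subtype.val_injective hs)
      exact Sum.inl_ne_inr this
    | succ j =>
      rintro _ ⟨s, rfl⟩ ⟨s', hs⟩
      have := h.symm.injective (Subtype.val_injective hs)
      exact hcd (congrArg (fun x => Fin.succ (Prod.fst x)) (Sum.inr_injective this)).symm

theorem iUnion_boundaryComponent : B = ⋃ c, boundaryComponent h c := by
  ext x
  rw [Set.mem_iUnion]
  constructor
  · intro hx
    rcases hs : h ⟨x, hx⟩ with s | ⟨i, s⟩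
    · exact ⟨0, s, by simp [← hs]⟩
    · exact ⟨i.succ, s, by simp [← hs]⟩
  · rintro ⟨c, hc⟩
    induction c using Fin.cases with
    | zero =>
      obtain ⟨s, rfl⟩ := hc
      exact Subtype.coe_prop _
    | succ i =>
      obtain ⟨s, rfl⟩ := hc
      exact Subtype.coe_prop _

end Components

theorem isPreconnected_boundaryComponent {M : Type*} [TopologicalSpace M] [T2Space M] {B : Set M}
    {g k : ℕ} (h : B ≃ₜ ClosedSurface g ⊕ (Fin k × ClosedSurface 1)) (c : Fin (k + 1)) :
    IsPreconnected (boundaryComponent h c) := by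
  obtain ⟨σ, hσ, hinj, hrange⟩ := exists_surface_range_eq h c
  have hπ := (oppositeSidesPairing (componentGenus g c)).isModel hσ hinj
  rw [← hrange, ← FacePairing.image_model]
  exact hπ.isPreconnected_range (convex_singleton 1) (by simp) (Set.singleton_nonempty 1)
    (isConnected_oppositeSidesPairing _)

theorem mainTheorem6 {M : Type*} [TopologicalSpace M] [T2Space M] [CompactSpace M]
    [ConnectedSpace M] (B : Set M) (hM : IsThreeManifoldWithBoundary M B) (g k : ℕ)
    (h : B ≃ₜ ClosedSurface g ⊕ (Fin k × ClosedSurface 1))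
    (n : ℕ) (T : IdealTriangulation n M B) :
    g + k ≤ n ∧
    (2 ≤ g → n = g + k →
      k ≤ g ∧
      (∀ i : Fin k,
        {t : Fin n | ∃ v, T.VertexOn t v (torusComponent h i) ∧
          ∀ w, w ≠ v → T.VertexOn t w (genusComponent h)}.ncard = 2) ∧
      {t : Fin n | ∀ v, T.VertexOn t v (genusComponent h)}.ncard = g - k ∧
      (∀ t : Fin n,
        (∃ i v, T.VertexOn t v (torusComponent h i) ∧
          ∀ w, w ≠ v → T.VertexOn t w (genusComponent h)) ∨
        ∀ v, T.VertexOn t v (genusComponent h)) ∧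
      ∃ e : Fin (k + 1) ≃ T.Edge,
        T.Joins (e 0) (genusComponent h) (genusComponent h) ∧
        T.incidence (e 0) = 6 * g ∧
        ∀ i : Fin k,
          T.Joins (e i.succ) (genusComponent h) (torusComponent h i) ∧
          T.incidence (e i.succ) = 6) := by
  let _ := Fintype.ofFinite T.IdealVertex
  let _ := Fintype.ofFinite T.Edge
  obtain ⟨i₀⟩ := T.exists_tetrahedron hM
  have hcompact : ∀ c, IsCompact (boundaryComponent h c) := fun c => by
    obtain ⟨σ, hσ, -, hrange⟩ := exists_surface_range_eq h c
    rw [← hrange]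
    exact isCompact_range hσ
  have hnonempty : ∀ c, (boundaryComponent h c).Nonempty := fun c => by
    obtain ⟨σ, -, -, hrange⟩ := exists_surface_range_eq h c
    rw [← hrange]
    exact ⟨σ (Quot.mk _ (0, FacePairing.toStdTriangle 0)), Set.mem_range_self _⟩
  obtain ⟨e, hsub, hopen, hon⟩ := T.exists_equiv_idealVertex hM (boundaryComponent h) hcompact
    (isPreconnected_boundaryComponent h) hnonempty (fun c d => disjoint_boundaryComponent h)
    (iUnion_boundaryComponent h)
  have hconn := T.forall_of_forall_target hM
  have hswap := T.not_eqvGen_swap hM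
  have hcardV : Nat.card T.IdealVertex = k + 1 := by
    rw [← Nat.card_congr e, Nat.card_fin]
  -- the numbers of triangles of the links
  let F : Fin (k + 1) → ℕ := fun c => Nat.card (T.LinkTriangle (e c))
  have hEuler : ∀ c, 2 * Nat.card (T.linkGluing (e c)).Vertex + 4 * componentGenus g c =
      F c + 4 := by
    intro c
    obtain ⟨σ, hσ, hinj, hrange⟩ := exists_surface_range_eq h c
    exact IdealTriangulation.two_mul_card_vertex_linkGluing hM
      ((Set.subset_iUnion _ c).trans (iUnion_boundaryComponent h).ge) (hsub c) (hopen c) hσ hinj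
      hrange
  have hF : ∑ c, F c = 4 * n := by
    rw [← T.sum_card_linkTriangle]
    exact e.sum_comp fun ν => Nat.card (T.LinkTriangle ν)
  have hF' : F 0 + ∑ i : Fin k, F i.succ = 4 * n := by rw [← hF, Fin.sum_univ_succ]
  have hcardE : Nat.card T.Edge + g = n + 1 := by
    have h1 := Finset.sum_congr rfl fun c (_ : c ∈ Finset.univ) => hEuler c
    simp only [Finset.sum_add_distrib, ← Finset.mul_sum] at h1
    rw [e.sum_comp fun ν => Nat.card (T.linkGluing ν).Vertex, T.sum_card_vertex_linkGluing hswap,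
      hF, Fin.sum_univ_succ] at h1
    simp only [componentGenus, Fin.cons_zero, Fin.cons_succ, Finset.sum_const, Finset.card_univ,
      Fintype.card_fin, smul_eq_mul, mul_one] at h1
    omega
  have hle := T.card_idealVertex_le_card_edge hconn i₀
  refine ⟨by omega, fun hg hn => ?_⟩
  obtain ⟨v₀, htet, D, hD⟩ := T.exists_equiv_edge hconn i₀ (by omega)
  -- the vertices of the tetrahedra that are not at `v₀`
  let A : Set (Fin n × Fin 4) := {x | T.idealVertex x.1 x.2 ≠ v₀}
  have hAinj : Set.InjOn Prod.fst A := by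
    rintro ⟨t, a⟩ ha ⟨t', b⟩ hb (rfl : t = t')
    by_contra hab
    exact hb (htet t a b (fun h => hab (h ▸ rfl)) ha)
  have hAle : A.ncard ≤ n := by
    rw [← hAinj.ncard_image]
    exact (Set.ncard_le_card _).trans_eq (Nat.card_fin n)
  obtain ⟨c₀, rfl⟩ := e.surjective v₀
  have hAcard : F c₀ + A.ncard = 4 * n := by
    have h1 := Set.ncard_add_ncard_compl A
    have h2 : F c₀ = Aᶜ.ncard := by
      rw [← Nat.card_coe_set_eq]
      exact Nat.card_congr (Equiv.subtypeEquivRight fun x => by simp [A])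
    rw [Nat.card_prod, Nat.card_fin, Nat.card_fin] at h1
    omega
  have hFc : ∀ c, c ≠ c₀ → F c + 2 = 4 * componentGenus g c := by
    intro c hc
    have h1 := hEuler c
    rw [FacePairing.card_vertex_linkGluing_eq_one htet hD (e.injective.ne hc)] at h1
    omega
  -- if the base vertex were at a torus, then the `4 * g - 2` triangles of the link at `Σ_g` would
  -- lie in different tetrahedra, as would those of the other links, which is too many
  have hc₀ : c₀ = 0 := by
    induction c₀ using Fin.cases with
    | zero => rfl
    | succ j =>
      exfalso
      have h0 := hFc 0 (Fin.succ_ne_zero j).symm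
      have h1 : ∑ i : Fin k, F i.succ = F j.succ + ∑ i ∈ Finset.univ.erase j, F i.succ :=
        (Finset.add_sum_erase _ _ (Finset.mem_univ j)).symm
      have h2 : ∑ i ∈ Finset.univ.erase j, F i.succ = (k - 1) * 2 := by
        rw [Finset.sum_const_nat (m := 2), Finset.card_erase_of_mem (Finset.mem_univ j),
          Finset.card_univ, Fintype.card_fin]
        intro i hi
        have := hFc i.succ fun h => (Finset.mem_erase.1 hi).1 (Fin.succ_injective _ h)
        simp only [componentGenus, Fin.cons_succ] at this
        omega
      have h3 : 0 < k := Fin.pos j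
      simp only [componentGenus, Fin.cons_zero] at h0
      omega
  subst hc₀
  have hF2 : ∀ i : Fin k, F i.succ = 2 := by
    intro i
    have := hFc i.succ (Fin.succ_ne_zero i)
    simp only [componentGenus, Fin.cons_succ] at this
    omega
  have hA : A.ncard = 2 * k := by
    have : ∑ i : Fin k, F i.succ = 2 * k := by simp [hF2, mul_comm]
    omega
  have hS : ∀ t v, T.VertexOn t v (genusComponent h) ↔ T.idealVertex t v = e 0 :=
    fun t v => hon t v 0
  have hT : ∀ (i : Fin k) t v, T.VertexOn t v (torusComponent h i) ↔
      T.idealVertex t v = e i.succ := fun i t v => hon t v i.succ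
  have hne : ∀ i : Fin k, e i.succ ≠ e 0 := fun i => e.injective.ne (Fin.succ_ne_zero i)
  simp only [IdealTriangulation.Joins, hS, hT]
  refine ⟨by omega, fun i => ?_, ?_, fun t => ?_, e.trans D, ?_, ?_, fun i => ⟨?_, ?_⟩⟩
  · have h1 : {t : Fin n | ∃ v, T.idealVertex t v = e i.succ ∧
        ∀ w, w ≠ v → T.idealVertex t w = e 0} =
        Prod.fst '' {x : Fin n × Fin 4 | T.idealVertex x.1 x.2 = e i.succ} := by
      ext t
      constructor
      · rintro ⟨v, hv, -⟩
        exact ⟨(t, v), hv, rfl⟩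
      · rintro ⟨⟨t, v⟩, hv, rfl⟩
        have hv' : T.idealVertex t v = e i.succ := hv
        exact ⟨v, hv', fun w hw => htet t v w hw.symm (hv'.trans_ne (hne i))⟩
    have h2 : {x : Fin n × Fin 4 | T.idealVertex x.1 x.2 = e i.succ} ⊆ A :=
      fun x hx => Eq.trans_ne hx (hne i)
    rw [h1, (hAinj.mono h2).ncard_image, ← Nat.card_coe_set_eq]
    exact hF2 i
  · have h1 : {t : Fin n | ∀ v, T.idealVertex t v = e 0} = (Prod.fst '' A)ᶜ := by
      ext t
      simp [A]
    have h2 := Set.ncard_add_ncard_compl (Prod.fst '' A)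
    rw [hAinj.ncard_image, Nat.card_fin] at h2
    rw [h1]
    omega
  · by_cases ht : ∀ v, T.idealVertex t v = e 0
    · exact .inr ht
    · obtain ⟨v, hv⟩ := not_forall.1 ht
      obtain ⟨c, hc⟩ := e.surjective (T.idealVertex t v)
      obtain ⟨i, rfl⟩ := Fin.exists_succ_eq.2 (fun h : c = 0 => hv (h ▸ hc.symm))
      exact .inl ⟨i, v, hc.symm, fun w hw => htet t v w hw.symm hv⟩
  · obtain ⟨t, a, b, hab, hE, ha, hb⟩ := T.exists_edge_eq_of_ends_eq (hD (e 0))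
    exact ⟨t, a, b, hab, hE, ha, hb⟩
  · have h1 := T.sum_incidence
    rw [← (e.trans D).sum_comp, Fin.sum_univ_succ, Finset.sum_const_nat (m := 6), Finset.card_univ,
      Fintype.card_fin] at h1
    · omega
    · intro i _
      have h2 := FacePairing.incidence_eq htet hD (hne i)
      rw [show Nat.card (T.LinkTriangle (e i.succ)) = 2 from hF2 i] at h2
      exact h2
  · obtain ⟨t, a, b, hab, hE, ha, hb⟩ := T.exists_edge_eq_of_ends_eq (hD (e i.succ))
    exact ⟨t, a, b, hab, hE, ha, hb⟩
  · have h2 := FacePairing.incidence_eq htet hD (hne i)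
    rw [show Nat.card (T.LinkTriangle (e i.succ)) = 2 from hF2 i] at h2
    exact h2
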